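/- Theorem 2. Notation: $\mathbb T^2=\mathbb R^2/\mathbb Z^2$, $\mathbb T^1_{2\pi}=\mathbb R/2\pi\mathbb Z$, $v(\theta)=(\cos\theta,\sin\theta)$, and for $a\ge 0$ let $\Omega_a=\mathbb T^1_{2\pi}\times[a,+\infty)\times[-1,1]$, with points $(\theta,s,h)$. The kernel $Q$ is defined for $|h'|\le h$ by $$Q(s,h|h')=\frac{6}{\pi^2}\begin{cases}1,&0\le s\le\frac1{1+h},\\ \dfrac{\frac1s-(1+h')}{h-h'},&\frac1{1+h}<s\le\frac1{1+h'},\\ 0,&s<0\text{ or }s>\frac1{1+h'},\end{cases}$$ and for all $h,h'\in[-1,1]$ by the symmetries $Q(s,h|h')=Q(s,h'|h)=Q(s,-h|-h')$. Put $E(s,h)=\int_s^\infty ds'\int_{-1}^1dh'\,Q(s',h|h')$. Let $X=\mathbb T^2$ or $X=\mathbb R^2$. A mild solution with initial datum $\mu_0\in L^1(X\times\Omega_0)$ is a function $\mu_t(x,\theta,s,h)$ with $$\mu_t(x,\theta,s,h)=\mu_0(x-tv(\theta),\theta,s+t,h)+\int_0^tdt'\int_{-1}^1dh'\,Q(s+t-t',h|h')\,\mu_{t'}\big(x-(t-t')v(\theta),\theta+\pi-2\arcsin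 h',0,h'\big)$$ for every $t\ge0$ and almost every $(x,\theta,s,h)$, and also at $s=0$ for almost every $(x,\theta,t,h)$, where $(x,\theta,t,h)\mapsto\mu_t(x,\theta,0,h)$ is integrable on $X\times\mathbb T^1_{2\pi}\times[0,T]\times[-1,1]$ for every $T>0$. For a function $f$ of $x\in X$ and further variables $y$, put $f^k(y)=\int_X e^{2\pi i k\cdot x}f(x,y)\,dx$, where $k\in\mathbb Z^2$ if $X=\mathbb T^2$ and $k\in\mathbb R^2$ if $X=\mathbb R^2$. There exists a constant $C>0$, depending only on $Q$, such that the following holds. (1) Let $p\in[1,+\infty]$, $k\in\mathbb Z^2\setminus\{(0,0)\}$ and $\mu_0\in L^1\cap L^p(\mathbb T^2\times\Omega_0)$, and let $\mu_t$ be the mild solution on $\mathbb T^2$ with initial datum $\mu_0$. Then for every $t\ge0$ one has $\mu_t\in L^1(\mathbb T^2\times\Omega_0)$ (so that $\mu_t^k$ is defined almost everywhere), $\mu_t^k\in L^p(\Omega_0)$, and $$\|\mu_t^k\|_{L^p(\Omega_0)}\le C\,\frac{\|\mu_0^k\|_{L^1(\Omega_0)}+\|\mu_0^k\|_{L^p(\Omega_0)}}{t+1}+C\Big[\|\mu_0^k\|_{L^1(\Omega_{t/4})}+\|\mu_0^k\|_{L^p(\Omega_{t/4})}\Big].$$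 In particular, if $\mu_0(x,\theta,s,h)=\mu_{in}(x,\theta)E(s,h)$ with $\mu_{in}\in L^p(\mathbb T^2\times\mathbb T^1_{2\pi})$, then $\mu_0\in L^1\cap L^p(\mathbb T^2\times\Omega_0)$ and for every $t\ge 0$ $$\|\mu_t^k\|_{L^p(\Omega_0)}\le\frac{C}{t+1}\,\|\mu_{in}^k\|_{L^p(\mathbb T^1_{2\pi})}.$$ (2) Let $k\in\mathbb R^2\setminus\{(0,0)\}$. The statements of (1) hold with $p=1$, with $\mathbb R^2$ in place of $\mathbb T^2$, with $\mu_0\in L^1(\mathbb R^2\times\Omega_0)$ (respectively $\mu_{in}\in L^1(\mathbb R^2\times\mathbb T^1_{2\pi})$), and with $C$ replaced by $\dfrac{C}{\min\{1,|k|^6\}}$. -/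

import Mathlib

open MeasureTheory Set
open scoped ENNReal

noncomputable section

namespace LorentzGas

instance fact_two_pi_pos : Fact ((0 : ℝ) < 2 * Real.pi) := ⟨Real.two_pi_pos⟩

/-! ### The transition kernel and the equilibrium density -/

/-- The kernel `Q(s, h | h')` in the region `|h'| ≤ h`. There `1 + h > 0` and `1 + h' ≥ 0`, so that
`s ≤ 1 / (1 + h)` is the inequality `s * (1 + h) ≤ 1`, and `s ≤ 1 / (1 + h')` is
`s * (1 + h') ≤ 1` (with `1 / 0 = ∞` when `h' = -1`). -/
def kernelBase (s h h' : ℝ) : ℝ :=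
  if s < 0 then 0
  else if s * (1 + h) ≤ 1 then 6 / Real.pi ^ 2
  else if s * (1 + h') ≤ 1 then 6 / Real.pi ^ 2 * ((1 / s - (1 + h')) / (h - h'))
  else 0

/-- The transition kernel `Q(s, h | h')` of the two-dimensional periodic Lorentz gas: the extension
of `kernelBase` from `|h'| ≤ h` to all `h`, `h'` by the symmetries
`Q(s, h | h') = Q(s, h' | h) = Q(s, -h | -h')`. -/
def Q (s h h' : ℝ) : ℝ :=
  if 0 ≤ h + h' then kernelBase s (max h h') (min h h')
  else kernelBase s (max (-h) (-h')) (min (-h) (-h'))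

theorem Q_eq_kernelBase (s : ℝ) {h h' : ℝ} (hh : |h'| ≤ h) : Q s h h' = kernelBase s h h' := by
  obtain ⟨h1, h2⟩ := abs_le.mp hh
  rw [Q, if_pos (by linarith), max_eq_left h2, min_eq_right h2]

theorem Q_swap (s h h' : ℝ) : Q s h h' = Q s h' h := by
  simp only [Q, add_comm h h', max_comm h h', min_comm h h', max_comm (-h) (-h'),
    min_comm (-h) (-h')]

theorem Q_neg (s h h' : ℝ) : Q s h h' = Q s (-h) (-h') := by
  unfold Q
  rcases lt_trichotomy (h + h') 0 with hlt | heq | hgt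
  · rw [if_neg (by linarith), if_pos (by linarith)]
  · obtain rfl : h' = -h := by linarith
    rw [if_pos (by linarith), if_pos (by linarith), neg_neg, max_comm, min_comm]
  · rw [if_pos hgt.le, if_neg (by linarith), neg_neg, neg_neg]

/-- The invariant density `E(s, h) = ∫_s^∞ ∫_{-1}^1 Q(s', h | h') dh' ds'`. -/
def E (s h : ℝ) : ℝ := ∫ s' in Ioi s, ∫ h' in (-1 : ℝ)..1, Q s' h h'

/-! ### The phase space -/

/-- The plane `ℝ²` with the Euclidean norm. -/
abbrev Plane := EuclideanSpace ℝ (Fin 2)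

/-- The flat torus `ℝ² / ℤ²`, with its measure of total mass `1`. -/
abbrev Torus := UnitAddTorus (Fin 2)

/-- The circle `ℝ / 2πℤ`, with its measure of total mass `2π`. -/
abbrev Circle2Pi := AddCircle (2 * Real.pi)

/-- The covering map `ℝ² → ℝ² / ℤ²`. -/
def torusProj (y : Plane) : Torus := fun i => (y i : UnitAddCircle)

/-- The unit velocity `v(θ) = (cos θ, sin θ)`. -/
def velocity (θ : Circle2Pi) : Plane := !₂[Real.cos_periodic.lift θ, Real.sin_periodic.lift θ]

/-- Lebesgue measure on the set of `(θ, s, h)` with `θ ∈ ℝ / 2πℤ`, `s ∈ [a, ∞)`, `h ∈ [-1, 1]`. -/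
def collisionMeasure (a : ℝ) : Measure (Circle2Pi × ℝ × ℝ) :=
  (volume : Measure Circle2Pi).prod
    ((volume.restrict (Ici a)).prod (volume.restrict (Icc (-1 : ℝ) 1)))

/-- Lebesgue measure on the set of `(x, θ, s, h)` with `x ∈ X`, `θ ∈ ℝ / 2πℤ`, `s ∈ [0, ∞)` and
`h ∈ [-1, 1]`. -/
def phaseMeasure (X : Type) [MeasureSpace X] : Measure (X × Circle2Pi × ℝ × ℝ) :=
  (volume : Measure X).prod (collisionMeasure 0)

/-! ### Mild solutions -/

/-- The right-hand side of the integral form of the kinetic equation, at time `t` and at the point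
`z = (x, θ, s, h)`. The position space is `X`, and `proj : ℝ² → X` is the covering map, by which
displacements in the plane act on `X`. -/
def mildRHS {X : Type} [Sub X] (proj : Plane → X) (μ₀ : X × Circle2Pi × ℝ × ℝ → ℝ)
    (μ : ℝ → X × Circle2Pi × ℝ × ℝ → ℝ) (t : ℝ) : X × Circle2Pi × ℝ × ℝ → ℝ
  | (x, θ, s, h) =>
    μ₀ (x - proj (t • velocity θ), θ, s + t, h) +
      ∫ t' in (0 : ℝ)..t, ∫ h' in (-1 : ℝ)..1,
        Q (s + t - t') h h' *
          μ t' (x - proj ((t - t') • velocity θ),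
            θ + ((Real.pi - 2 * Real.arcsin h' : ℝ) : Circle2Pi), 0, h')

/-- `μ` is a mild solution with initial datum `μ₀`. The equation involves the values of `μ` at
`s = 0`, a null set for each fixed time. They are therefore part of the data of `μ`: the density
`(x, θ, t, h) ↦ μ_t(x, θ, 0, h)` of the collisions is integrable over bounded time intervals, and
it satisfies the equation with `s = 0` almost everywhere in `(x, θ, t, h)`; at every time `t ≥ 0`
the equation holds for almost every `(x, θ, s, h)`. -/
structure IsMildSolution {X : Type} [Sub X] [MeasureSpace X] (proj : Plane → X)
    (μ₀ : X × Circle2Pi × ℝ × ℝ → ℝ) (μ : ℝ → X × Circle2Pi × ℝ × ℝ → ℝ) : Prop where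
  integrable_collisions : ∀ T : ℝ, 0 < T →
    Integrable (fun z : X × Circle2Pi × ℝ × ℝ => μ z.2.2.1 (z.1, z.2.1, 0, z.2.2.2))
      ((volume : Measure X).prod ((volume : Measure Circle2Pi).prod
        ((volume.restrict (Icc 0 T)).prod (volume.restrict (Icc (-1 : ℝ) 1)))))
  collisions_eq : ∀ᵐ z ∂phaseMeasure X,
    μ z.2.2.1 (z.1, z.2.1, 0, z.2.2.2) =
      mildRHS proj μ₀ μ z.2.2.1 (z.1, z.2.1, 0, z.2.2.2)
  eq : ∀ t : ℝ, 0 ≤ t → ∀ᵐ z ∂phaseMeasure X, μ t z = mildRHS proj μ₀ μ t z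

/-! ### Fourier coefficients -/

/-- The integral `∫ χ(x) f(x, y) dx`, as a function of `y`. -/
def partialTransform {X Y : Type} [MeasureSpace X] (χ : X → ℂ) (f : X × Y → ℝ) (y : Y) : ℂ :=
  ∫ x, χ x * (f (x, y) : ℂ)

/-- The Fourier coefficient in `x`, `∫ e^{2πi k·x} f(x, y) dx` over the torus, for `k ∈ ℤ²`. -/
def torusCoeff {Y : Type} (k : Fin 2 → ℤ) (f : Torus × Y → ℝ) : Y → ℂ :=
  partialTransform (fun x => UnitAddTorus.mFourier k x) f

/-- The Fourier coefficient in `x`, `∫ e^{2πi k·x} f(x, y) dx` over the plane, for `k ∈ ℝ²`. -/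
def planeCoeff {Y : Type} (k : Plane) (f : Plane × Y → ℝ) : Y → ℂ :=
  partialTransform (fun x => Complex.exp (2 * Real.pi * Complex.I * (inner ℝ k x : ℝ))) f

/-- The initial datum `μ_in(x, θ) E(s, h)`. -/
def productDatum {X : Type} (μin : X × Circle2Pi → ℝ) : X × Circle2Pi × ℝ × ℝ → ℝ
  | (x, θ, s, h) => μin (x, θ) * E s h

end LorentzGas

end

open LorentzGas

/-!
Along a free flight the time `σ` of the next collision is constant, so a mild solution is determined
by the density of collisions `c(x, θ, t, h) = μ_t(x, θ, 0, h)`. Its Fourier coefficient `f` in `x`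
solves a renewal equation `f = f₀ + K f` in the variables `(θ, t, h)`, where `f₀` comes from the
initial datum, and `K` is the collision operator with kernel `Q`, carrying the phase
`exp(i (t - t') ω(θ))` with `ω(θ) = 2π k · v(θ)` (`IsMildSolution.eLpNorm_partialTransform_le`).

The positive operator with kernel `Q` has norm `1` on every `L^p`, because `∫∫ Q ds dh' = 1`
(`ae_lintegral_Qe`, which rests on a dilogarithm identity and `∫_1^2 log u / (u - 1) du = π² / 12`).
Decay comes from phase cancellation over *two* collisions. In `K²`, integrate first over the time of
the intermediate collision: the modulus of the resulting kernel (`pairKernel`) is strictly smaller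
than that of the positive two-step kernel as soon as the frequencies before and after differ, and by
`le_lintegral_frequency_sub` they differ on average by an amount comparable to `|k|`. By Schur's
test (`eLpNorm_lintegral_mul_comp_le`) the positive operator `P` with kernel `|pairKernel|` has
norm at most `1 - δ` on every `L^p`, with `δ` a multiple of `min (1, |k|²)` (`eLpNorm_pairOp_le`).
Then `|f| ≤ |f₀| + K₊ |f₀| + P |f|`, with `K₊` the positive collision operator, and since `f` is
integrable over bounded times it is dominated by the Neumann series (`ae_le_iSup_picard`).

The rate in time follows from the tail `∫ Q(s, h | h') dh' = O(s⁻²)`, by weighting with a quadratic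
cutoff which vanishes before `T / 4` and equals `1` after `T`. This weight is almost subadditive
along flights, and the mass of `Q` weighted by the length of the flight is `O(1 / T)`
(`lintegral_lagWeight_mul_Qe_le`). Choosing the loss in subadditivity of order `δ` costs three
powers of `1 / δ` in all (`eLpNorm_collisionOp_before_le`), whence the factor `min (1, |k|⁶)⁻¹` in
the plane; on the torus `|k| ≥ 1`.

The torus and the plane are treated together, as an abelian group `X` with a map `ℝ² → X` and a
character `χ` on `X` that pulls back to `exp(2πi k · x)`. For product data the estimate reduces to
`E(s, h) = O(1 / (1 + s))`, with support where `|h|` is within `1 / s` of `1`.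
-/

noncomputable section

namespace LorentzGas

/-! ### Pointwise bounds for the kernel -/

/-- A property of a pair `(h, h')` which is invariant under the two symmetries of the kernel holds
for all pairs as soon as it holds in the region `|h'| ≤ h`. -/
theorem forall_of_symm {P : ℝ → ℝ → Prop} (base : ∀ h h', |h'| ≤ h → P h h')
    (swap : ∀ h h', P h h' → P h' h) (neg : ∀ h h', P h h' → P (-h) (-h')) (h h' : ℝ) :
    P h h' := by
  rcases le_total |h'| |h| with h1 | h1
  · rcases le_total 0 h with h2 | h2
    · exact base _ _ (by rwa [abs_of_nonneg h2] at h1)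
    · have := neg _ _ (base (-h) (-h') (by rwa [abs_of_nonpos h2, ← abs_neg h'] at h1))
      simpa using this
  · rcases le_total 0 h' with h2 | h2
    · exact swap _ _ (base _ _ (by rwa [abs_of_nonneg h2] at h1))
    · have := swap _ _ (neg _ _ (base (-h') (-h) (by rwa [abs_of_nonpos h2, ← abs_neg h] at h1)))
      simpa using this

theorem measurable_kernelBase :
    Measurable fun p : ℝ × ℝ × ℝ => kernelBase p.1 p.2.1 p.2.2 := by
  unfold kernelBase
  refine Measurable.ite (measurableSet_lt (by fun_prop) (by fun_prop)) (by fun_prop) ?_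
  refine Measurable.ite (measurableSet_le (by fun_prop) (by fun_prop)) (by fun_prop) ?_
  exact Measurable.ite (measurableSet_le (by fun_prop) (by fun_prop)) (by fun_prop) (by fun_prop)

theorem measurable_Q : Measurable fun p : ℝ × ℝ × ℝ => Q p.1 p.2.1 p.2.2 := by
  unfold Q
  refine Measurable.ite (measurableSet_le (by fun_prop) (by fun_prop)) ?_ ?_
  · exact measurable_kernelBase.comp (g := fun p : ℝ × ℝ × ℝ => kernelBase p.1 p.2.1 p.2.2)
      (f := fun p : ℝ × ℝ × ℝ => (p.1, max p.2.1 p.2.2, min p.2.1 p.2.2)) (by fun_prop)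
  · exact measurable_kernelBase.comp (g := fun p : ℝ × ℝ × ℝ => kernelBase p.1 p.2.1 p.2.2)
      (f := fun p : ℝ × ℝ × ℝ => (p.1, max (-p.2.1) (-p.2.2), min (-p.2.1) (-p.2.2)))
      (by fun_prop)

@[fun_prop]
theorem measurable_Q_comp {ι : Type*} [MeasurableSpace ι] {a b c : ι → ℝ} (ha : Measurable a)
    (hb : Measurable b) (hc : Measurable c) : Measurable fun i => Q (a i) (b i) (c i) :=
  measurable_Q.comp (f := fun i => (a i, b i, c i)) (by fun_prop)

theorem kernelBase_nonneg {s h h' : ℝ} (hh : |h'| ≤ h) : 0 ≤ kernelBase s h h' := by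
  have h1 := abs_le.mp hh
  unfold kernelBase
  split_ifs with a b c
  · exact le_rfl
  · positivity
  · have hs : 0 < s := by
      rcases (not_lt.mp a).lt_or_eq with h2 | h2
      · exact h2
      · rw [← h2] at b; norm_num at b
    have : 1 + h' ≤ 1 / s := by rw [le_div_iff₀ hs]; linarith
    have h3 : 0 ≤ (1 / s - (1 + h')) / (h - h') := div_nonneg (by linarith) (by linarith)
    positivity
  · exact le_rfl

theorem kernelBase_le {s h h' : ℝ} (hh : |h'| ≤ h) : kernelBase s h h' ≤ 6 / Real.pi ^ 2 := by
  have h1 := abs_le.mp hh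
  unfold kernelBase
  split_ifs with a b c
  · positivity
  · exact le_rfl
  · have hs : 0 < s := by
      rcases (not_lt.mp a).lt_or_eq with h2 | h2
      · exact h2
      · rw [← h2] at b; norm_num at b
    have : 1 / s ≤ 1 + h := by rw [div_le_iff₀ hs]; linarith
    have h3 : (1 / s - (1 + h')) / (h - h') ≤ 1 := div_le_one_of_le₀ (by linarith) (by linarith)
    have : 0 ≤ 6 / Real.pi ^ 2 := by positivity
    nlinarith
  · positivity

theorem Q_nonneg (s h h' : ℝ) : 0 ≤ Q s h h' := by
  revert h h'
  refine forall_of_symm (fun h h' hh => ?_) (fun h h' H => ?_) (fun h h' H => ?_)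
  · rw [Q_eq_kernelBase s hh]; exact kernelBase_nonneg hh
  · rwa [Q_swap]
  · rwa [← Q_neg]

theorem Q_le (s h h' : ℝ) : Q s h h' ≤ 6 / Real.pi ^ 2 := by
  revert h h'
  refine forall_of_symm (fun h h' hh => ?_) (fun h h' H => ?_) (fun h h' H => ?_)
  · rw [Q_eq_kernelBase s hh]; exact kernelBase_le hh
  · rwa [Q_swap]
  · rwa [← Q_neg]

theorem six_div_pi_sq_le_one : 6 / Real.pi ^ 2 ≤ 1 := by
  rw [div_le_one (by positivity)]
  nlinarith [Real.pi_gt_three]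

theorem Q_of_neg {s : ℝ} (hs : s < 0) (h h' : ℝ) : Q s h h' = 0 := by
  unfold Q kernelBase
  simp [hs]

theorem Q_of_le_half {s h h' : ℝ} (hs : 0 ≤ s) (hs' : s ≤ 1 / 2) (hh : h ∈ Icc (-1 : ℝ) 1)
    (hh' : h' ∈ Icc (-1 : ℝ) 1) : Q s h h' = 6 / Real.pi ^ 2 := by
  have key : ∀ M : ℝ, M ≤ 1 → s * (1 + M) ≤ 1 := fun M hM => by nlinarith
  unfold Q kernelBase
  rw [if_neg (not_lt.mpr hs), if_neg (not_lt.mpr hs),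
    if_pos (key _ (max_le hh.2 hh'.2)),
    if_pos (key _ (max_le (by linarith [hh.1]) (by linarith [hh'.1]))), ite_self]

/-- Long free paths occur only between collisions that are nearly tangent: `Q(s, h | h') = 0`
unless both `|h|` and `|h'|` are at least `1 - 1 / s`. -/
theorem Q_eq_zero_of_lt {s : ℝ} (hs : 0 ≤ s) (h h' : ℝ)
    (H : 1 < s * (1 - |h|) ∨ 1 < s * (1 - |h'|)) : Q s h h' = 0 := by
  revert h h'
  refine forall_of_symm (fun h h' hh H => ?_) (fun h h' H H' => ?_) (fun h h' H H' => ?_)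
  · rw [Q_eq_kernelBase s hh]
    have h1 := abs_le.mp hh
    have h0 : |h| = h := abs_of_nonneg ((abs_nonneg _).trans hh)
    rw [h0] at H
    have h2 : 1 < s * (1 - |h'|) := H.elim (fun h3 => h3.trans_le (by gcongr)) id
    have h3 : 1 < s * (1 + h') := h2.trans_le (by gcongr; linarith [neg_abs_le h'])
    have h4 : 1 < s * (1 + h) := h3.trans_le (by gcongr; linarith)
    unfold kernelBase
    rw [if_neg (not_lt.mpr hs), if_neg (not_le.mpr h4), if_neg (not_le.mpr h3)]
  · rw [Q_swap]; exact H H'.symm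
  · rw [← Q_neg]; exact H (by simpa using H')

theorem Q_le_of_two_le {s : ℝ} (hs : 2 ≤ s) (h h' : ℝ) (hh1 : |h| ≤ 1) (hh1' : |h'| ≤ 1) :
    Q s h h' ≤ 6 / Real.pi ^ 2 * (1 / s) := by
  revert h h'
  refine forall_of_symm (fun h h' hh b1 b2 => ?_) (fun h h' H b1 b2 => ?_) (fun h h' H b1 b2 => ?_)
  · rw [Q_eq_kernelBase s hh]
    have h1 := abs_le.mp hh
    have hp : 0 < 6 / Real.pi ^ 2 := by positivity
    have hs0 : (0 : ℝ) < s := by linarith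
    unfold kernelBase
    rw [if_neg (by linarith)]
    split_ifs with b c
    · nlinarith [(abs_nonneg h').trans hh]
    · have h2 : h' ≤ 1 / s - 1 := by
        have : 1 + h' ≤ 1 / s := by rw [le_div_iff₀ hs0]; linarith
        linarith
      have h3 : 1 / s ≤ 1 / 2 := one_div_le_one_div_of_le (by norm_num) hs
      have h4 : (0 : ℝ) < 1 / s := by positivity
      refine mul_le_mul_of_nonneg_left ?_ hp.le
      rw [div_le_iff₀ (by linarith)]
      -- here `h - h' ≥ -2 h' ≥ 2 - 2 / s ≥ 1`
      nlinarith [(abs_le.mp b2).1]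
    · positivity
  · rw [Q_swap]; exact H b2 b1
  · rw [← Q_neg]; exact H (by simpa using b1) (by simpa using b2)

/-! ### Normalization of the kernel -/

/-- The kernel with values in `[0, ∞]`. -/
def Qe (s h h' : ℝ) : ℝ≥0∞ := ENNReal.ofReal (Q s h h')

@[fun_prop]
theorem measurable_Qe_comp {ι : Type*} [MeasurableSpace ι] {a b c : ι → ℝ} (ha : Measurable a)
    (hb : Measurable b) (hc : Measurable c) : Measurable fun i => Qe (a i) (b i) (c i) :=
  (measurable_Q_comp ha hb hc).ennreal_ofReal

theorem Qe_swap (s h h' : ℝ) : Qe s h h' = Qe s h' h := by rw [Qe, Q_swap, Qe]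

theorem Qe_neg (s h h' : ℝ) : Qe s h h' = Qe s (-h) (-h') := by rw [Qe, Q_neg, Qe]

/-- The function `log u / (u - 1)`, with the value `1` at `u = 1`. -/
def logSlope : ℝ → ℝ := dslope Real.log 1

theorem logSlope_of_ne {u : ℝ} (hu : u ≠ 1) : logSlope u = Real.log u / (u - 1) := by
  rw [logSlope, dslope_of_ne _ hu, slope_def_field, Real.log_one, sub_zero]

theorem logSlope_one : logSlope 1 = 1 := by
  rw [logSlope, dslope_same, Real.deriv_log, inv_one]

theorem continuousOn_logSlope : ContinuousOn logSlope (Ioi 0) := by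
  rw [logSlope, continuousOn_dslope (Ioi_mem_nhds one_pos)]
  exact ⟨Real.continuousOn_log.mono fun x hx => (ne_of_gt hx : x ≠ 0),
    Real.differentiableAt_log one_ne_zero⟩

theorem logSlope_nonneg {u : ℝ} (hu : 0 < u) : 0 ≤ logSlope u := by
  rcases lt_trichotomy u 1 with h | h | h
  · rw [logSlope_of_ne h.ne]
    exact div_nonneg_of_nonpos (Real.log_nonpos hu.le h.le) (by linarith)
  · rw [h, logSlope_one]; exact zero_le_one
  · rw [logSlope_of_ne h.ne']
    exact div_nonneg (Real.log_nonneg h.le) (by linarith)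

/-- The primitive of `log u / (u - 1)` that vanishes at `1`, a form of the dilogarithm. -/
def logSlopePrimitive (x : ℝ) : ℝ := ∫ u in (1 : ℝ)..x, logSlope u

theorem hasDerivAt_logSlopePrimitive {x : ℝ} (hx : 0 < x) :
    HasDerivAt logSlopePrimitive (logSlope x) x := by
  refine intervalIntegral.integral_hasDerivAt_right ?_ ?_ ?_
  · refine (continuousOn_logSlope.mono fun u hu => ?_).intervalIntegrable
    exact (lt_min one_pos hx).trans_le (by simpa [uIcc] using hu.1)
  · exact continuousOn_logSlope.stronglyMeasurableAtFilter isOpen_Ioi x hx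
  · exact continuousOn_logSlope.continuousAt (Ioi_mem_nhds hx)

/-- The value `η(2) = π² / 12` of the alternating zeta function, from `ζ(2) = π² / 6`. -/
theorem hasSum_alternating_inv_sq :
    HasSum (fun n : ℕ => (-1 : ℝ) ^ n / ((n : ℝ) + 1) ^ 2) (Real.pi ^ 2 / 12) := by
  have hz := hasSum_zeta_two
  have hz' : HasSum (fun n : ℕ => 1 / ((n : ℝ) + 1) ^ 2) (Real.pi ^ 2 / 6) := by
    have := (hasSum_nat_add_iff' 1).mpr hz
    simpa using this
  have hodd : HasSum (fun n : ℕ => 1 / (((2 * n + 1 : ℕ) : ℝ) + 1) ^ 2) (Real.pi ^ 2 / 24) := by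
    have := hz'.mul_left (1 / 4)
    convert! this using 1
    · ext n
      push_cast
      field_simp
      ring
    · ring
  have heven : HasSum (fun n : ℕ => 1 / (((2 * n : ℕ) : ℝ) + 1) ^ 2) (Real.pi ^ 2 / 8) := by
    have hinj : Function.Injective fun n : ℕ => 2 * n := fun a b h => by simpa using h
    have hs : Summable (fun n : ℕ => 1 / (((2 * n : ℕ) : ℝ) + 1) ^ 2) := by
      have := hz'.summable.comp_injective hinj
      simpa only [Function.comp_def] using this
    have := (HasSum.even_add_odd (f := fun n : ℕ => 1 / ((n : ℝ) + 1) ^ 2)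
      hs.hasSum hodd).unique hz'
    convert! hs.hasSum using 1
    linarith
  have h1 := HasSum.even_add_odd (f := fun n : ℕ => (-1 : ℝ) ^ n / ((n : ℝ) + 1) ^ 2)
    (m := Real.pi ^ 2 / 8) (m' := -(Real.pi ^ 2 / 24)) (by simpa using heven)
    (by simpa [pow_succ, neg_div] using hodd.neg)
  convert! h1 using 1
  ring

/-- Expand `log (1 + x) / x` in powers of `x` and integrate over `[0, 1]` term by term. -/
theorem logSlopePrimitive_two : logSlopePrimitive 2 = Real.pi ^ 2 / 12 := by
  have h0 : logSlopePrimitive 2 = ∫ x in Ioc (0 : ℝ) 1, logSlope (x + 1) := by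
    rw [logSlopePrimitive, ← intervalIntegral.integral_of_le zero_le_one,
      intervalIntegral.integral_comp_add_right (fun x => logSlope x)]
    norm_num
  have hint : ∀ n : ℕ, ∫ x in Ioc (0 : ℝ) 1, x ^ n / ((n : ℝ) + 1) = 1 / ((n : ℝ) + 1) ^ 2 := by
    intro n
    rw [← intervalIntegral.integral_of_le zero_le_one, intervalIntegral.integral_div,
      integral_pow]
    simp only [one_pow, ne_eq, Nat.add_eq_zero_iff, one_ne_zero, and_false, not_false_eq_true,
      zero_pow, sub_zero]
    field_simp
  have key := hasSum_integral_of_summable_integral_norm (μ := volume.restrict (Ioc (0 : ℝ) 1))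
    (F := fun (n : ℕ) x => (-1 : ℝ) ^ n * (x ^ n / ((n : ℝ) + 1))) ?_ ?_
  · rw [h0]
    have h1 : ∀ n : ℕ, ∫ x in Ioc (0 : ℝ) 1, (-1 : ℝ) ^ n * (x ^ n / ((n : ℝ) + 1)) =
        (-1) ^ n / ((n : ℝ) + 1) ^ 2 := by
      intro n
      rw [integral_const_mul, hint, mul_one_div]
    simp_rw [h1] at key
    rw [← key.unique hasSum_alternating_inv_sq]
    refine integral_congr_ae ?_
    rw [Filter.EventuallyEq, ae_restrict_iff' measurableSet_Ioc]
    have : ∀ᵐ x : ℝ, x ≠ 1 := by simp [ae_iff]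
    filter_upwards [this] with x hx1 hx
    have hx0 : 0 < x := hx.1
    have h2 := Real.hasSum_pow_div_log_of_abs_lt_one (x := -x)
      (by rw [abs_neg, abs_of_pos hx0]; exact lt_of_le_of_ne hx.2 hx1)
    rw [logSlope_of_ne (by linarith)]
    have h3 := (h2.mul_left (-1 / x)).tsum_eq
    rw [sub_neg_eq_add, add_comm 1 x] at h3
    rw [add_sub_cancel_right]
    trans -1 / x * -Real.log (x + 1)
    · ring
    · rw [← h3]
      congr 1
      ext n
      rw [neg_pow, pow_succ, pow_succ x]
      field_simp
  · intro n
    exact ((by fun_prop : Continuous fun x : ℝ => (-1 : ℝ) ^ n * (x ^ n / ((n : ℝ) + 1))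
      ).integrableOn_Icc).mono_set Ioc_subset_Icc_self
  · have h2 : ∀ n : ℕ, ∫ x in Ioc (0 : ℝ) 1, ‖(-1 : ℝ) ^ n * (x ^ n / ((n : ℝ) + 1))‖ =
        1 / ((n : ℝ) + 1) ^ 2 := by
      intro n
      rw [← hint]
      refine setIntegral_congr_fun measurableSet_Ioc fun x hx => ?_
      have : (0 : ℝ) < x := hx.1
      simp only [norm_mul, norm_pow, norm_neg, norm_one, one_pow, one_mul]
      exact Real.norm_of_nonneg (by positivity)
    simp_rw [h2]
    have := (hasSum_nat_add_iff' 1).mpr hasSum_zeta_two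
    exact (by simpa using this.summable)

/-- The dilogarithm identity behind the normalization of the kernel: the left-hand side has derivative
zero in `h`, and its value at `h = 0` is `2 * π² / 12`. -/
theorem logSlopePrimitive_identity {h : ℝ} (h0 : 0 ≤ h) (h1 : h < 1) :
    logSlopePrimitive (2 / (1 + h)) - logSlopePrimitive ((1 - h) / (1 + h)) +
      (logSlopePrimitive (2 / (1 - h)) - logSlopePrimitive ((1 + h) / (1 - h))) =
      Real.pi ^ 2 / 6 := by
  let F : ℝ → ℝ := fun h =>
    logSlopePrimitive (2 / (1 + h)) - logSlopePrimitive ((1 - h) / (1 + h)) +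
      (logSlopePrimitive (2 / (1 - h)) - logSlopePrimitive ((1 + h) / (1 - h)))
  have hd : ∀ x ∈ Ico (0 : ℝ) 1, HasDerivAt F 0 x := by
    intro x hx
    have p1 : 0 < 1 + x := by linarith [hx.1]
    have p2 : 0 < 1 - x := by linarith [hx.2]
    have d1 : HasDerivAt (fun x : ℝ => 1 + x) 1 x := (hasDerivAt_id x).const_add 1
    have d2 : HasDerivAt (fun x : ℝ => 1 - x) (-1) x := (hasDerivAt_id x).const_sub 1
    have e1 := (hasDerivAt_logSlopePrimitive (x := 2 / (1 + x)) (by positivity)).comp x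
      ((hasDerivAt_const x (2 : ℝ)).div d1 p1.ne')
    have e2 := (hasDerivAt_logSlopePrimitive (x := (1 - x) / (1 + x)) (by positivity)).comp x
      (d2.div d1 p1.ne')
    have e3 := (hasDerivAt_logSlopePrimitive (x := 2 / (1 - x)) (by positivity)).comp x
      ((hasDerivAt_const x (2 : ℝ)).div d2 p2.ne')
    have e4 := (hasDerivAt_logSlopePrimitive (x := (1 + x) / (1 - x)) (by positivity)).comp x
      (d1.div d2 p2.ne')
    convert! (e1.sub e2).add (e3.sub e4) using 1
    rcases hx.1.eq_or_lt with hx0 | hx0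
    · subst hx0
      norm_num [logSlope_one]
    · have n1 : 2 / (1 + x) ≠ 1 := by rw [Ne, div_eq_one_iff_eq p1.ne']; linarith
      have n2 : (1 - x) / (1 + x) ≠ 1 := by rw [Ne, div_eq_one_iff_eq p1.ne']; linarith
      have n3 : 2 / (1 - x) ≠ 1 := by rw [Ne, div_eq_one_iff_eq p2.ne']; linarith
      have n4 : (1 + x) / (1 - x) ≠ 1 := by rw [Ne, div_eq_one_iff_eq p2.ne']; linarith
      rw [logSlope_of_ne n1, logSlope_of_ne n2, logSlope_of_ne n3, logSlope_of_ne n4,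
        Real.log_div two_ne_zero p1.ne', Real.log_div p2.ne' p1.ne',
        Real.log_div two_ne_zero p2.ne', Real.log_div p1.ne' p2.ne']
      have q1 : 2 / (1 + x) - 1 = (1 - x) / (1 + x) := by field_simp; ring
      have q2 : (1 - x) / (1 + x) - 1 = -2 * x / (1 + x) := by field_simp; ring
      have q3 : 2 / (1 - x) - 1 = (1 + x) / (1 - x) := by field_simp; ring
      have q4 : (1 + x) / (1 - x) - 1 = 2 * x / (1 - x) := by field_simp; ring
      rw [q1, q2, q3, q4]
      field_simp
      ring
  have hc := constant_of_has_deriv_right_zero (f := F) (a := 0) (b := h)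
    (fun x hx => (hd x ⟨hx.1, hx.2.trans_lt h1⟩).continuousAt.continuousWithinAt)
    (fun x hx => (hd x ⟨hx.1, hx.2.trans h1⟩).hasDerivWithinAt) h ⟨h0, le_rfl⟩
  change F h = _
  rw [hc]
  have : logSlopePrimitive 1 = 0 := by simp [logSlopePrimitive]
  simp only [F]
  norm_num [this, logSlopePrimitive_two]
  ring

/-- Lebesgue measure on the strip of pairs `(t, h)` with `t ∈ ℝ` and `h ∈ [-1, 1]`. -/
def stripMeasure : Measure (ℝ × ℝ) :=
  (volume : Measure ℝ).prod (volume.restrict (Icc (-1 : ℝ) 1))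

instance : SFinite stripMeasure := by unfold stripMeasure; infer_instance

theorem lintegral_stripMeasure {f : ℝ × ℝ → ℝ≥0∞} (hf : Measurable f) :
    ∫⁻ w, f w ∂stripMeasure = ∫⁻ t, ∫⁻ h in Icc (-1 : ℝ) 1, f (t, h) :=
  lintegral_prod _ hf.aemeasurable

theorem lintegral_stripMeasure_symm {f : ℝ × ℝ → ℝ≥0∞} (hf : Measurable f) :
    ∫⁻ w, f w ∂stripMeasure = ∫⁻ h in Icc (-1 : ℝ) 1, ∫⁻ t, f (t, h) :=
  lintegral_prod_symm _ hf.aemeasurable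

theorem lintegral_stripMeasure_sub {f : ℝ × ℝ → ℝ≥0∞} (hf : Measurable f) (a : ℝ) :
    ∫⁻ w, f (w.1 - a, w.2) ∂stripMeasure = ∫⁻ w, f w ∂stripMeasure := by
  rw [lintegral_stripMeasure (by fun_prop), lintegral_stripMeasure hf]
  exact lintegral_sub_right_eq_self (fun t => ∫⁻ h in Icc (-1 : ℝ) 1, f (t, h)) a

theorem lintegral_stripMeasure_rsub {f : ℝ × ℝ → ℝ≥0∞} (hf : Measurable f) (a : ℝ) :
    ∫⁻ w, f (a - w.1, w.2) ∂stripMeasure = ∫⁻ w, f w ∂stripMeasure := by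
  rw [lintegral_stripMeasure (by fun_prop), lintegral_stripMeasure hf]
  exact lintegral_sub_left_eq_self (fun t => ∫⁻ h in Icc (-1 : ℝ) 1, f (t, h)) a

theorem lintegral_Icc_neg (f : ℝ → ℝ≥0∞) :
    ∫⁻ h in Icc (-1 : ℝ) 1, f (-h) = ∫⁻ h in Icc (-1 : ℝ) 1, f h := by
  rw [← lintegral_indicator measurableSet_Icc, ← lintegral_indicator measurableSet_Icc,
    ← lintegral_neg_eq_self ((Icc (-1 : ℝ) 1).indicator f)]
  refine lintegral_congr fun x => ?_
  have : -x ∈ Icc (-1 : ℝ) 1 ↔ x ∈ Icc (-1 : ℝ) 1 := by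
    simp only [mem_Icc]; constructor <;> rintro ⟨a, b⟩ <;> constructor <;> linarith
  by_cases hx : x ∈ Icc (-1 : ℝ) 1
  · rw [indicator_of_mem hx, indicator_of_mem (this.mpr hx)]
  · rw [indicator_of_notMem hx, indicator_of_notMem (this.not.mpr hx)]

/-- The mass of the kernel over all free paths, at given impact parameters. -/
theorem lintegral_Qe_time {h h' : ℝ} (hh : |h'| < h) (h1 : h ≤ 1) :
    ∫⁻ s, Qe s h h' =
      ENNReal.ofReal (6 / Real.pi ^ 2 * (Real.log ((1 + h) / (1 + h')) / (h - h'))) := by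
  have hl := abs_lt.mp hh
  have p0 : 0 < 1 + h' := by linarith
  have p1 : 0 < 1 + h := by linarith
  have hlt : 1 / (1 + h) ≤ 1 / (1 + h') := one_div_le_one_div_of_le p0 (by linarith)
  have hpos : 0 < 1 / (1 + h) := by positivity
  have hsub : 0 < h - h' := by linarith
  have hc : (0 : ℝ) < 6 / Real.pi ^ 2 := by positivity
  have hQ : ∀ s, Qe s h h' = ENNReal.ofReal (kernelBase s h h') := fun s => by
    rw [Qe, Q_eq_kernelBase s hh.le]
  have hle : ∀ s, s ∈ Ioc (0 : ℝ) (1 / (1 + h)) → kernelBase s h h' = 6 / Real.pi ^ 2 := by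
    intro s hs
    have : s * (1 + h) ≤ 1 := (le_div_iff₀ p1).mp hs.2
    rw [kernelBase, if_neg (not_lt.mpr hs.1.le), if_pos this]
  have hmid : ∀ s, s ∈ Ioc (1 / (1 + h)) (1 / (1 + h')) → kernelBase s h h' =
      6 / Real.pi ^ 2 * ((1 / s - (1 + h')) / (h - h')) := by
    intro s hs
    have a1 : s * (1 + h') ≤ 1 := (le_div_iff₀ p0).mp hs.2
    have a2 : ¬ s * (1 + h) ≤ 1 := by rw [← le_div_iff₀ p1]; exact not_le.mpr hs.1
    rw [kernelBase, if_neg (not_lt.mpr (hpos.trans hs.1).le), if_neg a2, if_pos a1]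
  have hzero : ∀ s, s ≠ 0 → s ∉ Ioc (0 : ℝ) (1 / (1 + h')) → kernelBase s h h' = 0 := by
    intro s hs0 hs
    rcases lt_or_ge s 0 with h2 | h2
    · rw [kernelBase, if_pos h2]
    · have h3 : 1 / (1 + h') < s := by
        by_contra h4
        exact hs ⟨lt_of_le_of_ne h2 hs0.symm, not_lt.mp h4⟩
      have a1 : ¬ s * (1 + h') ≤ 1 := by rw [← le_div_iff₀ p0]; exact not_le.mpr h3
      have a2 : ¬ s * (1 + h) ≤ 1 := by rw [← le_div_iff₀ p1]; exact not_le.mpr (hlt.trans_lt h3)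
      rw [kernelBase, if_neg (not_lt.mpr h2), if_neg a2, if_neg a1]
  have hint : IntervalIntegrable (fun s : ℝ => 6 / Real.pi ^ 2 * ((1 / s - (1 + h')) / (h - h')))
      volume (1 / (1 + h)) (1 / (1 + h')) := by
    refine ContinuousOn.intervalIntegrable fun s hs => ?_
    rw [uIcc_of_le hlt] at hs
    have : s ≠ 0 := (hpos.trans_le hs.1).ne'
    exact ContinuousAt.continuousWithinAt (by fun_prop (disch := assumption))
  have e1 : ∫⁻ s, Qe s h h' = ∫⁻ s in Ioc (0 : ℝ) (1 / (1 + h')), Qe s h h' := by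
    rw [← lintegral_indicator measurableSet_Ioc]
    refine lintegral_congr_ae ?_
    have : ∀ᵐ x : ℝ, x ≠ 0 := by simp [ae_iff]
    filter_upwards [this] with s hs
    by_cases hs' : s ∈ Ioc (0 : ℝ) (1 / (1 + h'))
    · rw [indicator_of_mem hs']
    · rw [indicator_of_notMem hs', hQ, hzero s hs hs', ENNReal.ofReal_zero]
  rw [e1, ← Ioc_union_Ioc_eq_Ioc hpos.le hlt, lintegral_union measurableSet_Ioc
    (Ioc_disjoint_Ioc_of_le le_rfl)]
  have e2 : ∫⁻ s in Ioc (0 : ℝ) (1 / (1 + h)), Qe s h h' =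
      ENNReal.ofReal (6 / Real.pi ^ 2 * (1 / (1 + h))) := by
    rw [setLIntegral_congr_fun (g := fun _ => ENNReal.ofReal (6 / Real.pi ^ 2)) measurableSet_Ioc
      (fun s hs => by simp only [hQ, hle s hs])]
    rw [setLIntegral_const, Real.volume_Ioc, sub_zero, ← ENNReal.ofReal_mul hc.le]
  have e3 : ∫⁻ s in Ioc (1 / (1 + h)) (1 / (1 + h')), Qe s h h' = ENNReal.ofReal
      (∫ s in (1 / (1 + h))..(1 / (1 + h')),
        6 / Real.pi ^ 2 * ((1 / s - (1 + h')) / (h - h'))) := by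
    rw [intervalIntegral.integral_of_le hlt, ofReal_integral_eq_lintegral_ofReal hint.1]
    · exact setLIntegral_congr_fun measurableSet_Ioc fun s hs => by simp only [hQ, hmid s hs]
    · refine (ae_restrict_iff' measurableSet_Ioc).mpr (ae_of_all _ fun s hs => ?_)
      simp only [Pi.zero_apply, ← hmid s hs]
      exact kernelBase_nonneg hh.le
  rw [e2, e3, ← ENNReal.ofReal_add (by positivity)]
  · congr 1
    rw [intervalIntegral.integral_const_mul, intervalIntegral.integral_div,
      intervalIntegral.integral_sub, integral_one_div_of_pos hpos (hpos.trans_le hlt),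
      intervalIntegral.integral_const, smul_eq_mul,
      show 1 / (1 + h') / (1 / (1 + h)) = (1 + h) / (1 + h') by field_simp]
    · field_simp
      ring
    · refine ContinuousOn.intervalIntegrable fun s hs => ?_
      rw [uIcc_of_le hlt] at hs
      have : s ≠ 0 := (hpos.trans_le hs.1).ne'
      exact ContinuousAt.continuousWithinAt (by fun_prop (disch := assumption))
    · exact intervalIntegrable_const
  · rw [intervalIntegral.integral_of_le hlt]
    refine setIntegral_nonneg measurableSet_Ioc fun s hs => ?_
    rw [← hmid s hs]
    exact kernelBase_nonneg hh.le

theorem lintegral_ofReal_eq_sub {f F : ℝ → ℝ} {a b : ℝ} (hab : a ≤ b)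
    (hf : ContinuousOn f (Icc a b)) (hF : ∀ x ∈ Icc a b, HasDerivAt F (f x) x)
    (hpos : ∀ x ∈ Icc a b, 0 ≤ f x) :
    ∫⁻ x in Ioc a b, ENNReal.ofReal (f x) = ENNReal.ofReal (F b - F a) := by
  have hi : IntervalIntegrable f volume a b :=
    ContinuousOn.intervalIntegrable (by rwa [uIcc_of_le hab])
  rw [← intervalIntegral.integral_eq_sub_of_hasDerivAt (f := F) (f' := f)
    (by rwa [uIcc_of_le hab]) hi, intervalIntegral.integral_of_le hab,
    ofReal_integral_eq_lintegral_ofReal hi.1]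
  exact (ae_restrict_iff' measurableSet_Ioc).mpr
    (ae_of_all _ fun x hx => hpos x (Ioc_subset_Icc_self hx))

/-- The contribution of `h' ∈ (-h, 1]` to the mass of the kernel. Up to a factor independent of
`h'`, the mass at `h'` is `logSlope` in the variable `(1 + h') / (1 + h)`, on both sides of `h' = h`. -/
theorem lintegral_Qe_upper {h : ℝ} (h0 : 0 < h) (h1 : h < 1) :
    ∫⁻ h' in Ioc (-h) 1, ∫⁻ s, Qe s h h' = ENNReal.ofReal (6 / Real.pi ^ 2 *
      (logSlopePrimitive (2 / (1 + h)) - logSlopePrimitive ((1 - h) / (1 + h)))) := by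
  have p1 : 0 < 1 + h := by linarith
  have hpos : ∀ x ∈ Icc (-h) 1, 0 < (1 + x) / (1 + h) := fun x hx =>
    div_pos (by linarith [hx.1]) p1
  trans ∫⁻ x in Ioc (-h) 1,
    ENNReal.ofReal (6 / Real.pi ^ 2 * (logSlope ((1 + x) / (1 + h)) * (1 / (1 + h))))
  · refine lintegral_congr_ae ?_
    rw [Filter.EventuallyEq, ae_restrict_iff' measurableSet_Ioc]
    have : ∀ᵐ x : ℝ, x ≠ h := by simp [ae_iff]
    filter_upwards [this] with x hxh hx
    have hne : (1 + x) / (1 + h) ≠ 1 := by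
      rw [Ne, div_eq_one_iff_eq p1.ne']; intro h2; exact hxh (by linarith)
    have hsub : (1 + x) / (1 + h) - 1 = (x - h) / (1 + h) := by field_simp; ring
    have px : 0 < 1 + x := by linarith [hx.1]
    have hne' : x - h ≠ 0 := sub_ne_zero.mpr hxh
    have hne'' : h - x ≠ 0 := sub_ne_zero.mpr hxh.symm
    rw [logSlope_of_ne hne, hsub]
    rcases lt_or_gt_of_ne hxh with h2 | h2
    · rw [lintegral_Qe_time (abs_lt.mpr ⟨hx.1, h2⟩) h1.le]
      congr 2
      rw [Real.log_div p1.ne' px.ne', Real.log_div px.ne' p1.ne',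
        ← neg_sub x h, ← neg_sub (Real.log (1 + x)), neg_div_neg_eq]
      field_simp
    · simp_rw [Qe_swap _ h x]
      rw [lintegral_Qe_time (abs_lt.mpr ⟨by linarith, h2⟩) hx.2]
      congr 2
      field_simp
  · rw [lintegral_ofReal_eq_sub (F := fun x =>
      6 / Real.pi ^ 2 * logSlopePrimitive ((1 + x) / (1 + h))) (by linarith)]
    · rw [← mul_sub]
      norm_num [sub_eq_add_neg]
    · refine continuousOn_const.mul (ContinuousOn.mul ?_ continuousOn_const)
      exact continuousOn_logSlope.comp (by fun_prop) fun x hx => hpos x hx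
    · intro x hx
      have := HasDerivAt.const_mul (6 / Real.pi ^ 2)
        ((hasDerivAt_logSlopePrimitive (hpos x hx)).comp x
          (((hasDerivAt_id x).const_add 1).div_const (1 + h)))
      convert! this using 1
    · intro x hx
      have := logSlope_nonneg (hpos x hx)
      positivity

/-- The contribution of `h' ∈ (-1, -h]`. By symmetry, the mass at `h'` is now proportional to
`logSlope` in the variable `(1 - h') / (1 - h)`. -/
theorem lintegral_Qe_lower {h : ℝ} (h0 : 0 < h) (h1 : h < 1) :
    ∫⁻ h' in Ioc (-1) (-h), ∫⁻ s, Qe s h h' = ENNReal.ofReal (6 / Real.pi ^ 2 *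
      (logSlopePrimitive (2 / (1 - h)) - logSlopePrimitive ((1 + h) / (1 - h)))) := by
  have p1 : 0 < 1 - h := by linarith
  have hpos : ∀ x ∈ Icc (-1) (-h), 0 < (1 - x) / (1 - h) := fun x hx =>
    div_pos (by linarith [hx.2]) p1
  trans ∫⁻ x in Ioc (-1) (-h),
    ENNReal.ofReal (6 / Real.pi ^ 2 * (logSlope ((1 - x) / (1 - h)) * (1 / (1 - h))))
  · refine lintegral_congr_ae ?_
    rw [Filter.EventuallyEq, ae_restrict_iff' measurableSet_Ioc]
    have : ∀ᵐ x : ℝ, x ≠ -h := by simp [ae_iff]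
    filter_upwards [this] with x hxh hx
    have hlt : x < -h := lt_of_le_of_ne hx.2 hxh
    have hne : (1 - x) / (1 - h) ≠ 1 := by
      rw [Ne, div_eq_one_iff_eq p1.ne']; intro h2; linarith
    have hsub : (1 - x) / (1 - h) - 1 = (h - x) / (1 - h) := by field_simp; ring
    have px : 0 < 1 - x := by linarith
    have hne' : h - x ≠ 0 := by linarith
    rw [logSlope_of_ne hne, hsub]
    simp_rw [Qe_neg _ h x, Qe_swap _ (-h) (-x)]
    rw [lintegral_Qe_time (by rw [abs_neg, abs_of_pos h0]; linarith) (by linarith [hx.1])]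
    congr 2
    rw [← sub_eq_add_neg, ← sub_eq_add_neg, sub_neg_eq_add, neg_add_eq_sub]
    field_simp
  · rw [lintegral_ofReal_eq_sub (F := fun x =>
      -(6 / Real.pi ^ 2 * logSlopePrimitive ((1 - x) / (1 - h)))) (by linarith)]
    · congr 1
      norm_num [sub_eq_add_neg]
      ring
    · refine continuousOn_const.mul (ContinuousOn.mul ?_ continuousOn_const)
      exact continuousOn_logSlope.comp (by fun_prop) fun x hx => hpos x hx
    · intro x hx
      have := (HasDerivAt.const_mul (6 / Real.pi ^ 2)
        ((hasDerivAt_logSlopePrimitive (hpos x hx)).comp x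
          (((hasDerivAt_id x).const_sub 1).div_const (1 - h)))).neg
      convert! this using 1
      ring
    · intro x hx
      have := logSlope_nonneg (hpos x hx)
      positivity

theorem lintegral_Qe_of_pos {h : ℝ} (h0 : 0 < h) (h1 : h < 1) :
    ∫⁻ h' in Icc (-1 : ℝ) 1, ∫⁻ s, Qe s h h' = 1 := by
  have hm : ∀ {a b : ℝ}, 0 < a → a ≤ b → logSlopePrimitive a ≤ logSlopePrimitive b := by
    intro a b ha hab
    refine monotoneOn_of_deriv_nonneg (convex_Ioi (0 : ℝ))
      (fun x hx => (hasDerivAt_logSlopePrimitive hx).continuousAt.continuousWithinAt)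
      (fun x hx => ?_) (fun x hx => ?_) ha (ha.trans_le hab) hab
    · rw [interior_Ioi] at hx
      exact (hasDerivAt_logSlopePrimitive hx).differentiableAt.differentiableWithinAt
    · rw [interior_Ioi] at hx
      rw [(hasDerivAt_logSlopePrimitive hx).deriv]
      exact logSlope_nonneg hx
  have p1 : 0 < 1 + h := by linarith
  have p2 : 0 < 1 - h := by linarith
  have q1 := hm (a := (1 - h) / (1 + h)) (b := 2 / (1 + h)) (by positivity)
    (by gcongr; linarith)
  have q2 := hm (a := (1 + h) / (1 - h)) (b := 2 / (1 - h)) (by positivity)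
    (by gcongr; linarith)
  rw [← restrict_Ioc_eq_restrict_Icc, ← Ioc_union_Ioc_eq_Ioc (b := -h) (by linarith)
    (by linarith), lintegral_union measurableSet_Ioc (Ioc_disjoint_Ioc_of_le le_rfl),
    lintegral_Qe_upper h0 h1, lintegral_Qe_lower h0 h1, add_comm, ← ENNReal.ofReal_add
    (mul_nonneg (by positivity) (by linarith)) (mul_nonneg (by positivity) (by linarith)),
    ← mul_add, logSlopePrimitive_identity h0.le h1, ← ENNReal.ofReal_one]
  congr 1
  have := Real.pi_pos.ne'
  field_simp

/-- The kernel is a probability density: the outgoing free path and impact parameter have total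
mass `1`. The endpoints `h = ±1` and `h = 0` are left out, which is immaterial. -/
theorem ae_lintegral_Qe : ∀ᵐ h ∂volume.restrict (Icc (-1 : ℝ) 1),
    ∫⁻ w, Qe w.1 h w.2 ∂stripMeasure = 1 := by
  rw [ae_restrict_iff' measurableSet_Icc]
  have a1 : ∀ᵐ x : ℝ, x ≠ 1 := by simp [ae_iff]
  have a2 : ∀ᵐ x : ℝ, x ≠ -1 := by simp [ae_iff]
  have a3 : ∀ᵐ x : ℝ, x ≠ 0 := by simp [ae_iff]
  filter_upwards [a1, a2, a3] with h h1 h2 h3 hh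
  rw [lintegral_stripMeasure_symm (by fun_prop)]
  rcases lt_or_gt_of_ne h3 with h4 | h4
  · rw [← lintegral_Qe_of_pos (h := -h) (by linarith)
      (by linarith [lt_of_le_of_ne hh.1 h2.symm]), ← lintegral_Icc_neg]
    refine lintegral_congr fun x => lintegral_congr fun s => ?_
    simp only
    rw [Qe_neg, neg_neg]
  · exact lintegral_Qe_of_pos h4 (lt_of_le_of_ne hh.2 h1)

/-! ### Decay of the kernel in time -/

/-- The distribution of the free path has a tail of order `1 / s²`: the kernel is at most `1 / s`, on
a set of impact parameters `h'` of measure at most `2 / s`. -/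
theorem lintegral_Qe_le {s h : ℝ} (hs : 0 < s) (hh : |h| ≤ 1) :
    ∫⁻ h' in Icc (-1 : ℝ) 1, Qe s h h' ≤ ENNReal.ofReal (8 / s ^ 2) := by
  rcases lt_or_ge s 2 with h2 | h2
  · calc ∫⁻ h' in Icc (-1 : ℝ) 1, Qe s h h' ≤ ∫⁻ h' in Icc (-1 : ℝ) 1, 1 := by
          refine lintegral_mono fun x => ?_
          rw [Qe, ENNReal.ofReal_le_one]
          exact (Q_le _ _ _).trans six_div_pi_sq_le_one
      _ = ENNReal.ofReal 2 := by
          rw [setLIntegral_const, Real.volume_Icc, one_mul]; norm_num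
      _ ≤ _ := by
          refine ENNReal.ofReal_le_ofReal ?_
          rw [le_div_iff₀ (by positivity)]
          nlinarith
  · have hsub : ∀ x ∈ Icc (-1 : ℝ) 1, Qe s h x ≤
        (Icc (-1) (-1 + 1 / s) ∪ Icc (1 - 1 / s) 1).indicator
          (fun _ => ENNReal.ofReal (1 / s)) x := by
      intro x hx
      have hx1 : |x| ≤ 1 := abs_le.mpr hx
      by_cases hm : x ∈ Icc (-1) (-1 + 1 / s) ∪ Icc (1 - 1 / s) 1
      · rw [indicator_of_mem hm]
        refine ENNReal.ofReal_le_ofReal ((Q_le_of_two_le h2 h x hh hx1).trans ?_)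
        exact mul_le_of_le_one_left (by positivity) six_div_pi_sq_le_one
      · rw [Qe, Q_eq_zero_of_lt hs.le, ENNReal.ofReal_zero]
        · exact zero_le
        · right
          simp only [mem_union, mem_Icc, not_or, not_and, not_le] at hm
          have b1 := hm.1 hx.1
          have b2 : x < 1 - 1 / s := by
            by_contra h3
            exact absurd (hm.2 (not_lt.mp h3)) (not_lt.mpr hx.2)
          have b3 : 1 / s < 1 - |x| := by
            rcases abs_cases x with ⟨e, _⟩ | ⟨e, _⟩ <;> rw [e] <;> linarith
          rwa [div_lt_iff₀' hs] at b3
    calc ∫⁻ h' in Icc (-1 : ℝ) 1, Qe s h h'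
        ≤ ∫⁻ x in Icc (-1 : ℝ) 1, (Icc (-1) (-1 + 1 / s) ∪ Icc (1 - 1 / s) 1).indicator
          (fun _ => ENNReal.ofReal (1 / s)) x := setLIntegral_mono'  measurableSet_Icc hsub
      _ ≤ ∫⁻ x, (Icc (-1) (-1 + 1 / s) ∪ Icc (1 - 1 / s) 1).indicator
          (fun _ => ENNReal.ofReal (1 / s)) x := setLIntegral_le_lintegral _ _
      _ = ENNReal.ofReal (1 / s) * volume (Icc (-1) (-1 + 1 / s) ∪ Icc (1 - 1 / s) 1) :=
          lintegral_indicator_const (measurableSet_Icc.union measurableSet_Icc) _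
      _ ≤ ENNReal.ofReal (1 / s) * (ENNReal.ofReal (1 / s) + ENNReal.ofReal (1 / s)) := by
          gcongr
          refine (measure_union_le _ _).trans ?_
          rw [Real.volume_Icc, Real.volume_Icc]
          ring_nf
          exact le_rfl
      _ ≤ ENNReal.ofReal (8 / s ^ 2) := by
          rw [← ENNReal.ofReal_add (by positivity) (by positivity),
            ← ENNReal.ofReal_mul (by positivity)]
          refine ENNReal.ofReal_le_ofReal ?_
          rw [show 1 / s * (1 / s + 1 / s) = 2 / s ^ 2 by field_simp; ring]
          gcongr
          norm_num

theorem lintegral_ofReal_div_sq {c a : ℝ} (hc : 0 ≤ c) (ha : 0 < a) :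
    ∫⁻ s in Ioi a, ENNReal.ofReal (c / s ^ 2) = ENNReal.ofReal (c / a) := by
  have h1 : ∀ s ∈ Ioi a, c / s ^ 2 = c * s ^ (-2 : ℝ) := fun s hs => by
    rw [Real.rpow_neg (ha.trans hs).le, div_eq_mul_inv]
    norm_cast
  rw [← ofReal_integral_eq_lintegral_ofReal]
  · rw [setIntegral_congr_fun measurableSet_Ioi h1, integral_const_mul,
      integral_Ioi_rpow_of_lt (by norm_num) ha]
    congr 1
    norm_num
    rw [Real.rpow_neg_one, div_eq_mul_inv]
  · have h2 : IntegrableOn (fun s : ℝ => c * s ^ (-2 : ℝ)) (Ioi a) :=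
      (integrableOn_Ioi_rpow_of_lt (by norm_num) ha).const_mul c
    exact h2.congr_fun (fun s hs => (h1 s hs).symm) measurableSet_Ioi
  · exact (ae_restrict_iff' measurableSet_Ioi).mpr (ae_of_all _ fun s _ => by positivity)

/-- The time weight `min (1, (τ / T)²)`. -/
def lagWeight (T τ : ℝ) : ℝ≥0∞ := ENNReal.ofReal (min 1 ((τ / T) ^ 2))

@[fun_prop]
theorem measurable_lagWeight (T : ℝ) : Measurable (lagWeight T) := by
  unfold lagWeight; fun_prop

/-- The weighted mass of the kernel. The quadratic weight is what makes it `O(1 / T)`: free paths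
have tails of order `1 / τ²`, so a linear weight would lose a logarithm. -/
theorem lintegral_lagWeight_mul_Qe_le {T h : ℝ} (hT : 0 < T) (hh : |h| ≤ 1) :
    ∫⁻ w, lagWeight T w.1 * Qe w.1 h w.2 ∂stripMeasure ≤ ENNReal.ofReal (16 / T) := by
  rw [lintegral_stripMeasure (by fun_prop)]
  have h0 : ∀ s, ∫⁻ x in Icc (-1 : ℝ) 1, lagWeight T s * Qe s h x =
      lagWeight T s * ∫⁻ x in Icc (-1 : ℝ) 1, Qe s h x := fun s =>
    lintegral_const_mul _ (by fun_prop)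
  simp only [h0]
  have h1 : ∀ s, s ∉ Ioi (0 : ℝ) → s ≠ 0 →
      lagWeight T s * ∫⁻ x in Icc (-1 : ℝ) 1, Qe s h x = 0 := by
    intro s hs hs0
    have : s < 0 := lt_of_le_of_ne (not_lt.mp hs) hs0
    simp [Qe, Q_of_neg this]
  calc ∫⁻ s, lagWeight T s * ∫⁻ x in Icc (-1 : ℝ) 1, Qe s h x
      = ∫⁻ s in Ioi (0 : ℝ), lagWeight T s * ∫⁻ x in Icc (-1 : ℝ) 1, Qe s h x := by
        rw [← lintegral_indicator measurableSet_Ioi]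
        refine lintegral_congr_ae ?_
        have : ∀ᵐ x : ℝ, x ≠ 0 := by simp [ae_iff]
        filter_upwards [this] with s hs
        by_cases hs' : s ∈ Ioi (0 : ℝ)
        · rw [indicator_of_mem hs']
        · rw [indicator_of_notMem hs', h1 s hs' hs]
    _ ≤ (∫⁻ s in Ioc 0 T, ENNReal.ofReal (8 / T ^ 2)) +
          ∫⁻ s in Ioi T, ENNReal.ofReal (8 / s ^ 2) := by
        rw [← Ioc_union_Ioi_eq_Ioi hT.le, lintegral_union measurableSet_Ioi
          (by rw [Set.disjoint_left]; exact fun x (hx : x ∈ Ioc 0 T) hx' => not_lt.mpr hx.2 hx')]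
        refine add_le_add (setLIntegral_mono' measurableSet_Ioc fun s hs => ?_)
          (setLIntegral_mono' measurableSet_Ioi fun s hs => ?_)
        · refine (mul_le_mul_right (lintegral_Qe_le hs.1 hh) _).trans ?_
          rw [lagWeight, ← ENNReal.ofReal_mul (by positivity)]
          refine ENNReal.ofReal_le_ofReal ?_
          refine (mul_le_mul_of_nonneg_right (min_le_right _ _) (by positivity)).trans_eq ?_
          have := hs.1.ne'
          field_simp
        · refine (mul_le_mul_right (lintegral_Qe_le (hT.trans hs) hh) _).trans ?_
          rw [lagWeight, ← ENNReal.ofReal_mul (by positivity)]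
          refine ENNReal.ofReal_le_ofReal ?_
          exact mul_le_of_le_one_left (by positivity) (min_le_left _ _)
    _ = ENNReal.ofReal (16 / T) := by
        rw [lintegral_ofReal_div_sq (by norm_num) hT, setLIntegral_const, Real.volume_Ioc,
          ← ENNReal.ofReal_mul (by positivity), ← ENNReal.ofReal_add (by positivity)
            (by positivity)]
        congr 1
        field_simp
        ring

/-! ### Phase cancellation between two collisions -/

theorem abs_sin_le_mul {x : ℝ} (hx : 0 ≤ x) : |Real.sin x| ≤ x * (1 - min 1 (x ^ 2) / 20) := by
  have hpi := Real.pi_gt_three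
  have hpi4 := Real.pi_le_four
  rcases le_total x Real.pi with h | h
  · rw [abs_of_nonneg (Real.sin_nonneg_of_nonneg_of_le_pi hx h)]
    have h1 : Real.sin x = 2 * Real.sin (x / 2) * Real.cos (x / 2) := by
      rw [← Real.sin_two_mul]; ring_nf
    have h2 : Real.sin (x / 2) ≤ x / 2 := Real.sin_le (by linarith)
    have h3 : 0 ≤ Real.cos (x / 2) := Real.cos_nonneg_of_mem_Icc ⟨by linarith, by linarith⟩
    have h4 := Real.cos_le_one_sub_mul_cos_sq (x := x / 2)
      (by rw [abs_of_nonneg (by linarith)]; linarith)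
    have h5 : min 1 (x ^ 2) / 20 ≤ 2 / Real.pi ^ 2 * (x / 2) ^ 2 := by
      have : Real.pi ^ 2 ≤ 10 := by nlinarith [Real.pi_lt_d2]
      calc min 1 (x ^ 2) / 20 ≤ x ^ 2 / 20 := by gcongr; exact min_le_right _ _
        _ = 2 / 10 * (x / 2) ^ 2 := by ring
        _ ≤ _ := by gcongr
    calc Real.sin x ≤ x * Real.cos (x / 2) := by rw [h1]; nlinarith
      _ ≤ _ := by gcongr; linarith
  · have h1 : min 1 (x ^ 2) ≤ 1 := min_le_left _ _
    have h2 := Real.abs_sin_le_one x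
    nlinarith

/-- The mean of an oscillating exponential over an interval of length at least `1/4` is
quantitatively smaller than `1`. -/
theorem norm_integral_exp_le {a b : ℝ} (h1 : 1 / 4 ≤ b - a) (p q : ℝ) :
    ‖∫ u in a..b, Complex.exp (Complex.I * ((p + q * u : ℝ) : ℂ))‖ ≤
      (b - a) - min 1 (q ^ 2) / 5120 := by
  rcases eq_or_ne q 0 with rfl | hq
  · have := intervalIntegral.norm_integral_le_of_norm_le_const (a := a) (b := b) (C := 1)
      (f := fun u : ℝ => Complex.exp (Complex.I * ((p + 0 * u : ℝ) : ℂ)))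
      (fun u _ => by rw [mul_comm, Complex.norm_exp_ofReal_mul_I])
    rw [abs_of_nonneg (by linarith), one_mul] at this
    norm_num at this ⊢
    exact this
  · have hc : Complex.I * (q : ℂ) ≠ 0 := by simp [hq]
    have e1 : ∀ u : ℝ, Complex.exp (Complex.I * ((p + q * u : ℝ) : ℂ)) =
        Complex.exp (Complex.I * p) * Complex.exp (Complex.I * q * u) := fun u => by
      rw [← Complex.exp_add]; push_cast; ring_nf
    have e2 : Complex.exp (Complex.I * q * b) - Complex.exp (Complex.I * q * a) =
        Complex.exp (Complex.I * (q * a : ℝ)) *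
          (Complex.exp (Complex.I * (q * (b - a) : ℝ)) - 1) := by
      rw [mul_sub, ← Complex.exp_add]; push_cast; ring_nf
    simp_rw [e1]
    rw [intervalIntegral.integral_const_mul, norm_mul, mul_comm Complex.I (p : ℂ),
      Complex.norm_exp_ofReal_mul_I, one_mul, integral_exp_mul_complex hc, e2, norm_div, norm_mul,
      mul_comm Complex.I ((q * a : ℝ) : ℂ), Complex.norm_exp_ofReal_mul_I, one_mul,
      Complex.norm_exp_I_mul_ofReal_sub_one, norm_mul, norm_mul, Complex.norm_I, one_mul,
      Complex.norm_real, Real.norm_eq_abs, Real.norm_eq_abs, Real.norm_eq_abs, abs_two]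
    have hq' : 0 < |q| := abs_pos.mpr hq
    have e3 : |Real.sin (q * (b - a) / 2)| = |Real.sin (|q| * (b - a) / 2)| := by
      rcases abs_cases q with ⟨e, _⟩ | ⟨e, _⟩ <;> rw [e]
      rw [neg_mul, neg_div, Real.sin_neg, abs_neg]
    rw [e3, div_le_iff₀ hq']
    have h3 := abs_sin_le_mul (x := |q| * (b - a) / 2)
      (by have : 0 ≤ b - a := by linarith
          positivity)
    have h4 : min 1 (q ^ 2) / 64 ≤ min 1 ((|q| * (b - a) / 2) ^ 2) := by
      refine le_min ?_ ?_
      · have := min_le_left 1 (q ^ 2); linarith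
      · have := min_le_right 1 (q ^ 2)
        have h5 : (|q| * (b - a) / 2) ^ 2 = q ^ 2 * ((b - a) / 2) ^ 2 := by
          rw [← sq_abs q]; ring
        rw [h5]
        nlinarith [sq_nonneg q, mul_nonneg (sq_nonneg q) (sq_nonneg (b - a - 1 / 4)),
          mul_nonneg (sq_nonneg q) (sub_nonneg.mpr h1)]
    have h6 : 0 ≤ min 1 (q ^ 2) := le_min zero_le_one (sq_nonneg q)
    calc 2 * |Real.sin (|q| * (b - a) / 2)|
        ≤ 2 * (|q| * (b - a) / 2 * (1 - min 1 (q ^ 2) / 64 / 20)) := by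
          refine mul_le_mul_of_nonneg_left (h3.trans ?_) zero_le_two
          have : 0 ≤ b - a := by linarith
          gcongr
      _ ≤ _ := by
          have : 0 ≤ |q| * min 1 (q ^ 2) := mul_nonneg hq'.le h6
          nlinarith

/-! ### The deflection at a collision and the frequency shift -/

/-- The angle `π - 2 arcsin h'` by which a collision with impact parameter `h'` turns the
velocity. -/
def deflection (h : ℝ) : Circle2Pi := ((Real.pi - 2 * Real.arcsin h : ℝ) : Circle2Pi)

@[fun_prop]
theorem measurable_deflection : Measurable deflection :=
  ((AddCircle.continuous_mk' _).comp
    (continuous_const.sub (continuous_const.mul Real.continuous_arcsin))).measurable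

theorem neg_deflection (h : ℝ) : -deflection h = deflection (-h) := by
  rw [deflection, deflection, ← AddCircle.coe_neg, Real.arcsin_neg, eq_comm, ← sub_eq_zero,
    ← AddCircle.coe_sub]
  convert! AddCircle.coe_period (2 * Real.pi) using 2
  ring

theorem velocity_coe (r : ℝ) : velocity (r : Circle2Pi) = !₂[Real.cos r, Real.sin r] := rfl

theorem continuous_velocity : Continuous velocity := by
  have h1 : Continuous (Real.cos_periodic.lift : Circle2Pi → ℝ) :=
    continuous_coinduced_dom.mpr Real.continuous_cos
  have h2 : Continuous (Real.sin_periodic.lift : Circle2Pi → ℝ) :=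
    continuous_coinduced_dom.mpr Real.continuous_sin
  unfold velocity
  refine (PiLp.continuous_toLp 2 _).comp (continuous_pi fun i => ?_)
  fin_cases i
  · exact h1
  · exact h2

/-- The angular frequency `2π k · v(θ)` at which free transport in the direction `θ` rotates the
`k`-th Fourier coefficient. -/
def frequency (k : Plane) (θ : Circle2Pi) : ℝ := 2 * Real.pi * inner ℝ k (velocity θ)

@[fun_prop]
theorem measurable_frequency (k : Plane) : Measurable (frequency k) :=
  (continuous_const.mul (continuous_const.inner continuous_velocity)).measurable

theorem frequency_coe (k : Plane) (r : ℝ) :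
    frequency k (r : Circle2Pi) = 2 * Real.pi * (k 0 * Real.cos r + k 1 * Real.sin r) := by
  rw [frequency, velocity_coe, PiLp.inner_apply, Fin.sum_univ_two]
  simp [mul_comm]

/-- With `β = arcsin h`, the shift of the frequency is `4π cos β (k · v(θ - β))`. -/
theorem frequency_sub_frequency (k : Plane) (r : ℝ) {h : ℝ} (hh : |h| ≤ 1) :
    frequency k (r : Circle2Pi) - frequency k ((r : Circle2Pi) + deflection h) =
      4 * Real.pi * √(1 - h ^ 2) * (√(1 - h ^ 2) * (k 0 * Real.cos r + k 1 * Real.sin r) +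
        h * (k 0 * Real.sin r - k 1 * Real.cos r)) := by
  have hs : √(1 - h ^ 2) ^ 2 = 1 - h ^ 2 :=
    Real.sq_sqrt (by rw [← sq_abs]; nlinarith [abs_nonneg h])
  rw [deflection, ← AddCircle.coe_add, frequency_coe, frequency_coe,
    show r + (Real.pi - 2 * Real.arcsin h) = r - 2 * Real.arcsin h + Real.pi by ring,
    Real.cos_add_pi, Real.sin_add_pi, Real.cos_sub, Real.sin_sub, Real.cos_two_mul,
    Real.sin_two_mul, Real.cos_arcsin, Real.sin_arcsin (abs_le.mp hh).1 (abs_le.mp hh).2, hs]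
  linear_combination (-4 * Real.pi * (k 0 * Real.cos r + k 1 * Real.sin r)) * hs

/-- On average over the impact parameter, a collision changes the frequency by an amount comparable
to `|k|`. The impact parameters `h` and `-h` are paired: the two shifts do not vanish together. -/
theorem le_lintegral_frequency_sub (k : Plane) (θ : Circle2Pi) :
    ENNReal.ofReal (min 1 (‖k‖ ^ 2) / 8) ≤ ∫⁻ h in Icc (-1 : ℝ) 1,
      ENNReal.ofReal (min 1 ((frequency k θ - frequency k (θ + deflection h)) ^ 2)) := by
  induction θ using QuotientAddGroup.induction_on with | _ r
  set f : ℝ → ℝ := fun h =>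
    min 1 ((frequency k (r : Circle2Pi) - frequency k ((r : Circle2Pi) + deflection h)) ^ 2) with hf
  have hfm : Measurable f := by fun_prop
  have hf0 : ∀ h, 0 ≤ f h := fun h => le_min zero_le_one (sq_nonneg _)
  have hk : ‖k‖ ^ 2 = k 0 ^ 2 + k 1 ^ 2 := by
    rw [EuclideanSpace.norm_sq_eq, Fin.sum_univ_two]; simp
  have key : ∀ h ∈ Icc (1 / 4 : ℝ) (1 / 2), min 1 (‖k‖ ^ 2) ≤ f h + f (-h) := by
    intro h hh
    have habs : |h| ≤ 1 := by rw [abs_of_nonneg] <;> linarith [hh.1, hh.2]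
    have hs : √(1 - h ^ 2) ^ 2 = 1 - h ^ 2 := Real.sq_sqrt (by nlinarith [hh.1, hh.2])
    simp only [hf]
    rw [frequency_sub_frequency k r habs, frequency_sub_frequency k r (by rwa [abs_neg]), neg_sq]
    set a := k 0 * Real.cos r + k 1 * Real.sin r with ha
    set b := k 0 * Real.sin r - k 1 * Real.cos r with hb
    set c := √(1 - h ^ 2) with hc
    have hab : a ^ 2 + b ^ 2 = ‖k‖ ^ 2 := by
      rw [hk, ha, hb]
      linear_combination (k 0 ^ 2 + k 1 ^ 2) * Real.sin_sq_add_cos_sq r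
    have hsum : ‖k‖ ^ 2 ≤ (4 * Real.pi * c * (c * a + h * b)) ^ 2 +
        (4 * Real.pi * c * (c * a + -h * b)) ^ 2 := by
      have e : (4 * Real.pi * c * (c * a + h * b)) ^ 2 +
          (4 * Real.pi * c * (c * a + -h * b)) ^ 2 =
          32 * Real.pi ^ 2 * c ^ 2 * (c ^ 2 * a ^ 2 + h ^ 2 * b ^ 2) := by ring
      have h9 : 9 ≤ Real.pi ^ 2 := by nlinarith [Real.pi_gt_three]
      have h1 : 3 / 4 ≤ 1 - h ^ 2 := by nlinarith [hh.1, hh.2]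
      have h2 : 1 / 16 ≤ h ^ 2 := by nlinarith [hh.1, hh.2]
      rw [e, hs, ← hab]
      calc a ^ 2 + b ^ 2 ≤ 32 * 9 * (3 / 4) * (1 / 16 * a ^ 2 + 1 / 16 * b ^ 2) := by
            nlinarith [sq_nonneg a, sq_nonneg b]
        _ ≤ _ := by
            gcongr
            linarith
    refine (min_le_min_left 1 hsum).trans ?_
    rcases le_total 1 ((4 * Real.pi * c * (c * a + h * b)) ^ 2) with h1 | h1
    · rw [min_eq_left h1]
      have : (0 : ℝ) ≤ min 1 ((4 * Real.pi * c * (c * a + -h * b)) ^ 2) :=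
        le_min zero_le_one (sq_nonneg _)
      linarith [min_le_left (1 : ℝ) ((4 * Real.pi * c * (c * a + h * b)) ^ 2 +
        (4 * Real.pi * c * (c * a + -h * b)) ^ 2)]
    · rw [min_eq_right h1]
      rcases le_total 1 ((4 * Real.pi * c * (c * a + -h * b)) ^ 2) with h2 | h2
      · rw [min_eq_left h2]
        linarith [min_le_left (1 : ℝ) ((4 * Real.pi * c * (c * a + h * b)) ^ 2 +
          (4 * Real.pi * c * (c * a + -h * b)) ^ 2),
          sq_nonneg (4 * Real.pi * c * (c * a + h * b))]
      · rw [min_eq_right h2]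
        exact min_le_right _ _
  have hdouble : 2 * ∫⁻ h in Icc (-1 : ℝ) 1, ENNReal.ofReal (f h) =
      ∫⁻ h in Icc (-1 : ℝ) 1, ENNReal.ofReal (f h + f (-h)) := by
    rw [two_mul]
    nth_rewrite 2 [← lintegral_Icc_neg]
    rw [← lintegral_add_left (by fun_prop)]
    refine lintegral_congr fun h => ?_
    rw [ENNReal.ofReal_add (hf0 _) (hf0 _)]
  have hlow : ENNReal.ofReal (min 1 (‖k‖ ^ 2) / 4) ≤
      ∫⁻ h in Icc (-1 : ℝ) 1, ENNReal.ofReal (f h + f (-h)) := by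
    calc ENNReal.ofReal (min 1 (‖k‖ ^ 2) / 4)
        = ∫⁻ h in Icc (1 / 4 : ℝ) (1 / 2), ENNReal.ofReal (min 1 (‖k‖ ^ 2)) := by
          rw [setLIntegral_const, Real.volume_Icc, ← ENNReal.ofReal_mul (by positivity)]
          congr 1
          ring
      _ ≤ ∫⁻ h in Icc (1 / 4 : ℝ) (1 / 2), ENNReal.ofReal (f h + f (-h)) :=
          setLIntegral_mono' measurableSet_Icc fun h hh => ENNReal.ofReal_le_ofReal (key h hh)
      _ ≤ _ := lintegral_mono_set (Icc_subset_Icc (by norm_num) (by norm_num))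
  rw [← hdouble] at hlow
  have h2 : ENNReal.ofReal (min 1 (‖k‖ ^ 2) / 4) =
      2 * ENNReal.ofReal (min 1 (‖k‖ ^ 2) / 8) := by
    rw [two_mul, ← ENNReal.ofReal_add (by positivity) (by positivity)]
    congr 1
    ring
  rw [h2] at hlow
  exact (ENNReal.mul_le_mul_iff_right two_ne_zero ENNReal.ofNat_ne_top).mp hlow

/-- The same bound, with the roles of the directions before and after exchanged. -/
theorem le_lintegral_frequency_sub' (k : Plane) (θ : Circle2Pi) :
    ENNReal.ofReal (min 1 (‖k‖ ^ 2) / 8) ≤ ∫⁻ h in Icc (-1 : ℝ) 1,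
      ENNReal.ofReal (min 1 ((frequency k (θ - deflection h) - frequency k θ) ^ 2)) := by
  refine (le_lintegral_frequency_sub k θ).trans_eq ?_
  rw [← lintegral_Icc_neg]
  refine lintegral_congr fun h => ?_
  rw [← neg_deflection, ← sub_eq_add_neg, ← neg_sub, neg_sq]

/-! ### Positive integral operators on `L^p` -/

/-- Schur's test, for the operator `g ↦ ∫ N(z, v) g(Φ(z, v)) dv`: if its kernel has mass at most `a`
from almost every point, and if it has norm at most `a` on nonnegative functions in `L¹`, then it
has norm at most `a` on `L^p`. -/
theorem eLpNorm_lintegral_mul_comp_le {Z₁ Z₂ V : Type*} [MeasurableSpace Z₁] [MeasurableSpace Z₂]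
    [MeasurableSpace V] {m₁ : Measure Z₁} {m₂ : Measure Z₂} {ν : Measure V} [SFinite ν]
    {N : Z₁ × V → ℝ≥0∞} {Φ : Z₁ × V → Z₂} (hN : Measurable N) (hΦ : Measurable Φ) {a : ℝ≥0∞}
    (hmass : ∀ᵐ z ∂m₁, ∫⁻ v, N (z, v) ∂ν ≤ a)
    (hL1 : ∀ G : Z₂ → ℝ≥0∞, Measurable G →
      ∫⁻ z, ∫⁻ v, N (z, v) * G (Φ (z, v)) ∂ν ∂m₁ ≤ a * ∫⁻ y, G y ∂m₂)
    {g : Z₂ → ℝ≥0∞} (hg : Measurable g) {p : ℝ≥0∞} (hp : 1 ≤ p) :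
    eLpNorm (fun z => ∫⁻ v, N (z, v) * g (Φ (z, v)) ∂ν) p m₁ ≤ a * eLpNorm g p m₂ := by
  have hκ : ∀ z, ∀ G : Z₂ → ℝ≥0∞, Measurable G →
      ∫⁻ y, G y ∂((ν.withDensity fun v => N (z, v)).map fun v => Φ (z, v)) =
        ∫⁻ v, N (z, v) * G (Φ (z, v)) ∂ν := by
    intro z G hG
    rw [lintegral_map hG (by fun_prop), lintegral_withDensity_eq_lintegral_mul _ (by fun_prop)
      (by fun_prop)]
    rfl
  have hmeas : ∀ G : Z₂ → ℝ≥0∞, Measurable G →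
      Measurable fun z => ∫⁻ v, N (z, v) * G (Φ (z, v)) ∂ν := fun G hG =>
    Measurable.lintegral_prod_right' (f := fun q : Z₁ × V => N q * G (Φ q)) (by fun_prop)
  rcases eq_or_ne p ∞ with rfl | hp'
  · rw [eLpNorm_exponent_top, eLpNorm_exponent_top]
    set c := eLpNormEssSup g m₂ with hc
    have hN0 : ∫⁻ y, {y | c < g y}.indicator 1 y ∂m₂ = 0 := by
      rw [lintegral_indicator_one (measurableSet_lt measurable_const hg)]
      have : ∀ᵐ y ∂m₂, g y ≤ c := by
        have := ae_le_eLpNormEssSup (f := g) (μ := m₂)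
        simpa using this
      simpa [ae_iff] using this
    have h0 := hL1 ({y | c < g y}.indicator 1)
      (measurable_one.indicator (measurableSet_lt measurable_const hg))
    rw [hN0, mul_zero, nonpos_iff_eq_zero, lintegral_eq_zero_iff (hmeas _
      (measurable_one.indicator (measurableSet_lt measurable_const hg)))] at h0
    refine eLpNormEssSup_le_of_ae_enorm_bound ?_
    filter_upwards [hmass, h0] with z hz1 hz2
    have hΦz : Measurable fun v => Φ (z, v) := by fun_prop
    have hi : Measurable fun v => ({y | c < g y}.indicator 1 (Φ (z, v)) : ℝ≥0∞) :=
      (measurable_one.indicator (measurableSet_lt measurable_const hg)).comp hΦz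
    rw [Pi.zero_apply, lintegral_eq_zero_iff (by fun_prop)] at hz2
    calc ‖∫⁻ v, N (z, v) * g (Φ (z, v)) ∂ν‖ₑ = ∫⁻ v, N (z, v) * g (Φ (z, v)) ∂ν := rfl
      _ ≤ ∫⁻ v, N (z, v) * c ∂ν := by
        refine lintegral_mono_ae ?_
        filter_upwards [hz2] with v hv
        by_cases hcg : c < g (Φ (z, v))
        · have hv' : N (z, v) = 0 := by
            simpa [indicator_of_mem (s := {y | c < g y}) hcg] using hv
          simp [hv']
        · gcongr
          exact not_lt.mp hcg
      _ = (∫⁻ v, N (z, v) ∂ν) * c := lintegral_mul_const _ (by fun_prop)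
      _ ≤ a * c := by gcongr
  · have hp0 : p ≠ 0 := (zero_lt_one.trans_le hp).ne'
    have hp1 : 1 ≤ p.toReal := by
      rw [← ENNReal.toReal_one]; exact ENNReal.toReal_mono hp' hp
    have hpp : 0 < p.toReal := zero_lt_one.trans_le hp1
    have hpt : ∀ᵐ z ∂m₁, (∫⁻ v, N (z, v) * g (Φ (z, v)) ∂ν) ^ p.toReal ≤
        a ^ (p.toReal - 1) * ∫⁻ v, N (z, v) * (g (Φ (z, v))) ^ p.toReal ∂ν := by
      filter_upwards [hmass] with z hz
      set κ := (ν.withDensity fun v => N (z, v)).map fun v => Φ (z, v) with hκdef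
      have hu : κ univ ≤ a := by
        rw [← lintegral_one, hκ z (fun _ => 1) measurable_const]
        simpa using hz
      have h := eLpNorm_le_eLpNorm_mul_rpow_measure_univ (μ := κ) (p := 1) (q := p) (f := g) hp
        hg.aestronglyMeasurable
      rw [eLpNorm_one_eq_lintegral_enorm, eLpNorm_eq_lintegral_rpow_enorm_toReal hp0 hp'] at h
      simp only [enorm_eq_self] at h
      rw [hκ z g hg, hκ z (fun y => g y ^ p.toReal) (by fun_prop)] at h
      have h' := ENNReal.rpow_le_rpow h hpp.le
      rw [ENNReal.mul_rpow_of_nonneg _ _ hpp.le, ← ENNReal.rpow_mul, ← ENNReal.rpow_mul,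
        one_div_mul_cancel hpp.ne', ENNReal.rpow_one, mul_comm] at h'
      refine h'.trans ?_
      have he : (1 / (1 : ℝ≥0∞).toReal - 1 / p.toReal) * p.toReal = p.toReal - 1 := by
        rw [ENNReal.toReal_one]; field_simp
      rw [he]
      gcongr
    rw [eLpNorm_eq_lintegral_rpow_enorm_toReal hp0 hp',
      eLpNorm_eq_lintegral_rpow_enorm_toReal hp0 hp']
    simp only [enorm_eq_self]
    calc (∫⁻ z, (∫⁻ v, N (z, v) * g (Φ (z, v)) ∂ν) ^ p.toReal ∂m₁) ^ (1 / p.toReal)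
        ≤ (∫⁻ z, a ^ (p.toReal - 1) * ∫⁻ v, N (z, v) * (g (Φ (z, v))) ^ p.toReal ∂ν ∂m₁) ^
          (1 / p.toReal) := ENNReal.rpow_le_rpow (lintegral_mono_ae hpt) (by positivity)
      _ ≤ (a ^ (p.toReal - 1) * (a * ∫⁻ y, g y ^ p.toReal ∂m₂)) ^ (1 / p.toReal) := by
          refine ENNReal.rpow_le_rpow ?_ (by positivity)
          rw [lintegral_const_mul _ (hmeas (fun y => g y ^ p.toReal) (by fun_prop))]
          gcongr
          exact hL1 (fun y => g y ^ p.toReal) (by fun_prop)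
      _ = a * (∫⁻ y, g y ^ p.toReal ∂m₂) ^ (1 / p.toReal) := by
          have h1 : a ^ (p.toReal - 1) * a = a ^ p.toReal := by
            nth_rewrite 2 [← ENNReal.rpow_one a]
            rw [← ENNReal.rpow_add_of_nonneg _ _ (by linarith) zero_le_one]
            congr 1
            ring
          rw [← mul_assoc, h1, ENNReal.mul_rpow_of_nonneg _ _ (by positivity), ← ENNReal.rpow_mul,
            mul_one_div_cancel hpp.ne', ENNReal.rpow_one]

/-! ### The collision operators -/

/-- Lebesgue measure on the set of `(θ, t, h)` with `θ ∈ ℝ / 2πℤ`, `t ∈ ℝ` and `h ∈ [-1, 1]`. -/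
def angleStripMeasure : Measure (Circle2Pi × ℝ × ℝ) :=
  (volume : Measure Circle2Pi).prod stripMeasure

instance : SFinite angleStripMeasure := by unfold angleStripMeasure; infer_instance

theorem ae_angleStripMeasure_of_ae {P : ℝ → Prop}
    (h : ∀ᵐ x ∂volume.restrict (Icc (-1 : ℝ) 1), P x) : ∀ᵐ y ∂angleStripMeasure, P y.2.2 :=
  (Measure.quasiMeasurePreserving_snd.comp Measure.quasiMeasurePreserving_snd).ae h

/-- The positive operator of one collision: `g` is read at the time and impact parameter of the
previous collision, `N` is the density of the flight between the two. -/
def collisionOp (N : ℝ × ℝ × ℝ → ℝ≥0∞) (g : Circle2Pi × ℝ × ℝ → ℝ≥0∞) (y : Circle2Pi × ℝ × ℝ) :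
    ℝ≥0∞ :=
  ∫⁻ w, N (y.2.1 - w.1, y.2.2, w.2) * g (y.1 + deflection w.2, w) ∂stripMeasure

@[fun_prop]
theorem measurable_collisionOp {N : ℝ × ℝ × ℝ → ℝ≥0∞} (hN : Measurable N)
    {g : Circle2Pi × ℝ × ℝ → ℝ≥0∞} (hg : Measurable g) : Measurable (collisionOp N g) :=
  Measurable.lintegral_prod_right' (f := fun q : (Circle2Pi × ℝ × ℝ) × ℝ × ℝ =>
    N (q.1.2.1 - q.2.1, q.1.2.2, q.2.2) * g (q.1.1 + deflection q.2.2, q.2)) (by fun_prop)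

theorem lintegral_collisionOp {N : ℝ × ℝ × ℝ → ℝ≥0∞} (hN : Measurable N)
    {g : Circle2Pi × ℝ × ℝ → ℝ≥0∞} (hg : Measurable g) :
    ∫⁻ y, collisionOp N g y ∂angleStripMeasure =
      ∫⁻ y, g y * ∫⁻ u, N (u.1, u.2, y.2.2) ∂stripMeasure ∂angleStripMeasure := by
  have hI : Measurable fun x : ℝ => ∫⁻ u, N (u.1, u.2, x) ∂stripMeasure :=
    Measurable.lintegral_prod_right' (f := fun q : ℝ × ℝ × ℝ => N (q.2.1, q.2.2, q.1)) (by fun_prop)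
  have hmo := measurable_collisionOp hN hg
  unfold angleStripMeasure
  rw [lintegral_prod _ hmo.aemeasurable, lintegral_prod_symm _ (by fun_prop)]
  simp only [collisionOp]
  calc ∫⁻ θ, ∫⁻ z, ∫⁻ w, N (z.1 - w.1, z.2, w.2) * g (θ + deflection w.2, w)
        ∂stripMeasure ∂stripMeasure
      = ∫⁻ θ, ∫⁻ w, g (θ + deflection w.2, w) * ∫⁻ u, N (u.1, u.2, w.2) ∂stripMeasure
          ∂stripMeasure := by
        refine lintegral_congr fun θ => ?_
        rw [lintegral_lintegral_swap (by fun_prop)]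
        refine lintegral_congr fun w => ?_
        rw [lintegral_mul_const _ (by fun_prop), mul_comm]
        congr 1
        exact lintegral_stripMeasure_sub (f := fun u => N (u.1, u.2, w.2)) (by fun_prop) w.1
    _ = ∫⁻ w, ∫⁻ θ, g (θ, w) * (∫⁻ u, N (u.1, u.2, w.2) ∂stripMeasure) ∂volume
          ∂stripMeasure := by
        rw [lintegral_lintegral_swap (by fun_prop)]
        refine lintegral_congr fun w => ?_
        exact lintegral_add_right_eq_self
          (fun θ => g (θ, w) * ∫⁻ u, N (u.1, u.2, w.2) ∂stripMeasure) (deflection w.2)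

theorem lintegral_collisionOp_le {N : ℝ × ℝ × ℝ → ℝ≥0∞} (hN : Measurable N)
    (hsymm : ∀ s h h', N (s, h, h') = N (s, h', h)) {a : ℝ≥0∞}
    (ha : ∀ᵐ h ∂volume.restrict (Icc (-1 : ℝ) 1), ∫⁻ w, N (w.1, h, w.2) ∂stripMeasure ≤ a)
    {g : Circle2Pi × ℝ × ℝ → ℝ≥0∞} (hg : Measurable g) :
    ∫⁻ y, collisionOp N g y ∂angleStripMeasure ≤ a * ∫⁻ y, g y ∂angleStripMeasure := by
  rw [lintegral_collisionOp hN hg, ← lintegral_const_mul _ hg]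
  refine lintegral_mono_ae ?_
  filter_upwards [ae_angleStripMeasure_of_ae ha] with y hy
  rw [mul_comm]
  gcongr
  simpa only [hsymm _ y.2.2] using hy

theorem eLpNorm_collisionOp_le {N : ℝ × ℝ × ℝ → ℝ≥0∞} (hN : Measurable N)
    (hsymm : ∀ s h h', N (s, h, h') = N (s, h', h)) {a : ℝ≥0∞}
    (ha : ∀ᵐ h ∂volume.restrict (Icc (-1 : ℝ) 1), ∫⁻ w, N (w.1, h, w.2) ∂stripMeasure ≤ a)
    {g : Circle2Pi × ℝ × ℝ → ℝ≥0∞} (hg : Measurable g) {p : ℝ≥0∞} (hp : 1 ≤ p) :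
    eLpNorm (collisionOp N g) p angleStripMeasure ≤ a * eLpNorm g p angleStripMeasure := by
  refine eLpNorm_lintegral_mul_comp_le (Z₁ := Circle2Pi × ℝ × ℝ) (V := ℝ × ℝ) (ν := stripMeasure)
    (N := fun q => N (q.1.2.1 - q.2.1, q.1.2.2, q.2.2))
    (Φ := fun q => (q.1.1 + deflection q.2.2, q.2)) (by fun_prop) (by fun_prop) ?_
    (fun G hG => lintegral_collisionOp_le hN hsymm ha hG) hg hp
  filter_upwards [ae_angleStripMeasure_of_ae ha] with y hy
  refine le_of_eq_of_le ?_ hy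
  exact lintegral_stripMeasure_rsub (f := fun w => N (w.1, y.2.2, w.2)) (by fun_prop) y.2.1

/-- The product of the strip, with coordinates `(t'', h'')`, and of the interval `[-1, 1]`, with
coordinate `h'`: the data of a path that comes from a collision `(t'', h'')` through an intermediate
one with impact parameter `h'`. -/
def pathMeasure : Measure ((ℝ × ℝ) × ℝ) := stripMeasure.prod (volume.restrict (Icc (-1 : ℝ) 1))

instance : SFinite pathMeasure := by unfold pathMeasure; infer_instance

/-- The positive operator of two successive collisions with density `M`. -/
def pathOp (M : (Circle2Pi × ℝ × ℝ) × (ℝ × ℝ) × ℝ → ℝ≥0∞) (g : Circle2Pi × ℝ × ℝ → ℝ≥0∞)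
    (y : Circle2Pi × ℝ × ℝ) : ℝ≥0∞ :=
  ∫⁻ v, M (y, v) * g (y.1 + deflection v.2 + deflection v.1.2, v.1) ∂pathMeasure

@[fun_prop]
theorem measurable_pathOp {M : (Circle2Pi × ℝ × ℝ) × (ℝ × ℝ) × ℝ → ℝ≥0∞} (hM : Measurable M)
    {g : Circle2Pi × ℝ × ℝ → ℝ≥0∞} (hg : Measurable g) : Measurable (pathOp M g) :=
  Measurable.lintegral_prod_right' (f := fun q : (Circle2Pi × ℝ × ℝ) × (ℝ × ℝ) × ℝ =>
    M q * g (q.1.1 + deflection q.2.2 + deflection q.2.1.2, q.2.1)) (by fun_prop)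

theorem lintegral_pathMeasure {f : (ℝ × ℝ) × ℝ → ℝ≥0∞} (hf : Measurable f) :
    ∫⁻ v, f v ∂pathMeasure = ∫⁻ w, (∫⁻ x in Icc (-1 : ℝ) 1, f (w, x)) ∂stripMeasure :=
  lintegral_prod _ hf.aemeasurable

theorem lintegral_pathOp {M : (Circle2Pi × ℝ × ℝ) × (ℝ × ℝ) × ℝ → ℝ≥0∞} (hM : Measurable M)
    {g : Circle2Pi × ℝ × ℝ → ℝ≥0∞} (hg : Measurable g) :
    ∫⁻ y, pathOp M g y ∂angleStripMeasure =
      ∫⁻ y, g y * ∫⁻ v, M ((y.1 - deflection y.2.2 - deflection v.2, v.1), (y.2, v.2)) ∂pathMeasure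
        ∂angleStripMeasure := by
  have hI : Measurable fun y : Circle2Pi × ℝ × ℝ =>
      ∫⁻ v, M ((y.1 - deflection y.2.2 - deflection v.2, v.1), (y.2, v.2)) ∂pathMeasure :=
    Measurable.lintegral_prod_right' (f := fun q : (Circle2Pi × ℝ × ℝ) × (ℝ × ℝ) × ℝ =>
      M ((q.1.1 - deflection q.1.2.2 - deflection q.2.2, q.2.1), (q.1.2, q.2.2))) (by fun_prop)
  have hmo := measurable_pathOp hM hg
  unfold angleStripMeasure
  rw [lintegral_prod _ hmo.aemeasurable, lintegral_prod_symm _ (by fun_prop)]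
  simp only [pathOp]
  -- the density at the base point `(θ, z)`, reached from `w` through the impact parameter `x`
  set F : Circle2Pi → ℝ × ℝ → ℝ × ℝ → ℝ → ℝ≥0∞ := fun θ z w x =>
    M ((θ, z), (w, x)) * g (θ + deflection x + deflection w.2, w) with hF
  have hFm : Measurable fun q : Circle2Pi × (ℝ × ℝ) × (ℝ × ℝ) × ℝ =>
      F q.1 q.2.1 q.2.2.1 q.2.2.2 := by simp only [hF]; fun_prop
  have hG : Measurable fun q : Circle2Pi × (ℝ × ℝ) × (ℝ × ℝ) =>
      ∫⁻ x in Icc (-1 : ℝ) 1, F q.1 q.2.1 q.2.2 x :=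
    Measurable.lintegral_prod_right' (f := fun q : (Circle2Pi × (ℝ × ℝ) × (ℝ × ℝ)) × ℝ =>
      F q.1.1 q.1.2.1 q.1.2.2 q.2) (by fun_prop)
  have hG' : Measurable fun q : Circle2Pi × (ℝ × ℝ) =>
      ∫⁻ z, (∫⁻ x in Icc (-1 : ℝ) 1, F q.1 z q.2 x) ∂stripMeasure :=
    Measurable.lintegral_prod_right' (f := fun q : (Circle2Pi × (ℝ × ℝ)) × (ℝ × ℝ) =>
      ∫⁻ x in Icc (-1 : ℝ) 1, F q.1.1 q.2 q.1.2 x) (by fun_prop)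
  calc ∫⁻ θ, ∫⁻ z, ∫⁻ v, M ((θ, z), v) * g (θ + deflection v.2 + deflection v.1.2, v.1)
        ∂pathMeasure ∂stripMeasure
      = ∫⁻ θ, ∫⁻ w, ∫⁻ z, (∫⁻ x in Icc (-1 : ℝ) 1, F θ z w x) ∂stripMeasure ∂stripMeasure := by
        refine lintegral_congr fun θ => ?_
        trans ∫⁻ z, ∫⁻ w, (∫⁻ x in Icc (-1 : ℝ) 1, F θ z w x) ∂stripMeasure ∂stripMeasure
        · refine lintegral_congr fun z => ?_
          rw [lintegral_pathMeasure (by fun_prop)]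
        · rw [lintegral_lintegral_swap (by fun_prop)]
    _ = ∫⁻ w, ∫⁻ θ, ∫⁻ v, F θ v.1 w v.2 ∂pathMeasure ∂volume ∂stripMeasure := by
        rw [lintegral_lintegral_swap (by fun_prop)]
        refine lintegral_congr fun w => lintegral_congr fun θ => ?_
        rw [lintegral_pathMeasure (by fun_prop)]
    _ = _ := by
        refine lintegral_congr fun w => ?_
        trans ∫⁻ v, ∫⁻ θ, g (θ, w) *
          M ((θ - deflection w.2 - deflection v.2, v.1), (w, v.2)) ∂volume ∂pathMeasure
        · rw [lintegral_lintegral_swap (by fun_prop)]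
          refine lintegral_congr fun v => ?_
          conv_rhs => rw [← lintegral_add_right_eq_self _ (deflection v.2 + deflection w.2)]
          refine lintegral_congr fun θ => ?_
          simp only [hF]
          rw [mul_comm, ← add_assoc]
          congr 4
          abel
        · rw [lintegral_lintegral_swap (by fun_prop)]
          exact lintegral_congr fun θ => lintegral_const_mul _ (by fun_prop)

/-- The density of flights of two steps: the intermediate collision time is integrated out. -/
def stepConv (N₁ N₂ : ℝ × ℝ × ℝ → ℝ≥0∞) (z : ℝ × ℝ) (v : (ℝ × ℝ) × ℝ) : ℝ≥0∞ :=
  ∫⁻ t', N₁ (z.1 - t', z.2, v.2) * N₂ (t' - v.1.1, v.2, v.1.2)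

@[fun_prop]
theorem measurable_stepConv {N₁ N₂ : ℝ × ℝ × ℝ → ℝ≥0∞} (h₁ : Measurable N₁) (h₂ : Measurable N₂)
    {ι : Type*} [MeasurableSpace ι] {z : ι → ℝ × ℝ} {v : ι → (ℝ × ℝ) × ℝ} (hz : Measurable z)
    (hv : Measurable v) : Measurable fun i => stepConv N₁ N₂ (z i) (v i) :=
  Measurable.lintegral_prod_right' (f := fun q : ι × ℝ =>
    N₁ ((z q.1).1 - q.2, (z q.1).2, (v q.1).2) *
      N₂ (q.2 - (v q.1).1.1, (v q.1).2, (v q.1).1.2)) (by fun_prop)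

theorem lintegral_stepConv_le {N₁ N₂ : ℝ × ℝ × ℝ → ℝ≥0∞} (h₁ : Measurable N₁)
    (h₂ : Measurable N₂) {a₁ a₂ : ℝ≥0∞} {z : ℝ × ℝ}
    (ha₁ : ∫⁻ w, N₁ (w.1, z.2, w.2) ∂stripMeasure ≤ a₁)
    (ha₂ : ∀ᵐ h ∂volume.restrict (Icc (-1 : ℝ) 1), ∫⁻ w, N₂ (w.1, h, w.2) ∂stripMeasure ≤ a₂) :
    ∫⁻ v, stepConv N₁ N₂ z v ∂pathMeasure ≤ a₁ * a₂ := by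
  rw [lintegral_pathMeasure (by fun_prop)]
  have hae : ∀ᵐ u ∂stripMeasure, ∫⁻ w, N₂ (w.1, u.2, w.2) ∂stripMeasure ≤ a₂ :=
    Measure.quasiMeasurePreserving_snd.ae ha₂
  calc ∫⁻ w, (∫⁻ x in Icc (-1 : ℝ) 1, stepConv N₁ N₂ z (w, x)) ∂stripMeasure
      = ∫⁻ w, ∫⁻ u, N₁ (z.1 - u.1, z.2, u.2) * N₂ (u.1 - w.1, u.2, w.2) ∂stripMeasure
          ∂stripMeasure := by
        refine lintegral_congr fun w => ?_
        rw [lintegral_stripMeasure_symm (by fun_prop)]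
        rfl
    _ = ∫⁻ u, N₁ (z.1 - u.1, z.2, u.2) * ∫⁻ w, N₂ (w.1, u.2, w.2) ∂stripMeasure
          ∂stripMeasure := by
        rw [lintegral_lintegral_swap (by fun_prop)]
        refine lintegral_congr fun u => ?_
        rw [lintegral_const_mul _ (by fun_prop)]
        congr 1
        exact lintegral_stripMeasure_rsub (f := fun w => N₂ (w.1, u.2, w.2)) (by fun_prop) u.1
    _ ≤ ∫⁻ u, N₁ (z.1 - u.1, z.2, u.2) * a₂ ∂stripMeasure := by
        refine lintegral_mono_ae ?_
        filter_upwards [hae] with u hu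
        gcongr
    _ ≤ a₁ * a₂ := by
        rw [lintegral_mul_const _ (by fun_prop),
          lintegral_stripMeasure_rsub (f := fun u => N₁ (u.1, z.2, u.2)) (by fun_prop) z.1]
        gcongr

theorem lintegral_stepConv_le' {N₁ N₂ : ℝ × ℝ × ℝ → ℝ≥0∞} (h₁ : Measurable N₁)
    (h₂ : Measurable N₂) (s₁ : ∀ s h h', N₁ (s, h, h') = N₁ (s, h', h))
    (s₂ : ∀ s h h', N₂ (s, h, h') = N₂ (s, h', h)) {a₁ a₂ : ℝ≥0∞} {z : ℝ × ℝ}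
    (ha₁ : ∀ᵐ h ∂volume.restrict (Icc (-1 : ℝ) 1), ∫⁻ w, N₁ (w.1, h, w.2) ∂stripMeasure ≤ a₁)
    (ha₂ : ∫⁻ w, N₂ (w.1, z.2, w.2) ∂stripMeasure ≤ a₂) :
    ∫⁻ v, stepConv N₁ N₂ v.1 (z, v.2) ∂pathMeasure ≤ a₁ * a₂ := by
  rw [lintegral_pathMeasure (by fun_prop)]
  have hae : ∀ᵐ u ∂stripMeasure, ∫⁻ w, N₁ (w.1, u.2, w.2) ∂stripMeasure ≤ a₁ :=
    Measure.quasiMeasurePreserving_snd.ae ha₁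
  calc ∫⁻ w, (∫⁻ x in Icc (-1 : ℝ) 1, stepConv N₁ N₂ w (z, x)) ∂stripMeasure
      = ∫⁻ w, ∫⁻ u, N₁ (w.1 - u.1, u.2, w.2) * N₂ (u.1 - z.1, z.2, u.2) ∂stripMeasure
          ∂stripMeasure := by
        refine lintegral_congr fun w => ?_
        rw [lintegral_stripMeasure_symm (by fun_prop)]
        simp only [stepConv, s₁ _ w.2, s₂ _ _ z.2]
    _ = ∫⁻ u, (∫⁻ w, N₁ (w.1, u.2, w.2) ∂stripMeasure) * N₂ (u.1 - z.1, z.2, u.2)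
          ∂stripMeasure := by
        rw [lintegral_lintegral_swap (by fun_prop)]
        refine lintegral_congr fun u => ?_
        rw [lintegral_mul_const _ (by fun_prop)]
        congr 1
        exact lintegral_stripMeasure_sub (f := fun w => N₁ (w.1, u.2, w.2)) (by fun_prop) u.1
    _ ≤ ∫⁻ u, a₁ * N₂ (u.1 - z.1, z.2, u.2) ∂stripMeasure := by
        refine lintegral_mono_ae ?_
        filter_upwards [hae] with u hu
        gcongr
    _ ≤ a₁ * a₂ := by
        rw [lintegral_const_mul _ (by fun_prop),
          lintegral_stripMeasure_sub (f := fun u => N₂ (u.1, z.2, u.2)) (by fun_prop) z.1]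
        gcongr

theorem eLpNorm_pathOp_le {M : (Circle2Pi × ℝ × ℝ) × (ℝ × ℝ) × ℝ → ℝ≥0∞} (hM : Measurable M)
    {a : ℝ≥0∞} (ha : ∀ᵐ y ∂angleStripMeasure, ∫⁻ v, M (y, v) ∂pathMeasure ≤ a)
    (ha' : ∀ᵐ y ∂angleStripMeasure, ∫⁻ v,
      M ((y.1 - deflection y.2.2 - deflection v.2, v.1), (y.2, v.2)) ∂pathMeasure ≤ a)
    {g : Circle2Pi × ℝ × ℝ → ℝ≥0∞} (hg : Measurable g) {p : ℝ≥0∞} (hp : 1 ≤ p) :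
    eLpNorm (pathOp M g) p angleStripMeasure ≤ a * eLpNorm g p angleStripMeasure := by
  refine eLpNorm_lintegral_mul_comp_le (Z₁ := Circle2Pi × ℝ × ℝ) (V := (ℝ × ℝ) × ℝ)
    (ν := pathMeasure) (N := M)
    (Φ := fun q => (q.1.1 + deflection q.2.2 + deflection q.2.1.2, q.2.1)) (by fun_prop)
    (by fun_prop) ha (fun G hG => ?_) hg hp
  change ∫⁻ y, pathOp M G y ∂angleStripMeasure ≤ _
  rw [lintegral_pathOp hM hG, ← lintegral_const_mul _ hG]
  refine lintegral_mono_ae ?_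
  filter_upwards [ha'] with y hy
  rw [mul_comm]
  gcongr

/-! ### The oscillating two-step kernel -/

/-- The kernel of two successive collisions for the `k`-th Fourier coefficient: the intermediate
collision time `t'` is integrated out, while the intermediate impact parameter `h'` is kept, since
it is determined by the velocities before and after. -/
def pairKernel (k : Plane) (q : (Circle2Pi × ℝ × ℝ) × (ℝ × ℝ) × ℝ) : ℂ :=
  ∫ t', ((Q (q.1.2.1 - t') q.1.2.2 q.2.2 * Q (t' - q.2.1.1) q.2.2 q.2.1.2 : ℝ) : ℂ) *
    Complex.exp (Complex.I * (((q.1.2.1 - t') * frequency k q.1.1 +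
      (t' - q.2.1.1) * frequency k (q.1.1 + deflection q.2.2) : ℝ) : ℂ))

@[fun_prop]
theorem measurable_pairKernel (k : Plane) : Measurable (pairKernel k) := by
  refine StronglyMeasurable.measurable ?_
  refine StronglyMeasurable.integral_prod_right'
    (f := fun r : ((Circle2Pi × ℝ × ℝ) × (ℝ × ℝ) × ℝ) × ℝ =>
      ((Q (r.1.1.2.1 - r.2) r.1.1.2.2 r.1.2.2 * Q (r.2 - r.1.2.1.1) r.1.2.2 r.1.2.1.2 : ℝ) : ℂ) *
      Complex.exp (Complex.I * (((r.1.1.2.1 - r.2) * frequency k r.1.1.1 +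
        (r.2 - r.1.2.1.1) * frequency k (r.1.1.1 + deflection r.1.2.2) : ℝ) : ℂ))) ?_
  refine Measurable.stronglyMeasurable ?_
  fun_prop

/-- `Qe` as a function of a triple. -/
def kernelFn (q : ℝ × ℝ × ℝ) : ℝ≥0∞ := Qe q.1 q.2.1 q.2.2

@[fun_prop]
theorem measurable_kernelFn : Measurable kernelFn := by unfold kernelFn; fun_prop

theorem kernelFn_symm (s h h' : ℝ) : kernelFn (s, h, h') = kernelFn (s, h', h) := Qe_swap _ _ _

theorem enorm_exp_I_mul (x : ℝ) : ‖Complex.exp (Complex.I * (x : ℂ))‖ₑ = 1 := by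
  rw [← ofReal_norm, mul_comm, Complex.norm_exp_ofReal_mul_I, ENNReal.ofReal_one]

theorem enorm_Q (s h h' : ℝ) : ‖Q s h h'‖ₑ = Qe s h h' :=
  Real.enorm_of_nonneg (Q_nonneg _ _ _)

theorem enorm_pairKernel_le (k : Plane) (y : Circle2Pi × ℝ × ℝ) (v : (ℝ × ℝ) × ℝ) :
    ‖pairKernel k (y, v)‖ₑ ≤ stepConv kernelFn kernelFn y.2 v := by
  refine (enorm_integral_le_lintegral_enorm _).trans_eq (lintegral_congr fun t' => ?_)
  rw [enorm_mul, enorm_exp_I_mul, mul_one, Complex.ofReal_mul, enorm_mul]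
  simp only [kernelFn, ← enorm_Q]
  rw [← ofReal_norm, ← ofReal_norm, Complex.norm_real, Complex.norm_real,
    ofReal_norm, ofReal_norm]

/-- The gain due to cancellation in the two-step kernel. It is claimed only for flights of total
time between `1/4` and `1/2`, on which the kernel is constant. -/
def pairGain (k : Plane) (q : (Circle2Pi × ℝ × ℝ) × (ℝ × ℝ) × ℝ) : ℝ≥0∞ :=
  (Icc (1 / 4 : ℝ) (1 / 2)).indicator (fun _ => ENNReal.ofReal
    (min 1 ((frequency k q.1.1 - frequency k (q.1.1 + deflection q.2.2)) ^ 2) / 15000))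
    (q.1.2.1 - q.2.1.1)

@[fun_prop]
theorem measurable_pairGain (k : Plane) : Measurable (pairGain k) := by
  have : pairGain k = {q : (Circle2Pi × ℝ × ℝ) × (ℝ × ℝ) × ℝ |
      q.1.2.1 - q.2.1.1 ∈ Icc (1 / 4 : ℝ) (1 / 2)}.indicator fun q => ENNReal.ofReal
      (min 1 ((frequency k q.1.1 - frequency k (q.1.1 + deflection q.2.2)) ^ 2) / 15000) := by
    ext q
    simp [pairGain, indicator]
  rw [this]
  refine Measurable.indicator (by fun_prop) ?_
  exact measurableSet_Icc.preimage (f := fun q : (Circle2Pi × ℝ × ℝ) × (ℝ × ℝ) × ℝ =>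
    q.1.2.1 - q.2.1.1) (by fun_prop)

/-- Phase cancellation, pointwise: the gain is what the modulus of the two-step kernel loses against
the positive two-step kernel. -/
theorem enorm_pairKernel_add_pairGain_le (k : Plane) (y : Circle2Pi × ℝ × ℝ) (v : (ℝ × ℝ) × ℝ)
    (hy : y.2.2 ∈ Icc (-1 : ℝ) 1) (hv : v.2 ∈ Icc (-1 : ℝ) 1) (hv' : v.1.2 ∈ Icc (-1 : ℝ) 1) :
    ‖pairKernel k (y, v)‖ₑ + pairGain k (y, v) ≤ stepConv kernelFn kernelFn y.2 v := by
  obtain ⟨θ, t, h⟩ := y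
  obtain ⟨⟨t'', h''⟩, h'⟩ := v
  simp only at hy hv hv'
  by_cases hm : t - t'' ∈ Icc (1 / 4 : ℝ) (1 / 2)
  · have hle : t'' ≤ t := by linarith [hm.1]
    set c : ℝ := 6 / Real.pi ^ 2 with hc
    have hc0 : 0 ≤ c := by positivity
    have hout : ∀ t', t' ∉ Icc t'' t → Q (t - t') h h' * Q (t' - t'') h' h'' = 0 := by
      intro t' ht'
      rcases lt_or_ge t' t'' with h1 | h1
      · rw [Q_of_neg (by linarith : t' - t'' < 0), mul_zero]
      · have : t < t' := by
          by_contra h2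
          exact ht' ⟨h1, not_lt.mp h2⟩
        rw [Q_of_neg (by linarith : t - t' < 0), zero_mul]
    have hin : ∀ t' ∈ Icc t'' t, Q (t - t') h h' * Q (t' - t'') h' h'' = c ^ 2 := by
      intro t' ht'
      rw [Q_of_le_half (by linarith [ht'.2]) (by linarith [ht'.1, hm.2]) hy hv,
        Q_of_le_half (by linarith [ht'.1]) (by linarith [ht'.2, hm.2]) hv hv', ← hc]
      ring
    have e1 : stepConv kernelFn kernelFn (t, h) ((t'', h''), h') =
        ENNReal.ofReal (c ^ 2 * (t - t'')) := by
      have : ∀ t', kernelFn (t - t', h, h') * kernelFn (t' - t'', h', h'') =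
          (Icc t'' t).indicator (fun _ => ENNReal.ofReal (c ^ 2)) t' := by
        intro t'
        rw [kernelFn, kernelFn, Qe, Qe, ← ENNReal.ofReal_mul (Q_nonneg _ _ _)]
        by_cases ht' : t' ∈ Icc t'' t
        · rw [indicator_of_mem ht', hin t' ht']
        · rw [indicator_of_notMem ht', hout t' ht', ENNReal.ofReal_zero]
      simp only [stepConv, this]
      rw [lintegral_indicator_const measurableSet_Icc, Real.volume_Icc,
        ← ENNReal.ofReal_mul (by positivity)]
    have e2 : pairKernel k ((θ, t, h), ((t'', h''), h')) = (c ^ 2 : ℝ) * ∫ u in t''..t,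
        Complex.exp (Complex.I * ((t * frequency k θ - t'' * frequency k (θ + deflection h') +
          (frequency k (θ + deflection h') - frequency k θ) * u : ℝ) : ℂ)) := by
      rw [← intervalIntegral.integral_const_mul, intervalIntegral.integral_of_le hle,
        ← integral_Icc_eq_integral_Ioc, ← integral_indicator measurableSet_Icc, pairKernel]
      refine integral_congr_ae (ae_of_all _ fun t' => ?_)
      simp only
      by_cases ht' : t' ∈ Icc t'' t
      · rw [indicator_of_mem ht', hin t' ht']
        congr 4
        ring
      · rw [indicator_of_notMem ht', hout t' ht', Complex.ofReal_zero, zero_mul]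
    have hosc := norm_integral_exp_le hm.1
      (t * frequency k θ - t'' * frequency k (θ + deflection h'))
      (frequency k (θ + deflection h') - frequency k θ)
    rw [e1, e2, pairGain, indicator_of_mem hm, ← ofReal_norm, norm_mul, Complex.norm_real,
      Real.norm_of_nonneg (by positivity), ← neg_sub (frequency k (θ + deflection h')), neg_sq]
    set m := min 1 ((frequency k (θ + deflection h') - frequency k θ) ^ 2) with hmdef
    have hm0 : 0 ≤ m := le_min zero_le_one (sq_nonneg _)
    rw [← ENNReal.ofReal_add (by positivity) (by positivity)]
    refine ENNReal.ofReal_le_ofReal ?_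
    have hc2 : 36 / 100 ≤ c ^ 2 := by
      have h1 : Real.pi ^ 2 ≤ 10 := by nlinarith [Real.pi_lt_d2, Real.pi_pos]
      have h2 : 6 / 10 ≤ c := by rw [hc]; gcongr
      nlinarith
    have := mul_le_mul_of_nonneg_left hosc (sq_nonneg c)
    nlinarith [mul_le_mul_of_nonneg_right hc2 hm0]
  · rw [pairGain, indicator_of_notMem hm, add_zero]
    exact enorm_pairKernel_le k _ _

theorem ae_lintegral_kernelFn_le : ∀ᵐ h ∂volume.restrict (Icc (-1 : ℝ) 1),
    ∫⁻ w, kernelFn (w.1, h, w.2) ∂stripMeasure ≤ 1 :=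
  ae_lintegral_Qe.mono fun _ h => h.le

/-- The kernel with a weight depending on the free path. -/
def weightedKernel (T : ℝ) (q : ℝ × ℝ × ℝ) : ℝ≥0∞ := lagWeight T q.1 * kernelFn q

@[fun_prop]
theorem measurable_weightedKernel (T : ℝ) : Measurable (weightedKernel T) := by
  unfold weightedKernel; fun_prop

theorem weightedKernel_symm (T s h h' : ℝ) :
    weightedKernel T (s, h, h') = weightedKernel T (s, h', h) := by
  rw [weightedKernel, weightedKernel, kernelFn_symm]

theorem ae_lintegral_weightedKernel_le {T : ℝ} (hT : 0 < T) :
    ∀ᵐ h ∂volume.restrict (Icc (-1 : ℝ) 1),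
      ∫⁻ w, weightedKernel T (w.1, h, w.2) ∂stripMeasure ≤ ENNReal.ofReal (16 / T) := by
  rw [ae_restrict_iff' measurableSet_Icc]
  exact ae_of_all _ fun h hh => lintegral_lagWeight_mul_Qe_le hT (abs_le.mpr hh)

/-- The contraction constant for frequency `k`: the two-step operator has norm at most
`1 - gap k`. The denominator is `2 * 15000 * 8`: the total flight time ranges over an interval of
length `1 / 4` and one impact parameter over `[-1, 1]`, which yields `1 / 2`, while `15000` is the
constant in `pairGain`, and `8` that in the mean shift of the frequency. -/
def gap (k : Plane) : ℝ := min 1 (‖k‖ ^ 2) / 240000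

theorem gap_le_one (k : Plane) : gap k ≤ 1 := by
  unfold gap
  have := min_le_left 1 (‖k‖ ^ 2)
  linarith

theorem gap_pos {k : Plane} (hk : k ≠ 0) : 0 < gap k := by
  have : 0 < ‖k‖ := norm_pos_iff.mpr hk
  unfold gap
  positivity

/-- The two-step operator for the `k`-th Fourier coefficient. -/
def pairOp (k : Plane) : (Circle2Pi × ℝ × ℝ → ℝ≥0∞) → Circle2Pi × ℝ × ℝ → ℝ≥0∞ :=
  pathOp fun q => ‖pairKernel k q‖ₑ

@[fun_prop]
theorem measurable_enorm_pairKernel (k : Plane) : Measurable fun q => ‖pairKernel k q‖ₑ :=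
  (measurable_pairKernel k).enorm

theorem lintegral_indicator_lag_mul (f : ℝ → ℝ≥0∞) (hf : Measurable f) (φ : ℝ → ℝ)
    (hφ : MeasurePreserving φ) :
    ∫⁻ v, (Icc (1 / 4 : ℝ) (1 / 2)).indicator (fun _ => f v.2) (φ v.1.1) ∂pathMeasure =
      ENNReal.ofReal (1 / 2) * ∫⁻ x in Icc (-1 : ℝ) 1, f x := by
  have hφm := hφ.measurable
  set χ : ℝ → ℝ≥0∞ := (Icc (1 / 4 : ℝ) (1 / 2)).indicator 1 with hχ
  have hχm : Measurable χ := measurable_one.indicator measurableSet_Icc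
  have h1 : ∀ v : (ℝ × ℝ) × ℝ, (Icc (1 / 4 : ℝ) (1 / 2)).indicator (fun _ => f v.2) (φ v.1.1) =
      χ (φ v.1.1) * f v.2 := fun v => by
    by_cases h : φ v.1.1 ∈ Icc (1 / 4 : ℝ) (1 / 2)
    · rw [hχ, indicator_of_mem h, indicator_of_mem h, Pi.one_apply, one_mul]
    · rw [hχ, indicator_of_notMem h, indicator_of_notMem h, zero_mul]
  simp only [h1]
  rw [lintegral_pathMeasure (by fun_prop)]
  simp only
  simp_rw [fun w : ℝ × ℝ => lintegral_const_mul (μ := volume.restrict (Icc (-1 : ℝ) 1))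
    (χ (φ w.1)) hf]
  rw [lintegral_mul_const _ (by fun_prop), lintegral_stripMeasure (by fun_prop)]
  simp only
  congr 1
  simp_rw [lintegral_const]
  rw [lintegral_mul_const _ (by fun_prop), hφ.lintegral_comp hχm, hχ,
    lintegral_indicator_one measurableSet_Icc, Measure.restrict_apply_univ, Real.volume_Icc,
    Real.volume_Icc, ← ENNReal.ofReal_mul (by norm_num)]
  norm_num

theorem le_ofReal_one_sub_of_add_le {a b : ℝ≥0∞} {δ : ℝ} (hδ : 0 ≤ δ)
    (h : a + b ≤ 1) (hb : ENNReal.ofReal δ ≤ b) : a ≤ ENNReal.ofReal (1 - δ) := by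
  rw [ENNReal.ofReal_sub _ hδ, ENNReal.ofReal_one]
  exact ENNReal.le_sub_of_add_le_right ENNReal.ofReal_ne_top ((add_le_add_right hb a).trans h)

theorem gap_nonneg (k : Plane) : 0 ≤ gap k := by unfold gap; positivity

theorem ofReal_gap_le {k : Plane} {φ : ℝ → ℝ≥0∞}
    (h : ENNReal.ofReal (min 1 (‖k‖ ^ 2) / 8) ≤ ∫⁻ x in Icc (-1 : ℝ) 1, φ x) :
    ENNReal.ofReal (gap k) ≤
      ENNReal.ofReal (1 / 2) * ∫⁻ x in Icc (-1 : ℝ) 1, ENNReal.ofReal (1 / 15000) * φ x := by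
  rw [lintegral_const_mul' _ _ ENNReal.ofReal_ne_top]
  calc ENNReal.ofReal (gap k) = ENNReal.ofReal (1 / 2) *
        (ENNReal.ofReal (1 / 15000) * ENNReal.ofReal (min 1 (‖k‖ ^ 2) / 8)) := by
        rw [← ENNReal.ofReal_mul (by norm_num), ← ENNReal.ofReal_mul (by norm_num), gap]
        congr 1
        ring
    _ ≤ _ := by gcongr

theorem ae_mem_pathMeasure : ∀ᵐ v ∂pathMeasure, v.2 ∈ Icc (-1 : ℝ) 1 ∧ v.1.2 ∈ Icc (-1 : ℝ) 1 := by
  have h := ae_restrict_mem (μ := volume) (measurableSet_Icc (a := (-1 : ℝ)) (b := 1))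
  filter_upwards [(Measure.quasiMeasurePreserving_snd (μ := stripMeasure)).ae h,
    (Measure.quasiMeasurePreserving_snd.comp Measure.quasiMeasurePreserving_fst :
      Measure.QuasiMeasurePreserving _ pathMeasure _).ae h] with v h1 h2
  exact ⟨h1, h2⟩

/-- The mass of the two-step kernel in its source variables. -/
theorem ae_lintegral_pairKernel_le (k : Plane) : ∀ᵐ y ∂angleStripMeasure,
    ∫⁻ v, ‖pairKernel k (y, v)‖ₑ ∂pathMeasure ≤ ENNReal.ofReal (1 - gap k) := by
  have hmem := ae_restrict_mem (μ := volume) (measurableSet_Icc (a := (-1 : ℝ)) (b := 1))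
  filter_upwards [ae_angleStripMeasure_of_ae ae_lintegral_kernelFn_le,
    ae_angleStripMeasure_of_ae hmem] with y hy hy'
  refine le_ofReal_one_sub_of_add_le (b := ∫⁻ v, pairGain k (y, v) ∂pathMeasure)
    (gap_nonneg k) ?_ ?_
  · rw [← lintegral_add_left (by fun_prop)]
    calc ∫⁻ v, ‖pairKernel k (y, v)‖ₑ + pairGain k (y, v) ∂pathMeasure
        ≤ ∫⁻ v, stepConv kernelFn kernelFn y.2 v ∂pathMeasure := by
          refine lintegral_mono_ae ?_
          filter_upwards [ae_mem_pathMeasure] with v hv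
          exact enorm_pairKernel_add_pairGain_le k y v hy' hv.1 hv.2
      _ ≤ 1 * 1 := lintegral_stepConv_le (by fun_prop) (by fun_prop) hy ae_lintegral_kernelFn_le
      _ = 1 := one_mul 1
  · have h := ofReal_gap_le (le_lintegral_frequency_sub k y.1)
    simp_rw [← ENNReal.ofReal_mul (by norm_num : (0 : ℝ) ≤ 1 / 15000), one_div_mul_eq_div] at h
    rw [← lintegral_indicator_lag_mul _ (by fun_prop) (fun t => y.2.1 - t)
      (Measure.measurePreserving_sub_left volume y.2.1)] at h
    exact h

/-- The mass of the two-step kernel in its target variables. -/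
theorem ae_lintegral_pairKernel_le' (k : Plane) : ∀ᵐ y ∂angleStripMeasure,
    ∫⁻ v, ‖pairKernel k ((y.1 - deflection y.2.2 - deflection v.2, v.1), (y.2, v.2))‖ₑ
      ∂pathMeasure ≤ ENNReal.ofReal (1 - gap k) := by
  have hmem := ae_restrict_mem (μ := volume) (measurableSet_Icc (a := (-1 : ℝ)) (b := 1))
  filter_upwards [ae_angleStripMeasure_of_ae ae_lintegral_kernelFn_le,
    ae_angleStripMeasure_of_ae hmem] with y hy hy'
  refine le_ofReal_one_sub_of_add_le (b := ∫⁻ v,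
    pairGain k ((y.1 - deflection y.2.2 - deflection v.2, v.1), (y.2, v.2)) ∂pathMeasure)
    (gap_nonneg k) ?_ ?_
  · rw [← lintegral_add_left (by fun_prop)]
    calc ∫⁻ v, ‖pairKernel k ((y.1 - deflection y.2.2 - deflection v.2, v.1), (y.2, v.2))‖ₑ +
          pairGain k ((y.1 - deflection y.2.2 - deflection v.2, v.1), (y.2, v.2)) ∂pathMeasure
        ≤ ∫⁻ v, stepConv kernelFn kernelFn v.1 (y.2, v.2) ∂pathMeasure := by
          refine lintegral_mono_ae ?_
          filter_upwards [ae_mem_pathMeasure] with v hv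
          exact enorm_pairKernel_add_pairGain_le k (y.1 - deflection y.2.2 - deflection v.2, v.1)
            (y.2, v.2) hv.2 hv.1 hy'
      _ ≤ 1 * 1 := lintegral_stepConv_le' (by fun_prop) (by fun_prop) kernelFn_symm kernelFn_symm
          ae_lintegral_kernelFn_le hy
      _ = 1 := one_mul 1
  · have h := ofReal_gap_le (le_lintegral_frequency_sub' k (y.1 - deflection y.2.2))
    simp_rw [← ENNReal.ofReal_mul (by norm_num : (0 : ℝ) ≤ 1 / 15000), one_div_mul_eq_div] at h
    rw [← lintegral_indicator_lag_mul _ (by fun_prop) (fun t => t - y.2.1)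
      (measurePreserving_sub_right volume y.2.1)] at h
    refine h.trans_eq (lintegral_congr fun v => ?_)
    simp only [pairGain, sub_add_cancel]

/-- Phase cancellation makes the two-step operator a contraction of `L^p`. -/
theorem eLpNorm_pairOp_le (k : Plane) {g : Circle2Pi × ℝ × ℝ → ℝ≥0∞} (hg : Measurable g)
    {p : ℝ≥0∞} (hp : 1 ≤ p) :
    eLpNorm (pairOp k g) p angleStripMeasure ≤
      ENNReal.ofReal (1 - gap k) * eLpNorm g p angleStripMeasure :=
  eLpNorm_pathOp_le (measurable_enorm_pairKernel k) (ae_lintegral_pairKernel_le k)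
    (ae_lintegral_pairKernel_le' k) hg hp

theorem lagWeight_add_le (T a b : ℝ) :
    lagWeight T (a + b) ≤ 2 * lagWeight T a + 2 * lagWeight T b := by
  simp only [lagWeight]
  rw [← ENNReal.ofReal_ofNat, ← ENNReal.ofReal_mul zero_le_two, ← ENNReal.ofReal_mul zero_le_two,
    ← ENNReal.ofReal_add (by positivity) (by positivity)]
  refine ENNReal.ofReal_le_ofReal ?_
  rw [add_div]
  set x := a / T
  set y := b / T
  rcases min_cases 1 (x ^ 2) with ⟨e1, _⟩ | ⟨e1, _⟩ <;>
  rcases min_cases 1 (y ^ 2) with ⟨e2, _⟩ | ⟨e2, _⟩ <;>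
  rcases min_cases 1 ((x + y) ^ 2) with ⟨e3, _⟩ | ⟨e3, _⟩ <;>
  rw [e1, e2, e3] <;> nlinarith [sq_nonneg (x - y), sq_nonneg x, sq_nonneg y]

/-- The two-step operator with a weight depending on the total time of the two flights. -/
def weightedPairOp (T : ℝ) (k : Plane) :
    (Circle2Pi × ℝ × ℝ → ℝ≥0∞) → Circle2Pi × ℝ × ℝ → ℝ≥0∞ :=
  pathOp fun q => lagWeight T (q.1.2.1 - q.2.1.1) * ‖pairKernel k q‖ₑ

/-- A long pair of flights contains a long flight. -/
theorem lagWeight_mul_stepConv_le (T : ℝ) (z : ℝ × ℝ) (v : (ℝ × ℝ) × ℝ) :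
    lagWeight T (z.1 - v.1.1) * stepConv kernelFn kernelFn z v ≤
      2 * stepConv (weightedKernel T) kernelFn z v +
        2 * stepConv kernelFn (weightedKernel T) z v := by
  unfold stepConv
  rw [← lintegral_const_mul _ (by fun_prop), ← lintegral_const_mul _ (by fun_prop),
    ← lintegral_const_mul _ (by fun_prop), ← lintegral_add_left (by fun_prop)]
  refine lintegral_mono fun t' => ?_
  simp only [weightedKernel]
  have h := lagWeight_add_le T (z.1 - t') (t' - v.1.1)
  rw [sub_add_sub_cancel] at h
  calc _ ≤ (2 * lagWeight T (z.1 - t') + 2 * lagWeight T (t' - v.1.1)) *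
        (kernelFn (z.1 - t', z.2, v.2) * kernelFn (t' - v.1.1, v.2, v.1.2)) := by gcongr
    _ = _ := by ring

/-- Pairs of flights of total time comparable to `T` or more have mass `O(1 / T)`. -/
theorem eLpNorm_weightedPairOp_le {T : ℝ} (hT : 0 < T) (k : Plane)
    {g : Circle2Pi × ℝ × ℝ → ℝ≥0∞} (hg : Measurable g) {p : ℝ≥0∞} (hp : 1 ≤ p) :
    eLpNorm (weightedPairOp T k g) p angleStripMeasure ≤
      ENNReal.ofReal (64 / T) * eLpNorm g p angleStripMeasure := by
  have hsum : 2 * (ENNReal.ofReal (16 / T) * 1) + 2 * (1 * ENNReal.ofReal (16 / T)) =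
      ENNReal.ofReal (64 / T) := by
    rw [one_mul, mul_one, ← two_mul, ← mul_assoc, ← ENNReal.ofReal_ofNat,
      ← ENNReal.ofReal_mul zero_le_two, ← ENNReal.ofReal_mul (by norm_num)]
    congr 1
    ring
  have hmem := ae_restrict_mem (μ := volume) (measurableSet_Icc (a := (-1 : ℝ)) (b := 1))
  refine eLpNorm_pathOp_le (by fun_prop) ?_ ?_ hg hp
  · filter_upwards [ae_angleStripMeasure_of_ae ae_lintegral_kernelFn_le,
      ae_angleStripMeasure_of_ae (ae_lintegral_weightedKernel_le hT)] with y hy hy'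
    calc ∫⁻ v, lagWeight T (y.2.1 - v.1.1) * ‖pairKernel k (y, v)‖ₑ ∂pathMeasure
        ≤ ∫⁻ v, 2 * stepConv (weightedKernel T) kernelFn y.2 v +
          2 * stepConv kernelFn (weightedKernel T) y.2 v ∂pathMeasure :=
          lintegral_mono fun v => (mul_le_mul_right (enorm_pairKernel_le k y v) _).trans
            (lagWeight_mul_stepConv_le T y.2 v)
      _ ≤ 2 * (ENNReal.ofReal (16 / T) * 1) + 2 * (1 * ENNReal.ofReal (16 / T)) := by
          rw [lintegral_add_left (by fun_prop), lintegral_const_mul _ (by fun_prop),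
            lintegral_const_mul _ (by fun_prop)]
          gcongr
          · exact lintegral_stepConv_le (by fun_prop) (by fun_prop) hy' ae_lintegral_kernelFn_le
          · exact lintegral_stepConv_le (by fun_prop) (by fun_prop) hy
              (ae_lintegral_weightedKernel_le hT)
      _ = _ := hsum
  · filter_upwards [ae_angleStripMeasure_of_ae ae_lintegral_kernelFn_le,
      ae_angleStripMeasure_of_ae (ae_lintegral_weightedKernel_le hT)] with y hy hy'
    calc ∫⁻ v, lagWeight T (v.1.1 - y.2.1) * ‖pairKernel k
          ((y.1 - deflection y.2.2 - deflection v.2, v.1), (y.2, v.2))‖ₑ ∂pathMeasure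
        ≤ ∫⁻ v, 2 * stepConv (weightedKernel T) kernelFn v.1 (y.2, v.2) +
          2 * stepConv kernelFn (weightedKernel T) v.1 (y.2, v.2) ∂pathMeasure :=
          lintegral_mono fun v => (mul_le_mul_right (enorm_pairKernel_le k
            (y.1 - deflection y.2.2 - deflection v.2, v.1) (y.2, v.2)) _).trans
            (lagWeight_mul_stepConv_le T v.1 (y.2, v.2))
      _ ≤ 2 * (ENNReal.ofReal (16 / T) * 1) + 2 * (1 * ENNReal.ofReal (16 / T)) := by
          rw [lintegral_add_left (by fun_prop), lintegral_const_mul _ (by fun_prop),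
            lintegral_const_mul _ (by fun_prop)]
          gcongr
          · exact lintegral_stepConv_le' (by fun_prop) (by fun_prop) (weightedKernel_symm T)
              kernelFn_symm (ae_lintegral_weightedKernel_le hT) hy
          · exact lintegral_stepConv_le' (by fun_prop) (by fun_prop) kernelFn_symm
              (weightedKernel_symm T) ae_lintegral_kernelFn_le hy'
      _ = _ := hsum

/-! ### Renewal inequalities -/

theorem eLpNorm_le_of_ae_le_add {Z : Type*} [MeasurableSpace Z] {m : Measure Z} {p : ℝ≥0∞}
    (hp : 1 ≤ p) {f g₁ g₂ : Z → ℝ≥0∞} (h₁ : Measurable g₁) (h₂ : Measurable g₂) {c₁ c₂ : ℝ≥0∞}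
    (h : ∀ᵐ z ∂m, f z ≤ c₁ * g₁ z + c₂ * g₂ z) :
    eLpNorm f p m ≤ c₁ * eLpNorm g₁ p m + c₂ * eLpNorm g₂ p m := by
  calc eLpNorm f p m ≤ eLpNorm ((fun z => c₁ * g₁ z) + fun z => c₂ * g₂ z) p m :=
        eLpNorm_mono_enorm_ae h
    _ ≤ eLpNorm (fun z => c₁ * g₁ z) p m + eLpNorm (fun z => c₂ * g₂ z) p m :=
        eLpNorm_add_le (h₁.const_mul c₁).aestronglyMeasurable
          (h₂.const_mul c₂).aestronglyMeasurable hp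
    _ ≤ _ := add_le_add
        (eLpNorm_le_mul_eLpNorm_of_ae_le_mul'' p (by fun_prop) (ae_of_all _ fun _ => le_rfl))
        (eLpNorm_le_mul_eLpNorm_of_ae_le_mul'' p (by fun_prop) (ae_of_all _ fun _ => le_rfl))

theorem eLpNorm_iSup_le {Z : Type*} [MeasurableSpace Z] {m : Measure Z} {p : ℝ≥0∞} (hp : 1 ≤ p)
    {u : ℕ → Z → ℝ≥0∞} (hu : ∀ n, Measurable (u n)) (hmono : Monotone u) {c : ℝ≥0∞}
    (h : ∀ n, eLpNorm (u n) p m ≤ c) : eLpNorm (fun z => ⨆ n, u n z) p m ≤ c := by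
  rcases eq_or_ne p ∞ with rfl | hp'
  · simp only [eLpNorm_exponent_top] at h ⊢
    refine eLpNormEssSup_le_of_ae_enorm_bound ?_
    have h' : ∀ᵐ z ∂m, ∀ n, u n z ≤ c := ae_all_iff.mpr fun n => by
      filter_upwards [ae_le_eLpNormEssSup (f := u n) (μ := m)] with z hz
      exact hz.trans (h n)
    filter_upwards [h'] with z hz
    exact iSup_le hz
  · have hp0 : p ≠ 0 := (zero_lt_one.trans_le hp).ne'
    have hpp : 0 < p.toReal := ENNReal.toReal_pos hp0 hp'
    simp only [eLpNorm_eq_lintegral_rpow_enorm_toReal hp0 hp', enorm_eq_self] at h ⊢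
    have e : ∀ z, (⨆ n, u n z) ^ p.toReal = ⨆ n, u n z ^ p.toReal := fun z =>
      (ENNReal.orderIsoRpow p.toReal hpp).map_iSup _
    simp only [e]
    rw [lintegral_iSup (fun n => by fun_prop)
      (fun i j hij z => ENNReal.rpow_le_rpow (hmono hij z) hpp.le)]
    rw [one_div, ENNReal.rpow_inv_le_iff hpp]
    refine iSup_le fun n => ?_
    have := h n
    rwa [one_div, ENNReal.rpow_inv_le_iff hpp] at this

theorem pathOp_mono {M : (Circle2Pi × ℝ × ℝ) × (ℝ × ℝ) × ℝ → ℝ≥0∞}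
    {f g : Circle2Pi × ℝ × ℝ → ℝ≥0∞} (h : ∀ y, f y ≤ g y) (y : Circle2Pi × ℝ × ℝ) :
    pathOp M f y ≤ pathOp M g y :=
  lintegral_mono fun _ => mul_le_mul_right (h _) _

theorem pathOp_add {M : (Circle2Pi × ℝ × ℝ) × (ℝ × ℝ) × ℝ → ℝ≥0∞} (hM : Measurable M)
    {f : Circle2Pi × ℝ × ℝ → ℝ≥0∞} (hf : Measurable f) (g : Circle2Pi × ℝ × ℝ → ℝ≥0∞)
    (y : Circle2Pi × ℝ × ℝ) :
    pathOp M (fun z => f z + g z) y = pathOp M f y + pathOp M g y := by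
  simp only [pathOp, mul_add]
  exact lintegral_add_left (by fun_prop) _

theorem collisionOp_mono {N : ℝ × ℝ × ℝ → ℝ≥0∞} {f g : Circle2Pi × ℝ × ℝ → ℝ≥0∞}
    (h : ∀ y, f y ≤ g y) (y : Circle2Pi × ℝ × ℝ) : collisionOp N f y ≤ collisionOp N g y :=
  lintegral_mono fun _ => mul_le_mul_right (h _) _

theorem lintegral_pairOp_le (k : Plane) {g : Circle2Pi × ℝ × ℝ → ℝ≥0∞} (hg : Measurable g) :
    ∫⁻ y, pairOp k g y ∂angleStripMeasure ≤
      ENNReal.ofReal (1 - gap k) * ∫⁻ y, g y ∂angleStripMeasure := by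
  have := eLpNorm_pairOp_le k hg le_rfl
  simpa only [eLpNorm_one_eq_lintegral_enorm, enorm_eq_self] using this

@[fun_prop]
theorem measurable_pairOp (k : Plane) {g : Circle2Pi × ℝ × ℝ → ℝ≥0∞} (hg : Measurable g) :
    Measurable (pairOp k g) :=
  measurable_pathOp (by fun_prop) hg

theorem pairOp_ae_mono (k : Plane) {f g : Circle2Pi × ℝ × ℝ → ℝ≥0∞} (hf : Measurable f)
    (hg : Measurable g) (h : ∀ᵐ y ∂angleStripMeasure, f y ≤ g y) :
    ∀ᵐ y ∂angleStripMeasure, pairOp k f y ≤ pairOp k g y := by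
  have hd : ∫⁻ y, pairOp k (fun z => f z - g z) y ∂angleStripMeasure = 0 := by
    refine le_antisymm ((lintegral_pairOp_le k (by fun_prop)).trans_eq ?_) zero_le
    rw [lintegral_congr_ae (g := 0), Pi.zero_def, lintegral_zero, mul_zero]
    filter_upwards [h] with y hy using tsub_eq_zero_of_le hy
  rw [lintegral_eq_zero_iff (measurable_pairOp k (by fun_prop))] at hd
  filter_upwards [hd] with y hy
  calc pairOp k f y ≤ pairOp k (fun z => g z + (f z - g z)) y :=
        pathOp_mono (fun z => le_add_tsub) y
    _ = pairOp k g y := by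
        rw [pairOp, pathOp_add (by fun_prop) hg]
        change _ + pairOp k _ y = _
        rw [hy, Pi.zero_apply, add_zero]

/-- The two-step kernel vanishes unless the second collision comes after the first. -/
theorem pairKernel_eq_zero {k : Plane} {y : Circle2Pi × ℝ × ℝ} {v : (ℝ × ℝ) × ℝ}
    (h : y.2.1 < v.1.1) : pairKernel k (y, v) = 0 := by
  rw [pairKernel]
  refine integral_eq_zero_of_ae (ae_of_all _ fun t' => ?_)
  rcases lt_or_ge t' v.1.1 with h1 | h1
  · simp [Q_of_neg (sub_neg.mpr h1)]
  · simp [Q_of_neg (sub_neg.mpr (h.trans_le h1))]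

/-- The indicator function of the times before `T`. -/
def before (T : ℝ) (y : Circle2Pi × ℝ × ℝ) : ℝ≥0∞ := (Iic T).indicator 1 y.2.1

@[fun_prop]
theorem measurable_before (T : ℝ) : Measurable (before T) :=
  (measurable_one.indicator measurableSet_Iic).comp (by fun_prop)

theorem before_of_le {T : ℝ} {y : Circle2Pi × ℝ × ℝ} (h : y.2.1 ≤ T) : before T y = 1 :=
  indicator_of_mem (s := Iic T) h 1

theorem before_of_lt {T : ℝ} {y : Circle2Pi × ℝ × ℝ} (h : T < y.2.1) : before T y = 0 :=
  indicator_of_notMem (s := Iic T) (not_le.mpr h) 1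

theorem before_le_one (T : ℝ) (y : Circle2Pi × ℝ × ℝ) : before T y ≤ 1 := by
  rcases le_or_gt y.2.1 T with h | h
  · rw [before_of_le h]
  · rw [before_of_lt h]; exact zero_le_one

theorem before_mul_pairOp_le (T : ℝ) (k : Plane) (g : Circle2Pi × ℝ × ℝ → ℝ≥0∞)
    (y : Circle2Pi × ℝ × ℝ) :
    before T y * pairOp k g y ≤ pairOp k (fun z => before T z * g z) y := by
  rcases le_or_gt y.2.1 T with h | h
  · rw [before_of_le h, one_mul]
    refine lintegral_mono fun v => ?_
    rcases le_or_gt v.1.1 y.2.1 with h1 | h1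
    · simp only
      rw [before_of_le (h1.trans h), one_mul]
    · simp [pairKernel_eq_zero h1]
  · rw [before_of_lt h, zero_mul]; exact zero_le

theorem before_mul_collisionOp_le (T : ℝ) (g : Circle2Pi × ℝ × ℝ → ℝ≥0∞)
    (y : Circle2Pi × ℝ × ℝ) :
    before T y * collisionOp kernelFn g y ≤ collisionOp kernelFn (fun z => before T z * g z) y := by
  rcases le_or_gt y.2.1 T with h | h
  · rw [before_of_le h, one_mul]
    refine lintegral_mono fun w => ?_
    rcases le_or_gt w.1 y.2.1 with h1 | h1
    · simp only
      rw [before_of_le (h1.trans h), one_mul]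
    · simp [kernelFn, Qe, Q_of_neg (sub_neg.mpr h1)]
  · rw [before_of_lt h, zero_mul]; exact zero_le

theorem lintegral_collisionOp_kernelFn_le {g : Circle2Pi × ℝ × ℝ → ℝ≥0∞} (hg : Measurable g) :
    ∫⁻ y, collisionOp kernelFn g y ∂angleStripMeasure ≤ ∫⁻ y, g y ∂angleStripMeasure := by
  have := lintegral_collisionOp_le (by fun_prop) kernelFn_symm ae_lintegral_kernelFn_le hg
  rwa [one_mul] at this

/-- The Picard iterates for the inequality `a ≤ G + P a`, where `P` is the two-step operator. -/
def picard (k : Plane) (G : Circle2Pi × ℝ × ℝ → ℝ≥0∞) : ℕ → Circle2Pi × ℝ × ℝ → ℝ≥0∞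
  | 0 => 0
  | n + 1 => fun y => G y + pairOp k (picard k G n) y

@[fun_prop]
theorem measurable_picard (k : Plane) {G : Circle2Pi × ℝ × ℝ → ℝ≥0∞} (hG : Measurable G) (n : ℕ) :
    Measurable (picard k G n) := by
  induction n with
  | zero => exact measurable_zero
  | succ n ih => exact hG.add (measurable_pairOp k ih)

theorem monotone_picard (k : Plane) (G : Circle2Pi × ℝ × ℝ → ℝ≥0∞) : Monotone (picard k G) := by
  refine monotone_nat_of_le_succ fun n => ?_
  induction n with
  | zero => exact fun y => zero_le
  | succ n ih => exact fun y => add_le_add_right (pathOp_mono ih y) _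

theorem measurable_iterate_pairOp (k : Plane) {a : Circle2Pi × ℝ × ℝ → ℝ≥0∞} (ha : Measurable a)
    (n : ℕ) : Measurable ((pairOp k)^[n] a) := by
  induction n with
  | zero => exact ha
  | succ n ih => rw [Function.iterate_succ_apply']; exact measurable_pairOp k ih

/-- A solution of the renewal inequality `a ≤ G + P a` that is integrable over bounded times is
bounded by the limit of the Picard iterates. -/
theorem ae_le_iSup_picard {k : Plane} (hk : k ≠ 0) {G a : Circle2Pi × ℝ × ℝ → ℝ≥0∞}
    (hG : Measurable G) (ha : Measurable a)
    (hloc : ∀ T, ∫⁻ y, before T y * a y ∂angleStripMeasure ≠ ∞)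
    (h : ∀ᵐ y ∂angleStripMeasure, a y ≤ G y + pairOp k a y) :
    ∀ᵐ y ∂angleStripMeasure, a y ≤ ⨆ n, picard k G n y := by
  have hP := measurable_iterate_pairOp k ha
  have hiter : ∀ n, ∀ᵐ y ∂angleStripMeasure, a y ≤ picard k G n y + (pairOp k)^[n] a y := by
    intro n
    induction n with
    | zero => exact ae_of_all _ fun y => by simp [picard]
    | succ n ih =>
      have hm := hP n
      filter_upwards [h, pairOp_ae_mono k ha ((measurable_picard k hG n).add hm) ih] with y h1 h2
      refine h1.trans ((add_le_add_right h2 _).trans_eq ?_)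
      rw [Function.iterate_succ_apply', picard, add_assoc]
      congr 1
      exact pathOp_add (by fun_prop) (by fun_prop) _ y
  have hsmall : ∀ T n, ∫⁻ y, before T y * (pairOp k)^[n] a y ∂angleStripMeasure ≤
      ENNReal.ofReal (1 - gap k) ^ n * ∫⁻ y, before T y * a y ∂angleStripMeasure := by
    intro T n
    induction n with
    | zero => simp
    | succ n ih =>
      have hm := hP n
      simp only [Function.iterate_succ_apply']
      calc ∫⁻ y, before T y * pairOp k ((pairOp k)^[n] a) y ∂angleStripMeasure
          ≤ ∫⁻ y, pairOp k (fun z => before T z * (pairOp k)^[n] a z) y ∂angleStripMeasure :=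
            lintegral_mono fun y => before_mul_pairOp_le T k _ y
        _ ≤ ENNReal.ofReal (1 - gap k) *
            ∫⁻ y, before T y * (pairOp k)^[n] a y ∂angleStripMeasure :=
            lintegral_pairOp_le k (by fun_prop)
        _ ≤ _ := by
            rw [pow_succ', mul_assoc]
            gcongr
  have hlt : ENNReal.ofReal (1 - gap k) < 1 := by
    rw [ENNReal.ofReal_lt_one]
    linarith [gap_pos hk]
  have hsup : Measurable fun y => ⨆ n, picard k G n y :=
    Measurable.iSup fun n => measurable_picard k hG n
  have hT : ∀ T : ℕ, ∀ᵐ y ∂angleStripMeasure,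
      before T y * (a y - ⨆ n, picard k G n y) = 0 := by
    intro T
    have hz : ∫⁻ y, before T y * (a y - ⨆ n, picard k G n y) ∂angleStripMeasure = 0 := by
      refine le_antisymm (ge_of_tendsto' (x := Filter.atTop) (f := fun n : ℕ =>
        ENNReal.ofReal (1 - gap k) ^ n * ∫⁻ y, before T y * a y ∂angleStripMeasure) ?_
        fun n => ?_) zero_le
      · rw [← zero_mul (∫⁻ y, before T y * a y ∂angleStripMeasure)]
        exact ENNReal.Tendsto.mul_const (ENNReal.tendsto_pow_atTop_nhds_zero_of_lt_one hlt)
          (Or.inr (hloc T))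
      · refine le_trans (lintegral_mono_ae ?_) (hsmall T n)
        filter_upwards [hiter n] with y hy
        gcongr
        rw [tsub_le_iff_left]
        exact hy.trans (add_le_add_left (le_iSup (fun n => picard k G n y) n) _)
    rw [lintegral_eq_zero_iff (by fun_prop)] at hz
    exact hz
  filter_upwards [ae_all_iff.mpr hT] with y hy
  obtain ⟨T, hyT⟩ := exists_nat_ge y.2.1
  have := hy T
  rw [before_of_le hyT, one_mul] at this
  exact tsub_eq_zero_iff_le.mp this

/-! ### Decay in time of solutions of renewal inequalities -/

/-- The weight `min (1, ((t - T / 4)₊ / (3 T / 4))²)` on times: it vanishes up to time `T / 4` and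
is `1` from time `T` on. -/
def timeWeight (T : ℝ) (y : Circle2Pi × ℝ × ℝ) : ℝ≥0∞ :=
  lagWeight (3 * T / 4) (max 0 (y.2.1 - T / 4))

@[fun_prop]
theorem measurable_timeWeight (T : ℝ) : Measurable (timeWeight T) := by
  unfold timeWeight; fun_prop

theorem lagWeight_le_one (T τ : ℝ) : lagWeight T τ ≤ 1 :=
  ENNReal.ofReal_le_one.mpr (min_le_left _ _)

theorem timeWeight_of_le {T : ℝ} (hT : 0 < T) {y : Circle2Pi × ℝ × ℝ} (h : T ≤ y.2.1) :
    timeWeight T y = 1 := by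
  rw [timeWeight, lagWeight, min_eq_left, ENNReal.ofReal_one]
  have h1 : 1 ≤ max 0 (y.2.1 - T / 4) / (3 * T / 4) := by
    rw [le_div_iff₀ (by positivity)]
    exact le_max_of_le_right (by linarith)
  nlinarith

theorem timeWeight_of_lt {T : ℝ} {y : Circle2Pi × ℝ × ℝ} (h : y.2.1 < T / 4) :
    timeWeight T y = 0 := by
  rw [timeWeight, max_eq_left (by linarith), lagWeight]
  simp

/-- The weights are quasi-subadditive: `(x + τ)² ≤ (1 + ε) x² + (1 + 1 / ε) τ²`. -/
theorem lagWeight_le_add {S x x' τ ε : ℝ} (hS : 0 < S) (hx : 0 ≤ x) (hx' : 0 ≤ x') (hτ : 0 ≤ τ)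
    (h : x ≤ x' + τ) (hε : 0 < ε) :
    lagWeight S x ≤ ENNReal.ofReal (1 + ε) * lagWeight S x' +
      ENNReal.ofReal (1 + 1 / ε) * lagWeight S τ := by
  simp only [lagWeight]
  rw [← ENNReal.ofReal_mul (by positivity), ← ENNReal.ofReal_mul (by positivity),
    ← ENNReal.ofReal_add (by positivity) (by positivity)]
  refine ENNReal.ofReal_le_ofReal ?_
  have h1 : x / S ≤ x' / S + τ / S := by rw [← add_div]; gcongr
  have p0 : 0 ≤ x / S := by positivity
  have p1 : 0 ≤ x' / S := by positivity
  have p2 : 0 ≤ τ / S := by positivity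
  set u := x / S
  set u' := x' / S
  set r := τ / S
  have hε' : 0 < 1 / ε := by positivity
  have hm1 : 0 ≤ min 1 (u' ^ 2) := by positivity
  have hm2 : 0 ≤ min 1 (r ^ 2) := by positivity
  rcases le_or_gt 1 (u' ^ 2) with h2 | h2
  · have := min_le_left 1 (u ^ 2)
    rw [min_eq_left h2]
    nlinarith [mul_nonneg hε'.le hm2]
  rcases le_or_gt 1 (r ^ 2) with h3 | h3
  · have := min_le_left 1 (u ^ 2)
    rw [min_eq_left h3]
    nlinarith [mul_nonneg hε.le hm1]
  · rw [min_eq_right h2.le, min_eq_right h3.le]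
    refine (min_le_right _ _).trans ?_
    have h4 : u ^ 2 ≤ (u' + r) ^ 2 := by gcongr
    have h5 : 2 * u' * r ≤ ε * u' ^ 2 + 1 / ε * r ^ 2 := by
      have h6 : 0 ≤ (ε * u' - r) ^ 2 / ε := by positivity
      have h7 : (ε * u' - r) ^ 2 / ε = ε * u' ^ 2 + 1 / ε * r ^ 2 - 2 * u' * r := by
        field_simp; ring
      linarith
    nlinarith

theorem timeWeight_le_add {T ε : ℝ} (hT : 0 < T) (hε : 0 < ε) {y z : Circle2Pi × ℝ × ℝ}
    (h : z.2.1 ≤ y.2.1) :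
    timeWeight T y ≤ ENNReal.ofReal (1 + ε) * timeWeight T z +
      ENNReal.ofReal (1 + 1 / ε) * lagWeight (3 * T / 4) (y.2.1 - z.2.1) := by
  refine lagWeight_le_add (by positivity) (le_max_left _ _) (le_max_left _ _) (by linarith) ?_ hε
  refine max_le (add_nonneg (le_max_left _ _) (by linarith)) ?_
  linarith [le_max_right 0 (z.2.1 - T / 4)]

theorem timeWeight_mul_pairOp_le {T ε : ℝ} (hT : 0 < T) (hε : 0 < ε) (k : Plane)
    {g : Circle2Pi × ℝ × ℝ → ℝ≥0∞} (hg : Measurable g) (y : Circle2Pi × ℝ × ℝ) :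
    timeWeight T y * pairOp k g y ≤
      ENNReal.ofReal (1 + ε) * pairOp k (fun z => timeWeight T z * g z) y +
        ENNReal.ofReal (1 + 1 / ε) * weightedPairOp (3 * T / 4) k g y := by
  simp only [pairOp, weightedPairOp, pathOp]
  rw [← lintegral_const_mul _ (by fun_prop), ← lintegral_const_mul _ (by fun_prop),
    ← lintegral_const_mul _ (by fun_prop), ← lintegral_add_left (by fun_prop)]
  refine lintegral_mono fun v => ?_
  rcases le_or_gt v.1.1 y.2.1 with h1 | h1
  · have := timeWeight_le_add hT hε
      (z := (y.1 + deflection v.2 + deflection v.1.2, v.1)) h1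
    refine (mul_le_mul_left this _).trans_eq ?_
    ring
  · simp [pairKernel_eq_zero h1]

theorem timeWeight_mul_collisionOp_le {T : ℝ} (hT : 0 < T) {g : Circle2Pi × ℝ × ℝ → ℝ≥0∞}
    (hg : Measurable g) (y : Circle2Pi × ℝ × ℝ) :
    timeWeight T y * collisionOp kernelFn g y ≤
      2 * collisionOp kernelFn (fun z => timeWeight T z * g z) y +
        2 * collisionOp (weightedKernel (3 * T / 4)) g y := by
  simp only [collisionOp, weightedKernel]
  rw [← lintegral_const_mul _ (by fun_prop), ← lintegral_const_mul _ (by fun_prop),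
    ← lintegral_const_mul _ (by fun_prop), ← lintegral_add_left (by fun_prop)]
  refine lintegral_mono fun w => ?_
  rcases le_or_gt w.1 y.2.1 with h1 | h1
  · have := timeWeight_le_add hT one_pos (z := (y.1 + deflection w.2, w)) h1
    norm_num at this
    refine (mul_le_mul_left this _).trans_eq ?_
    ring
  · simp [kernelFn, Qe, Q_of_neg (sub_neg.mpr h1)]

theorem eLpNorm_collisionOp_kernelFn_le {g : Circle2Pi × ℝ × ℝ → ℝ≥0∞} (hg : Measurable g)
    {p : ℝ≥0∞} (hp : 1 ≤ p) :
    eLpNorm (collisionOp kernelFn g) p angleStripMeasure ≤ eLpNorm g p angleStripMeasure := by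
  have := eLpNorm_collisionOp_le (by fun_prop) kernelFn_symm ae_lintegral_kernelFn_le hg hp
  rwa [one_mul] at this

theorem eLpNorm_timeWeight_mul_collisionOp_le {T : ℝ} (hT : 0 < T)
    {g : Circle2Pi × ℝ × ℝ → ℝ≥0∞} (hg : Measurable g) {p : ℝ≥0∞} (hp : 1 ≤ p) :
    eLpNorm (fun y => timeWeight T y * collisionOp kernelFn g y) p angleStripMeasure ≤
      2 * eLpNorm (fun y => timeWeight T y * g y) p angleStripMeasure +
        ENNReal.ofReal (44 / T) * eLpNorm g p angleStripMeasure := by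
  refine (eLpNorm_le_of_ae_le_add hp (by fun_prop) (by fun_prop)
    (ae_of_all _ (timeWeight_mul_collisionOp_le hT hg))).trans ?_
  have h1 := eLpNorm_collisionOp_kernelFn_le (g := fun y => timeWeight T y * g y) (by fun_prop) hp
  have hS : 0 < 3 * T / 4 := by positivity
  have h2 := eLpNorm_collisionOp_le (measurable_weightedKernel (3 * T / 4))
    (weightedKernel_symm _) (ae_lintegral_weightedKernel_le hS) hg hp
  calc _ ≤ 2 * eLpNorm (fun y => timeWeight T y * g y) p angleStripMeasure +
        2 * (ENNReal.ofReal (16 / (3 * T / 4)) * eLpNorm g p angleStripMeasure) := by gcongr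
    _ ≤ _ := by
        rw [← mul_assoc, ← ENNReal.ofReal_ofNat, ← ENNReal.ofReal_mul zero_le_two]
        gcongr
        rw [mul_div_assoc', div_le_div_iff₀ hS hT]
        nlinarith

/-- The Picard iterates are bounded by the geometric series of ratio `1 - gap k`. -/
theorem eLpNorm_picard_le {k : Plane} (hk : k ≠ 0) {G : Circle2Pi × ℝ × ℝ → ℝ≥0∞}
    (hG : Measurable G) {p : ℝ≥0∞} (hp : 1 ≤ p) (n : ℕ) :
    eLpNorm (picard k G n) p angleStripMeasure ≤
      ENNReal.ofReal (1 / gap k) * eLpNorm G p angleStripMeasure := by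
  have hδ := gap_pos hk
  have hδ1 := gap_le_one k
  induction n with
  | zero => simp [picard]
  | succ n ih =>
    have hn := measurable_picard k hG n
    calc eLpNorm (picard k G (n + 1)) p angleStripMeasure
        ≤ 1 * eLpNorm G p angleStripMeasure +
          1 * eLpNorm (pairOp k (picard k G n)) p angleStripMeasure :=
          eLpNorm_le_of_ae_le_add hp hG (by fun_prop) (ae_of_all _ fun y => by simp [picard])
      _ ≤ 1 * eLpNorm G p angleStripMeasure + 1 * (ENNReal.ofReal (1 - gap k) *
          (ENNReal.ofReal (1 / gap k) * eLpNorm G p angleStripMeasure)) := by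
          gcongr
          refine (eLpNorm_pairOp_le k hn hp).trans ?_
          gcongr
      _ = ENNReal.ofReal (1 / gap k) * eLpNorm G p angleStripMeasure := by
          rw [one_mul (ENNReal.ofReal (1 - gap k) * _), ← mul_assoc, ← add_mul,
            ← ENNReal.ofReal_mul (by linarith), ← ENNReal.ofReal_one,
            ← ENNReal.ofReal_add zero_le_one (mul_nonneg (by linarith) (by positivity))]
          congr 2
          field_simp
          ring

/-- The weighted norms of the Picard iterates. The parameter `ε = δ / 2` in the subadditivity of the
weight keeps `(1 + ε) * (1 - δ) ≤ 1 - δ / 2`, and costs a factor `1 / ε` on long flights. -/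
theorem eLpNorm_timeWeight_mul_picard_le {k : Plane} (hk : k ≠ 0) {T : ℝ} (hT : 0 < T)
    {G : Circle2Pi × ℝ × ℝ → ℝ≥0∞} (hG : Measurable G) {p : ℝ≥0∞} (hp : 1 ≤ p) (n : ℕ) :
    eLpNorm (fun y => timeWeight T y * picard k G n y) p angleStripMeasure ≤
      ENNReal.ofReal (2 / gap k) *
        (eLpNorm (fun y => timeWeight T y * G y) p angleStripMeasure +
          ENNReal.ofReal (258 / (gap k ^ 2 * T)) * eLpNorm G p angleStripMeasure) := by
  have hδ := gap_pos hk
  have hδ1 := gap_le_one k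
  set δ := gap k with hδdef
  set X := eLpNorm (fun y => timeWeight T y * G y) p angleStripMeasure with hX
  set Y := eLpNorm G p angleStripMeasure with hY
  induction n with
  | zero => simp [picard]
  | succ n ih =>
    have hn := measurable_picard k hG n
    have hS : 0 < 3 * T / 4 := by positivity
    have h1 : eLpNorm (fun y => timeWeight T y * pairOp k (picard k G n) y) p angleStripMeasure ≤
        ENNReal.ofReal (1 - δ / 2) * (ENNReal.ofReal (2 / δ) *
          (X + ENNReal.ofReal (258 / (δ ^ 2 * T)) * Y)) +
          ENNReal.ofReal (258 / (δ ^ 2 * T)) * Y := by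
      refine (eLpNorm_le_of_ae_le_add hp (by fun_prop)
        (measurable_pathOp (by fun_prop) (by fun_prop))
        (ae_of_all _ (timeWeight_mul_pairOp_le hT (half_pos hδ) k hn))).trans (add_le_add ?_ ?_)
      · refine (mul_le_mul_right (eLpNorm_pairOp_le k (by fun_prop) hp) _).trans ?_
        rw [← mul_assoc, ← ENNReal.ofReal_mul (by linarith)]
        refine mul_le_mul' (ENNReal.ofReal_le_ofReal ?_) ih
        rw [← hδdef]
        nlinarith
      · refine (mul_le_mul_right ((eLpNorm_weightedPairOp_le hS k hn hp).trans
          (mul_le_mul_right (eLpNorm_picard_le hk hG hp n) _)) _).trans ?_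
        rw [← hδdef, ← mul_assoc, ← mul_assoc, ← ENNReal.ofReal_mul (by positivity),
          ← ENNReal.ofReal_mul (by positivity)]
        gcongr
        -- `1 + 2 / δ ≤ 3 / δ` and `3 * 64 * 4 / 3 = 256`
        rw [show (1 + 1 / (δ / 2)) * (64 / (3 * T / 4)) * (1 / δ) =
          (δ + 2) * (256 / 3) / (δ ^ 2 * T) by field_simp; ring]
        gcongr
        linarith
    calc eLpNorm (fun y => timeWeight T y * picard k G (n + 1) y) p angleStripMeasure
        ≤ 1 * X + 1 * eLpNorm (fun y => timeWeight T y * pairOp k (picard k G n) y) p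
            angleStripMeasure :=
          eLpNorm_le_of_ae_le_add hp (by fun_prop) (by fun_prop)
            (ae_of_all _ fun y => by simp [picard, mul_add])
      _ ≤ X + (ENNReal.ofReal (1 - δ / 2) * (ENNReal.ofReal (2 / δ) *
          (X + ENNReal.ofReal (258 / (δ ^ 2 * T)) * Y)) +
          ENNReal.ofReal (258 / (δ ^ 2 * T)) * Y) := by
          rw [one_mul, one_mul]
          gcongr
      _ = (ENNReal.ofReal (1 - δ / 2) * ENNReal.ofReal (2 / δ) + 1) *
          (X + ENNReal.ofReal (258 / (δ ^ 2 * T)) * Y) := by ring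
      _ = _ := by
          congr 1
          rw [← ENNReal.ofReal_mul (by linarith), ← ENNReal.ofReal_one,
            ← ENNReal.ofReal_add (mul_nonneg (by linarith) (by positivity)) zero_le_one]
          congr 1
          field_simp
          ring

theorem collisionMeasure_eq_restrict (a : ℝ) :
    collisionMeasure a = angleStripMeasure.restrict {y | a ≤ y.2.1} := by
  have h1 : (volume.restrict (Ici a)).prod (volume.restrict (Icc (-1 : ℝ) 1)) =
      stripMeasure.restrict (Ici a ×ˢ univ) := by
    rw [stripMeasure, ← Measure.prod_restrict, Measure.restrict_univ]
  have h2 : {y : Circle2Pi × ℝ × ℝ | a ≤ y.2.1} = univ ×ˢ (Ici a ×ˢ univ) := by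
    ext y; simp
  rw [collisionMeasure, h1, h2, angleStripMeasure, ← Measure.prod_restrict, Measure.restrict_univ]

theorem measurableSet_le_time (a : ℝ) : MeasurableSet {y : Circle2Pi × ℝ × ℝ | a ≤ y.2.1} :=
  measurableSet_le (by fun_prop) (by fun_prop)

/-- The time weight is supported on the times after `T / 4`. -/
theorem eLpNorm_timeWeight_mul_le {T : ℝ} {p : ℝ≥0∞} (f : Circle2Pi × ℝ × ℝ → ℝ≥0∞) :
    eLpNorm (fun y => timeWeight T y * f y) p angleStripMeasure ≤
      eLpNorm f p (collisionMeasure (T / 4)) := by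
  rw [collisionMeasure_eq_restrict, ← eLpNorm_indicator_eq_eLpNorm_restrict
    (measurableSet_le_time _)]
  refine eLpNorm_mono_enorm fun y => ?_
  simp only [enorm_eq_self]
  by_cases h : T / 4 ≤ y.2.1
  · rw [indicator_of_mem (s := {y : Circle2Pi × ℝ × ℝ | T / 4 ≤ y.2.1}) h]
    exact mul_le_of_le_one_left' (lagWeight_le_one _ _)
  · rw [timeWeight_of_lt (not_le.mp h), zero_mul]; exact zero_le

section Flux

variable {k : Plane} {f₀ a : Circle2Pi × ℝ × ℝ → ℝ≥0∞} {p : ℝ≥0∞}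

theorem eLpNorm_add_collisionOp_le (hf : Measurable f₀) (hp : 1 ≤ p) :
    eLpNorm (fun y => f₀ y + collisionOp kernelFn f₀ y) p angleStripMeasure ≤
      ENNReal.ofReal 2 * eLpNorm f₀ p angleStripMeasure := by
  refine (eLpNorm_le_of_ae_le_add (c₁ := 1) (c₂ := 1) (g₂ := collisionOp kernelFn f₀) hp hf
    (by fun_prop) (ae_of_all _ fun y => by simp)).trans ?_
  rw [one_mul, one_mul, ENNReal.ofReal_ofNat]
  exact (add_le_add_right (eLpNorm_collisionOp_kernelFn_le hf hp) _).trans_eq (two_mul _).symm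

theorem eLpNorm_flux_le (hk : k ≠ 0) (hf : Measurable f₀) (ha : Measurable a)
    (hloc : ∀ T, ∫⁻ y, before T y * a y ∂angleStripMeasure ≠ ∞)
    (h : ∀ᵐ y ∂angleStripMeasure, a y ≤ f₀ y + collisionOp kernelFn f₀ y + pairOp k a y)
    (hp : 1 ≤ p) :
    eLpNorm a p angleStripMeasure ≤
      ENNReal.ofReal (2 / gap k) * eLpNorm f₀ p angleStripMeasure := by
  have hδ := gap_pos hk
  have hG : Measurable fun y => f₀ y + collisionOp kernelFn f₀ y := by fun_prop
  have hsup := eLpNorm_iSup_le hp (measurable_picard k hG) (monotone_picard k _)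
    (fun n => (eLpNorm_picard_le hk hG hp n).trans 
      (mul_le_mul_right (eLpNorm_add_collisionOp_le hf hp) _))
  refine (eLpNorm_mono_enorm_ae ?_).trans (hsup.trans_eq ?_)
  · filter_upwards [ae_le_iSup_picard hk hG ha hloc h] with y hy using hy
  · rw [← mul_assoc, ← ENNReal.ofReal_mul (by positivity)]
    congr 2
    ring

theorem eLpNorm_timeWeight_mul_flux_le (hk : k ≠ 0) (hf : Measurable f₀) (ha : Measurable a)
    (hloc : ∀ T, ∫⁻ y, before T y * a y ∂angleStripMeasure ≠ ∞)
    (h : ∀ᵐ y ∂angleStripMeasure, a y ≤ f₀ y + collisionOp kernelFn f₀ y + pairOp k a y)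
    (hp : 1 ≤ p) {T : ℝ} (hT : 0 < T) :
    eLpNorm (fun y => timeWeight T y * a y) p angleStripMeasure ≤
      ENNReal.ofReal (6 / gap k) *
          eLpNorm (fun y => timeWeight T y * f₀ y) p angleStripMeasure +
        ENNReal.ofReal (1120 / (gap k ^ 3 * T)) * eLpNorm f₀ p angleStripMeasure := by
  have hδ := gap_pos hk
  have hδ1 := gap_le_one k
  set δ := gap k with hδdef
  set X := eLpNorm (fun y => timeWeight T y * f₀ y) p angleStripMeasure with hX
  set Y := eLpNorm f₀ p angleStripMeasure with hY
  have hG : Measurable fun y => f₀ y + collisionOp kernelFn f₀ y := by fun_prop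
  have hG2 : eLpNorm (fun y => f₀ y + collisionOp kernelFn f₀ y) p angleStripMeasure ≤
      ENNReal.ofReal 2 * Y := eLpNorm_add_collisionOp_le hf hp
  have hwG : eLpNorm (fun y => timeWeight T y * (f₀ y + collisionOp kernelFn f₀ y)) p
      angleStripMeasure ≤ ENNReal.ofReal 3 * X + ENNReal.ofReal (44 / T) * Y := by
    refine (eLpNorm_le_of_ae_le_add (c₁ := 1) (c₂ := 1)
      (g₁ := fun y => timeWeight T y * f₀ y)
      (g₂ := fun y => timeWeight T y * collisionOp kernelFn f₀ y) hp (by fun_prop) (by fun_prop)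
      (ae_of_all _ fun y => by rw [one_mul, one_mul, mul_add])).trans ?_
    rw [one_mul, one_mul]
    refine (add_le_add_right (eLpNorm_timeWeight_mul_collisionOp_le hT hf hp) _).trans_eq ?_
    rw [ENNReal.ofReal_ofNat]
    ring
  have hsup := eLpNorm_iSup_le (m := angleStripMeasure) hp
    (u := fun n y => timeWeight T y * picard k (fun y => f₀ y + collisionOp kernelFn f₀ y) n y)
    (fun n => by have := measurable_picard k hG n; fun_prop)
    (fun i j hij y => mul_le_mul_right (monotone_picard k _ hij y) _)
    (fun n => (eLpNorm_timeWeight_mul_picard_le hk hT hG hp n).trans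
      (mul_le_mul_right (add_le_add hwG (mul_le_mul_right hG2 _)) _))
  refine (eLpNorm_mono_enorm_ae ?_).trans (hsup.trans ?_)
  · filter_upwards [ae_le_iSup_picard hk hG ha hloc h] with y hy
    simp only [enorm_eq_self, ← ENNReal.mul_iSup]
    gcongr
  · rw [← hδdef, ← mul_assoc (ENNReal.ofReal (258 / _)), ← ENNReal.ofReal_mul (by positivity),
      add_assoc, ← add_mul, ← ENNReal.ofReal_add (by positivity) (by positivity), mul_add,
      ← mul_assoc, ← mul_assoc, ← ENNReal.ofReal_mul (by positivity),
      ← ENNReal.ofReal_mul (by positivity)]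
    gcongr
    · exact le_of_eq (by ring)
    · rw [show 2 / δ * (44 / T + 258 / (δ ^ 2 * T) * 2) = (88 * δ ^ 2 + 1032) / (δ ^ 3 * T) by
        field_simp; ring]
      gcongr
      nlinarith

/-- The contribution to the density at time `T` of the particles that have collided before. The
two terms on the right come from the collisions at early times, after which the free path is
long, and at late times, when few particles are left in the `k`-th Fourier mode. -/
theorem eLpNorm_collisionOp_before_le (hk : k ≠ 0) (hf : Measurable f₀) (ha : Measurable a)
    (hloc : ∀ T, ∫⁻ y, before T y * a y ∂angleStripMeasure ≠ ∞)
    (h : ∀ᵐ y ∂angleStripMeasure, a y ≤ f₀ y + collisionOp kernelFn f₀ y + pairOp k a y)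
    (hp : 1 ≤ p) {T : ℝ} (hT : 0 ≤ T) :
    eLpNorm (collisionOp kernelFn fun y => before T y * a y) p (collisionMeasure T) ≤
      ENNReal.ofReal (4656 / gap k ^ 3) *
          (eLpNorm f₀ p angleStripMeasure / ENNReal.ofReal (T + 1)) +
        ENNReal.ofReal (4656 / gap k ^ 3) * eLpNorm f₀ p (collisionMeasure (T / 4)) := by
  have hδ := gap_pos hk
  have hδ1 := gap_le_one k
  have hδ3 : gap k ^ 3 ≤ gap k := by
    have : gap k ^ 2 ≤ 1 := pow_le_one₀ hδ.le hδ1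
    nlinarith
  have hb : Measurable fun y => before T y * a y := by fun_prop
  have hle : eLpNorm (fun y => before T y * a y) p angleStripMeasure ≤
      ENNReal.ofReal (2 / gap k) * eLpNorm f₀ p angleStripMeasure := by
    refine le_trans (eLpNorm_mono_enorm fun y => ?_) (eLpNorm_flux_le hk hf ha hloc h hp)
    exact mul_le_of_le_one_left' (before_le_one T y)
  set δ := gap k with hδdef
  set Y := eLpNorm f₀ p angleStripMeasure with hY
  have hdiv : ENNReal.ofReal (4656 / δ ^ 3) * (Y / ENNReal.ofReal (T + 1)) =
      ENNReal.ofReal (4656 / δ ^ 3 / (T + 1)) * Y := by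
    rw [ENNReal.ofReal_div_of_pos (y := T + 1) (by linarith), ENNReal.div_eq_inv_mul,
      ENNReal.div_eq_inv_mul]
    ring
  rw [hdiv]
  rcases lt_or_ge T 1 with hT1 | hT1
  · refine le_trans ?_ le_self_add
    calc eLpNorm (collisionOp kernelFn fun y => before T y * a y) p (collisionMeasure T)
        ≤ eLpNorm (collisionOp kernelFn fun y => before T y * a y) p angleStripMeasure := by
          rw [collisionMeasure_eq_restrict]
          exact eLpNorm_mono_measure _ Measure.restrict_le_self
      _ ≤ ENNReal.ofReal (2 / δ) * Y := (eLpNorm_collisionOp_kernelFn_le hb hp).trans hle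
      _ ≤ _ := by
          refine mul_le_mul_left (ENNReal.ofReal_le_ofReal ?_) _
          rw [div_div, div_le_div_iff₀ hδ (by positivity)]
          have : δ ^ 3 * (T + 1) ≤ δ * 2 := by gcongr; linarith
          nlinarith
  · have hT0 : 0 < T := by linarith
    calc eLpNorm (collisionOp kernelFn fun y => before T y * a y) p (collisionMeasure T)
        ≤ eLpNorm (fun y => timeWeight T y * collisionOp kernelFn (fun y => before T y * a y) y) p
            angleStripMeasure := by
          rw [collisionMeasure_eq_restrict, ← eLpNorm_indicator_eq_eLpNorm_restrict
            (measurableSet_le_time _)]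
          refine eLpNorm_mono_enorm fun y => ?_
          simp only [enorm_eq_self]
          by_cases hy : T ≤ y.2.1
          · rw [indicator_of_mem (s := {y : Circle2Pi × ℝ × ℝ | T ≤ y.2.1}) hy,
              timeWeight_of_le hT0 hy, one_mul]
          · rw [indicator_of_notMem (s := {y : Circle2Pi × ℝ × ℝ | T ≤ y.2.1}) hy]
            exact zero_le
      _ ≤ 2 * eLpNorm (fun y => timeWeight T y * (before T y * a y)) p angleStripMeasure +
            ENNReal.ofReal (44 / T) * eLpNorm (fun y => before T y * a y) p angleStripMeasure :=
          eLpNorm_timeWeight_mul_collisionOp_le hT0 hb hp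
      _ ≤ 2 * (ENNReal.ofReal (6 / δ) * eLpNorm f₀ p (collisionMeasure (T / 4)) +
            ENNReal.ofReal (1120 / (δ ^ 3 * T)) * Y) +
            ENNReal.ofReal (44 / T) * (ENNReal.ofReal (2 / δ) * Y) := by
          gcongr
          refine le_trans (eLpNorm_mono_enorm (g := fun y => timeWeight T y * a y) fun y => ?_)
            ((eLpNorm_timeWeight_mul_flux_le hk hf ha hloc h hp hT0).trans ?_)
          · simp only [enorm_eq_self]
            gcongr
            exact mul_le_of_le_one_left' (before_le_one T y)
          · gcongr
            exact eLpNorm_timeWeight_mul_le f₀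
      _ = ENNReal.ofReal (2240 / (δ ^ 3 * T) + 88 / (δ * T)) * Y +
            ENNReal.ofReal (12 / δ) * eLpNorm f₀ p (collisionMeasure (T / 4)) := by
          rw [mul_add, ← mul_assoc, ← mul_assoc, ← mul_assoc, ← ENNReal.ofReal_ofNat,
            ← ENNReal.ofReal_mul zero_le_two, ← ENNReal.ofReal_mul zero_le_two,
            ← ENNReal.ofReal_mul (by positivity),
            ENNReal.ofReal_add (by positivity) (by positivity), add_mul,
            show 2 * (6 / δ) = 12 / δ by ring,
            show 2 * (1120 / (δ ^ 3 * T)) = 2240 / (δ ^ 3 * T) by ring,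
            show 44 / T * (2 / δ) = 88 / (δ * T) by field_simp; ring]
          ring
      _ ≤ _ := by
          gcongr
          · calc 2240 / (δ ^ 3 * T) + 88 / (δ * T) ≤ 2240 / (δ ^ 3 * T) + 88 / (δ ^ 3 * T) := by
                  gcongr
              _ = 4656 / (δ ^ 3 * (2 * T)) := by field_simp; norm_num
              _ ≤ 4656 / δ ^ 3 / (T + 1) := by
                  rw [div_div]
                  gcongr
                  linarith
          · norm_num

end Flux

/-! ### Free transport and collisions in position space -/

theorem ae_ae_swap_of_ae_prod {α β : Type*} [MeasurableSpace α] [MeasurableSpace β]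
    {m : Measure α} {n : Measure β} [SFinite m] [SFinite n] {P : α × β → Prop}
    (h : ∀ᵐ z ∂m.prod n, P z) : ∀ᵐ y ∂n, ∀ᵐ x ∂m, P (x, y) :=
  Measure.ae_ae_of_ae_prod
    ((Measure.measurePreserving_swap (μ := n) (ν := m)).quasiMeasurePreserving.ae h)

theorem ae_prod_of_ae_ae_swap {α β : Type*} [MeasurableSpace α] [MeasurableSpace β]
    {m : Measure α} {n : Measure β} [SFinite m] [SFinite n] {P : α × β → Prop}
    (hP : MeasurableSet {z | P z}) (h : ∀ᵐ y ∂n, ∀ᵐ x ∂m, P (x, y)) : ∀ᵐ z ∂m.prod n, P z := by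
  have h1 : ∀ᵐ z ∂n.prod m, P z.swap :=
    (Measure.ae_prod_iff_ae_ae (hP.preimage measurable_swap)).mpr h
  exact (Measure.measurePreserving_swap (μ := m) (ν := n)).quasiMeasurePreserving.ae h1

/-- The iterated integral over `0 ≤ t ≤ a` of a function known almost everywhere. -/
theorem intervalIntegral_eq_integral_stripMeasure {F G : ℝ × ℝ → ℝ} {a : ℝ} (ha : 0 ≤ a)
    (hF : Integrable F stripMeasure) (h0 : ∀ w : ℝ × ℝ, w.1 < 0 ∨ a < w.1 → F w = 0)
    (hG : ∀ᵐ w ∂stripMeasure, w.1 ∈ Icc 0 a → G w = F w) :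
    ∫ t in (0 : ℝ)..a, ∫ h in (-1 : ℝ)..1, G (t, h) = ∫ w, F w ∂stripMeasure := by
  have h1 : ∫ t, (∫ h in Icc (-1 : ℝ) 1, F (t, h)) =
      ∫ t in Icc 0 a, ∫ h in Icc (-1 : ℝ) 1, F (t, h) := by
    refine (setIntegral_eq_integral_of_forall_compl_eq_zero fun t ht => ?_).symm
    refine integral_eq_zero_of_ae (ae_of_all _ fun h => h0 (t, h) ?_)
    simp only [mem_Icc, not_and_or, not_le] at ht
    exact ht
  rw [stripMeasure, integral_prod _ hF, h1, intervalIntegral.integral_of_le ha,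
    ← integral_Icc_eq_integral_Ioc]
  refine setIntegral_congr_ae measurableSet_Icc ?_
  filter_upwards [Measure.ae_ae_of_ae_prod hG] with t ht htm
  rw [intervalIntegral.integral_of_le (by norm_num), ← integral_Icc_eq_integral_Ioc]
  refine integral_congr_ae ?_
  filter_upwards [ht] with h hh using hh htm

@[fun_prop]
theorem measurable_velocity : Measurable velocity := continuous_velocity.measurable

section Transport

variable {X : Type} [AddCommGroup X]

/-- Free transport of `m₀` over the time `a`, plus the particles whose last collision, of density
`q`, took place at the time `w.1` with impact parameter `w.2`. The second time variable of the
argument is that of the next collision, which is constant along free flights. -/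
def duhamel (proj : Plane → X) (a : Circle2Pi × ℝ × ℝ → ℝ) (m₀ q : X × Circle2Pi × ℝ × ℝ → ℝ)
    (z : X × Circle2Pi × ℝ × ℝ) : ℝ :=
  m₀ (z.1 - proj (a z.2 • velocity z.2.1), z.2) +
    ∫ w, Q (z.2.2.1 - w.1) z.2.2.2 w.2 *
      q (z.1 - proj ((a z.2 - w.1) • velocity z.2.1), z.2.1 + deflection w.2, w) ∂stripMeasure

variable {proj : Plane → X} {a : Circle2Pi × ℝ × ℝ → ℝ} {m₀ q μ₀ : X × Circle2Pi × ℝ × ℝ → ℝ}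
  {μ : ℝ → X × Circle2Pi × ℝ × ℝ → ℝ}

theorem measurable_duhamel [MeasureSpace X] [MeasurableSub₂ X] 
    (hproj : Measurable proj) (ha : Measurable a) (hm₀ : Measurable m₀) (hq : Measurable q) :
    Measurable (duhamel proj a m₀ q) := by
  refine Measurable.add (by fun_prop) (StronglyMeasurable.measurable
    (StronglyMeasurable.integral_prod_right' (f := fun r : (X × Circle2Pi × ℝ × ℝ) × ℝ × ℝ =>
      Q (r.1.2.2.1 - r.2.1) r.1.2.2.2 r.2.2 *
      q (r.1.1 - proj ((a r.1.2 - r.2.1) • velocity r.1.2.1), r.1.2.1 + deflection r.2.2, r.2)) ?_))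
  exact Measurable.stronglyMeasurable (by fun_prop)

theorem enorm_duhamel_le (z : X × Circle2Pi × ℝ × ℝ) :
    ‖duhamel proj a m₀ q z‖ₑ ≤ ‖m₀ (z.1 - proj (a z.2 • velocity z.2.1), z.2)‖ₑ +
      ∫⁻ w, kernelFn (z.2.2.1 - w.1, z.2.2.2, w.2) *
        ‖q (z.1 - proj ((a z.2 - w.1) • velocity z.2.1), z.2.1 + deflection w.2, w)‖ₑ
          ∂stripMeasure := by
  refine (enorm_add_le _ _).trans (add_le_add_right
    ((enorm_integral_le_lintegral_enorm _).trans_eq (lintegral_congr fun w => ?_)) _)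
  rw [enorm_mul, enorm_Q]
  rfl

variable [MeasureSpace X] [MeasurableAdd X] [MeasurableSub₂ X] [SFinite (volume : Measure X)]
  [(volume : Measure X).IsAddRightInvariant]

/-- Integration over positions commutes with collisions, whatever the displacements `d` during the
flights. -/
theorem lintegral_lintegral_flight {N : ℝ × ℝ × ℝ → ℝ≥0∞} (hN : Measurable N)
    {F : X × Circle2Pi × ℝ × ℝ → ℝ≥0∞} (hF : Measurable F) {d : ℝ × ℝ → X} (hd : Measurable d)
    (y : Circle2Pi × ℝ × ℝ) :
    ∫⁻ x, ∫⁻ w, N (y.2.1 - w.1, y.2.2, w.2) * F (x - d w, y.1 + deflection w.2, w)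
        ∂stripMeasure = collisionOp N (fun y => ∫⁻ x, F (x, y)) y := by
  rw [lintegral_lintegral_swap (by fun_prop)]
  refine lintegral_congr fun w => ?_
  rw [lintegral_const_mul _ (by fun_prop)]
  congr 1
  exact lintegral_sub_right_eq_self (fun x => F (x, y.1 + deflection w.2, w)) (d w)

/-- A property that holds almost everywhere holds at almost every preceding collision, for almost
every end point. -/
theorem ae_ae_flight {P : X × Circle2Pi × ℝ × ℝ → Prop}
    (hP : ∀ᵐ z ∂(volume : Measure X).prod angleStripMeasure, P z)
    {d : (Circle2Pi × ℝ × ℝ) × ℝ × ℝ → X} (hd : Measurable d) :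
    ∀ᵐ z ∂(volume : Measure X).prod angleStripMeasure, ∀ᵐ w ∂stripMeasure,
      P (z.1 - d (z.2, w), z.2.1 + deflection w.2, w) := by
  set A := toMeasurable ((volume : Measure X).prod angleStripMeasure) {z | ¬ P z} with hA
  have hAm : MeasurableSet A := measurableSet_toMeasurable _ _
  set b : X × Circle2Pi × ℝ × ℝ → ℝ≥0∞ := A.indicator 1 with hb
  have hbm : Measurable b := measurable_one.indicator hAm
  have hB : Measurable fun y => ∫⁻ x, b (x, y) := hbm.lintegral_prod_left'
  have h0 : ∫⁻ y, (∫⁻ x, b (x, y)) ∂angleStripMeasure = 0 := by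
    rw [← lintegral_prod_symm' _ hbm, hb, lintegral_indicator_one hAm, hA, measure_toMeasurable]
    exact hP
  rw [lintegral_eq_zero_iff hB] at h0
  have h1 : ∫⁻ z, (∫⁻ w, 1 * b (z.1 - d (z.2, w), z.2.1 + deflection w.2, w) ∂stripMeasure)
      ∂(volume : Measure X).prod angleStripMeasure = 0 := by
    rw [lintegral_prod_symm' _ (Measurable.lintegral_prod_right'
      (f := fun q : (X × Circle2Pi × ℝ × ℝ) × ℝ × ℝ =>
        1 * b (q.1.1 - d (q.1.2, q.2), q.1.2.1 + deflection q.2.2, q.2)) (by fun_prop))]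
    simp only
    rw [lintegral_congr fun y => lintegral_lintegral_flight (N := fun _ => 1) measurable_const hbm
      (d := fun w => d (y, w)) (by fun_prop) y, lintegral_collisionOp measurable_const hB]
    rw [lintegral_eq_zero_iff (by fun_prop)]
    filter_upwards [h0] with y hy
    simp only [hy, Pi.zero_apply, zero_mul]
  rw [lintegral_eq_zero_iff (Measurable.lintegral_prod_right'
      (f := fun q : (X × Circle2Pi × ℝ × ℝ) × ℝ × ℝ =>
        1 * b (q.1.1 - d (q.1.2, q.2), q.1.2.1 + deflection q.2.2, q.2)) (by fun_prop))] at h1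
  filter_upwards [h1] with z hz
  rw [Pi.zero_apply, lintegral_eq_zero_iff (by fun_prop)] at hz
  filter_upwards [hz] with w hw
  by_contra hcon
  have : (z.1 - d (z.2, w), z.2.1 + deflection w.2, w) ∈ A := subset_toMeasurable _ _ hcon
  simp [hb, this] at hw

theorem lintegral_enorm_duhamel_le (hproj : Measurable proj) (ha : Measurable a)
    (hm₀ : Measurable m₀) (hq : Measurable q) :
    ∫⁻ z, ‖duhamel proj a m₀ q z‖ₑ ∂(volume : Measure X).prod angleStripMeasure ≤
      ∫⁻ z, ‖m₀ z‖ₑ ∂(volume : Measure X).prod angleStripMeasure +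
        ∫⁻ y, (∫⁻ x, ‖q (x, y)‖ₑ) ∂angleStripMeasure := by
  have hqn : Measurable fun y => ∫⁻ x, ‖q (x, y)‖ₑ := hq.enorm.lintegral_prod_left'
  have hD := measurable_duhamel hproj ha hm₀ hq
  rw [lintegral_prod_symm' _ hD.enorm, lintegral_prod_symm' _ hm₀.enorm]
  calc ∫⁻ y, (∫⁻ x, ‖duhamel proj a m₀ q (x, y)‖ₑ) ∂angleStripMeasure
      ≤ ∫⁻ y, ((∫⁻ x, ‖m₀ (x, y)‖ₑ) +
          collisionOp kernelFn (fun y => ∫⁻ x, ‖q (x, y)‖ₑ) y) ∂angleStripMeasure := by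
        refine lintegral_mono fun y => ?_
        refine (lintegral_mono fun x => enorm_duhamel_le (x, y)).trans_eq ?_
        rw [lintegral_add_left (by fun_prop)]
        congr 1
        · exact lintegral_sub_right_eq_self (fun x => ‖m₀ (x, y)‖ₑ) (proj (a y • velocity y.1))
        · exact lintegral_lintegral_flight measurable_kernelFn hq.enorm
            (d := fun w => proj ((a y - w.1) • velocity y.1)) (by fun_prop) y
    _ ≤ _ := by
        rw [lintegral_add_left hm₀.enorm.lintegral_prod_left']
        exact add_le_add_right (lintegral_collisionOp_kernelFn_le hqn) _

/-- The right-hand side of the equation, expressed through measurable representatives `m₀` of the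
initial datum and `q` of the density of collisions. -/
theorem ae_mildRHS_eq_duhamel (hproj : Measurable proj) (ha : Measurable a) (hq : Measurable q)
    {S : Set ℝ} (hS : ∀ y, Icc 0 (a y) ⊆ S)
    (h₀ : ∀ᵐ z ∂(volume : Measure X).prod angleStripMeasure, 0 ≤ z.2.2.1 → μ₀ z = m₀ z)
    (hqμ : ∀ᵐ z ∂(volume : Measure X).prod angleStripMeasure, z.2.2.1 ∈ S →
      μ z.2.2.1 (z.1, z.2.1, 0, z.2.2.2) = q z)
    (hq0 : ∀ x y (w : ℝ × ℝ), w.1 < 0 ∨ a y < w.1 →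
      Q (y.2.1 - w.1) y.2.2 w.2 * q (x, y.1 + deflection w.2, w) = 0)
    (hfin : ∀ᵐ y ∂angleStripMeasure, collisionOp kernelFn (fun y => ∫⁻ x, ‖q (x, y)‖ₑ) y < ∞) :
    ∀ᵐ z ∂(volume : Measure X).prod angleStripMeasure, 0 ≤ a z.2 → a z.2 ≤ z.2.2.1 →
      mildRHS proj μ₀ μ (a z.2) (z.1, z.2.1, z.2.2.1 - a z.2, z.2.2.2) =
        duhamel proj a m₀ q z := by
  have hd : Measurable fun r : (Circle2Pi × ℝ × ℝ) × ℝ × ℝ =>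
      proj ((a r.1 - r.2.1) • velocity r.1.1) := by fun_prop
  -- the displacement along the free flight preserves null sets
  have hshift : Measure.QuasiMeasurePreserving
      (fun z : X × Circle2Pi × ℝ × ℝ => (z.1 - proj (a z.2 • velocity z.2.1), z.2))
      ((volume : Measure X).prod angleStripMeasure)
      ((volume : Measure X).prod angleStripMeasure) := by
    refine ⟨by fun_prop, Measure.AbsolutelyContinuous.mk fun A hA hA0 => ?_⟩
    rw [Measure.map_apply (by fun_prop) hA, ← lintegral_indicator_one
      (hA.preimage (by fun_prop)), lintegral_prod_symm' _ (measurable_one.indicator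
      (hA.preimage (by fun_prop)))]
    rw [← lintegral_indicator_one hA, lintegral_prod_symm' _ (measurable_one.indicator hA)] at hA0
    rw [← hA0]
    refine lintegral_congr fun y => ?_
    exact lintegral_sub_right_eq_self (fun x => A.indicator (fun _ => (1 : ℝ≥0∞)) (x, y))
      (proj (a y • velocity y.1))
  have hint : ∀ᵐ z ∂(volume : Measure X).prod angleStripMeasure,
      ∫⁻ w, kernelFn (z.2.2.1 - w.1, z.2.2.2, w.2) *
        ‖q (z.1 - proj ((a z.2 - w.1) • velocity z.2.1), z.2.1 + deflection w.2, w)‖ₑ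
          ∂stripMeasure < ∞ := by
    have hm : Measurable fun z : X × Circle2Pi × ℝ × ℝ =>
        ∫⁻ w, kernelFn (z.2.2.1 - w.1, z.2.2.2, w.2) *
        ‖q (z.1 - proj ((a z.2 - w.1) • velocity z.2.1), z.2.1 + deflection w.2, w)‖ₑ
          ∂stripMeasure :=
      Measurable.lintegral_prod_right' (f := fun r : (X × Circle2Pi × ℝ × ℝ) × ℝ × ℝ =>
        kernelFn (r.1.2.2.1 - r.2.1, r.1.2.2.2, r.2.2) * ‖q (r.1.1 - proj ((a r.1.2 - r.2.1) •
          velocity r.1.2.1), r.1.2.1 + deflection r.2.2, r.2)‖ₑ) (by fun_prop)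
    refine ae_prod_of_ae_ae_swap (measurableSet_lt hm measurable_const) ?_
    filter_upwards [hfin] with y hy
    refine ae_lt_top (by fun_prop) ?_
    rw [lintegral_lintegral_flight measurable_kernelFn hq.enorm
      (d := fun w => proj ((a y - w.1) • velocity y.1)) (by fun_prop) y]
    exact hy.ne
  filter_upwards [hshift.ae h₀, hint, ae_ae_flight hqμ hd] with z hz1 hz2 hz3 h0 hσ
  obtain ⟨x, θ, σ, h⟩ := z
  simp only at hz1 hz2 hz3 h0 hσ ⊢
  simp only [mildRHS, duhamel, sub_add_cancel]
  rw [hz1 (h0.trans hσ)]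
  congr 1
  refine intervalIntegral_eq_integral_stripMeasure (G := fun w => Q (σ - w.1) h w.2 * μ w.1
    (x - proj ((a (θ, σ, h) - w.1) • velocity θ), θ + deflection w.2, 0, w.2)) h0 ?_ ?_ ?_
  · refine ⟨(Measurable.aestronglyMeasurable (by fun_prop)), ?_⟩
    rw [hasFiniteIntegral_iff_enorm]
    refine lt_of_eq_of_lt (lintegral_congr fun w => ?_) hz2
    rw [enorm_mul, enorm_Q]
    rfl
  · exact fun w hw => hq0 _ (θ, σ, h) w hw
  · filter_upwards [hz3] with w hw hwm
    rw [hw (hS _ hwm)]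

end Transport

/-! ### The equation in Fourier variables -/

/-- The collision operator on the mode `k`: `collisionOp` with the kernel `Q`, together with the
phase gained during a free flight that ends at time `a`. -/
def modeOp (k : Plane) (a : ℝ) (f : Circle2Pi × ℝ × ℝ → ℂ) (y : Circle2Pi × ℝ × ℝ) : ℂ :=
  ∫ w, ((Q (y.2.1 - w.1) y.2.2 w.2 : ℝ) : ℂ) *
    Complex.exp (Complex.I * (((a - w.1) * frequency k y.1 : ℝ) : ℂ)) *
      f (y.1 + deflection w.2, w) ∂stripMeasure

theorem enorm_complex_Q (s h h' : ℝ) : ‖((Q s h h' : ℝ) : ℂ)‖ₑ = Qe s h h' := by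
  rw [← ofReal_norm, Complex.norm_real, ofReal_norm, enorm_Q]

theorem enorm_modeOp_le (k : Plane) (a : ℝ) (f : Circle2Pi × ℝ × ℝ → ℂ)
    (y : Circle2Pi × ℝ × ℝ) :
    ‖modeOp k a f y‖ₑ ≤ collisionOp kernelFn (fun y => ‖f y‖ₑ) y := by
  refine (enorm_integral_le_lintegral_enorm _).trans_eq (lintegral_congr fun w => ?_)
  rw [enorm_mul, enorm_mul, enorm_exp_I_mul, mul_one, enorm_complex_Q]
  rfl

theorem measurable_modeOp (k : Plane) {a : Circle2Pi × ℝ × ℝ → ℝ} (ha : Measurable a)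
    {f : Circle2Pi × ℝ × ℝ → ℂ} (hf : Measurable f) : Measurable fun y => modeOp k (a y) f y := by
  refine StronglyMeasurable.measurable (StronglyMeasurable.integral_prod_right'
    (f := fun r : (Circle2Pi × ℝ × ℝ) × ℝ × ℝ => ((Q (r.1.2.1 - r.2.1) r.1.2.2 r.2.2 : ℝ) : ℂ) *
      Complex.exp (Complex.I * (((a r.1 - r.2.1) * frequency k r.1.1 : ℝ) : ℂ)) *
        f (r.1.1 + deflection r.2.2, r.2)) ?_)
  exact Measurable.stronglyMeasurable (by fun_prop)

/-- A property that holds almost everywhere holds at almost every preceding collision, for functions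
that do not depend on position. -/
theorem ae_ae_deflection {P : Circle2Pi × ℝ × ℝ → Prop} (hP : ∀ᵐ y ∂angleStripMeasure, P y) :
    ∀ᵐ y ∂angleStripMeasure, ∀ᵐ w ∂stripMeasure, P (y.1 + deflection w.2, w) := by
  set A := toMeasurable angleStripMeasure {z | ¬ P z} with hA
  have hAm : MeasurableSet A := measurableSet_toMeasurable _ _
  set b : Circle2Pi × ℝ × ℝ → ℝ≥0∞ := A.indicator 1 with hb
  have hbm : Measurable b := measurable_one.indicator hAm
  have h0 : ∫⁻ y, b y ∂angleStripMeasure = 0 := by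
    rw [hb, lintegral_indicator_one hAm, hA, measure_toMeasurable]
    exact hP
  rw [lintegral_eq_zero_iff hbm] at h0
  have h1 : ∫⁻ y, collisionOp (fun _ => 1) b y ∂angleStripMeasure = 0 := by
    rw [lintegral_collisionOp measurable_const hbm, lintegral_eq_zero_iff (by fun_prop)]
    filter_upwards [h0] with y hy
    rw [hy, Pi.zero_apply, zero_mul]
  rw [lintegral_eq_zero_iff (by fun_prop)] at h1
  filter_upwards [h1] with y hy
  rw [Pi.zero_apply, collisionOp, lintegral_eq_zero_iff (by fun_prop)] at hy
  filter_upwards [hy] with w hw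
  by_contra hcon
  have : (y.1 + deflection w.2, w) ∈ A := subset_toMeasurable _ _ hcon
  simp [hb, this] at hw

theorem lintegral_before_mul_collisionOp_le (T : ℝ) {g : Circle2Pi × ℝ × ℝ → ℝ≥0∞}
    (hg : Measurable g) :
    ∫⁻ y, before T y * collisionOp kernelFn g y ∂angleStripMeasure ≤
      ∫⁻ y, before T y * g y ∂angleStripMeasure :=
  (lintegral_mono fun y => before_mul_collisionOp_le T g y).trans
    (lintegral_collisionOp_kernelFn_le (by fun_prop))

/-- A function that is integrable over bounded times is finite almost everywhere. -/
theorem ae_lt_top_of_before {g : Circle2Pi × ℝ × ℝ → ℝ≥0∞} (hg : Measurable g)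
    (h : ∀ T, ∫⁻ y, before T y * g y ∂angleStripMeasure ≠ ∞) :
    ∀ᵐ y ∂angleStripMeasure, g y < ∞ := by
  have h' : ∀ T : ℕ, ∀ᵐ y ∂angleStripMeasure, before T y * g y < ∞ := fun T =>
    ae_lt_top (by fun_prop) (h T)
  filter_upwards [ae_all_iff.mpr h'] with y hy
  obtain ⟨T, hyT⟩ := exists_nat_ge y.2.1
  have := hy T
  rwa [before_of_le hyT, one_mul] at this

/-- The contribution of two successive collisions to the mode `k` is controlled by the two-step
operator, whose kernel is the modulus of an oscillating integral. -/
theorem enorm_modeOp_modeOp_le (k : Plane) {f : Circle2Pi × ℝ × ℝ → ℂ} (hf : Measurable f)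
    {y : Circle2Pi × ℝ × ℝ}
    (hy : collisionOp kernelFn (collisionOp kernelFn fun y => ‖f y‖ₑ) y < ∞) :
    ‖modeOp k y.2.1 (fun y => modeOp k y.2.1 f y) y‖ₑ ≤ pairOp k (fun y => ‖f y‖ₑ) y := by
  set H : (ℝ × ℝ) × ℝ × ℝ → ℂ := fun r => (((Q (y.2.1 - r.1.1) y.2.2 r.1.2 *
    Q (r.1.1 - r.2.1) r.1.2 r.2.2 : ℝ) : ℂ) * Complex.exp (Complex.I *
      (((y.2.1 - r.1.1) * frequency k y.1 + (r.1.1 - r.2.1) *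
        frequency k (y.1 + deflection r.1.2) : ℝ) : ℂ))) *
      f (y.1 + deflection r.1.2 + deflection r.2.2, r.2) with hH
  have hHm : Measurable H := by rw [hH]; fun_prop
  have hHint : Integrable H (stripMeasure.prod stripMeasure) := by
    refine ⟨hHm.aestronglyMeasurable, ?_⟩
    rw [hasFiniteIntegral_iff_enorm, lintegral_prod _ hHm.enorm.aemeasurable]
    refine lt_of_eq_of_lt (lintegral_congr fun w => ?_) hy
    rw [collisionOp, ← lintegral_const_mul _ (by fun_prop)]
    refine lintegral_congr fun w' => ?_
    simp only [hH]
    rw [enorm_mul, enorm_mul, enorm_exp_I_mul, mul_one, Complex.ofReal_mul, enorm_mul,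
      enorm_complex_Q, enorm_complex_Q, mul_assoc]
    rfl
  -- Fubini: the time of the intermediate collision is to be integrated first
  have e1 : modeOp k y.2.1 (fun y => modeOp k y.2.1 f y) y =
      ∫ w', ∫ w, H (w, w') ∂stripMeasure ∂stripMeasure := by
    rw [← integral_integral_swap hHint, modeOp]
    refine integral_congr_ae (ae_of_all _ fun w => ?_)
    simp only [modeOp]
    rw [← integral_const_mul]
    refine integral_congr_ae (ae_of_all _ fun w' => ?_)
    simp only [hH]
    rw [Complex.ofReal_add, mul_add, Complex.exp_add, Complex.ofReal_mul (Q _ _ _)]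
    ring
  rw [e1]
  refine (enorm_integral_le_lintegral_enorm _).trans ?_
  rw [pairOp, pathOp, lintegral_pathMeasure (by fun_prop)]
  refine lintegral_mono_ae ?_
  filter_upwards [hHint.prod_left_ae] with w' hw'
  have hw2 : Integrable (fun w => H (w, w'))
      ((volume : Measure ℝ).prod (volume.restrict (Icc (-1 : ℝ) 1))) := hw'
  rw [stripMeasure, integral_prod_symm _ hw2]
  refine (enorm_integral_le_lintegral_enorm _).trans_eq (lintegral_congr fun h' => ?_)
  simp only [hH]
  rw [integral_mul_const, enorm_mul]
  rfl

/-- A mode that solves the renewal equation satisfies the two-step inequality. -/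
theorem ae_enorm_le_of_ae_eq_modeOp (k : Plane) {f f₀ : Circle2Pi × ℝ × ℝ → ℂ}
    (hf : Measurable f) (hf₀ : Measurable f₀)
    (hfin₀ : ∫⁻ y, ‖f₀ y‖ₑ ∂angleStripMeasure ≠ ∞)
    (hfin : ∀ T, ∫⁻ y, before T y * ‖f y‖ₑ ∂angleStripMeasure ≠ ∞)
    (h : ∀ᵐ y ∂angleStripMeasure, f y = f₀ y + modeOp k y.2.1 f y) :
    ∀ᵐ y ∂angleStripMeasure,
      ‖f y‖ₑ ≤ ‖f₀ y‖ₑ + collisionOp kernelFn (fun y => ‖f₀ y‖ₑ) y +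
        pairOp k (fun y => ‖f y‖ₑ) y := by
  have hA : Measurable (collisionOp kernelFn fun y => ‖f y‖ₑ) := by fun_prop
  have hA0 : ∀ᵐ y ∂angleStripMeasure, collisionOp kernelFn (fun y => ‖f₀ y‖ₑ) y < ∞ :=
    ae_lt_top (by fun_prop)
      (ne_top_of_le_ne_top hfin₀ (lintegral_collisionOp_kernelFn_le (by fun_prop)))
  have hAA : ∀ᵐ y ∂angleStripMeasure,
      collisionOp kernelFn (collisionOp kernelFn fun y => ‖f y‖ₑ) y < ∞ :=
    ae_lt_top_of_before (by fun_prop) fun T => ne_top_of_le_ne_top (hfin T)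
      ((lintegral_before_mul_collisionOp_le T hA).trans
        (lintegral_before_mul_collisionOp_le T (by fun_prop)))
  have hK : Measurable fun y => modeOp k y.2.1 f y := measurable_modeOp k (by fun_prop) hf
  -- insert the equation into itself once; finiteness allows splitting the integral
  filter_upwards [h, ae_ae_deflection h, hA0, hAA] with y h1 h2 h3 h4
  have hint : ∀ g : Circle2Pi × ℝ × ℝ → ℂ, Measurable g →
      collisionOp kernelFn (fun y => ‖g y‖ₑ) y < ∞ →
      Integrable (fun w => ((Q (y.2.1 - w.1) y.2.2 w.2 : ℝ) : ℂ) *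
        Complex.exp (Complex.I * (((y.2.1 - w.1) * frequency k y.1 : ℝ) : ℂ)) *
          g (y.1 + deflection w.2, w)) stripMeasure := by
    intro g hg hgt
    refine ⟨Measurable.aestronglyMeasurable (by fun_prop), ?_⟩
    rw [hasFiniteIntegral_iff_enorm]
    refine lt_of_eq_of_lt (lintegral_congr fun w => ?_) hgt
    rw [enorm_mul, enorm_mul, enorm_exp_I_mul, mul_one, enorm_complex_Q]
    rfl
  have h5 : modeOp k y.2.1 f y =
      modeOp k y.2.1 f₀ y + modeOp k y.2.1 (fun y => modeOp k y.2.1 f y) y := by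
    rw [modeOp, modeOp, modeOp, ← integral_add (hint f₀ hf₀ h3) (hint _ hK
      ((collisionOp_mono (fun y => enorm_modeOp_le k y.2.1 f y) y).trans_lt h4))]
    refine integral_congr_ae ?_
    filter_upwards [h2] with w hw
    rw [hw, mul_add]
  rw [h1, h5, add_assoc]
  refine (enorm_add_le _ _).trans (add_le_add_right ((enorm_add_le _ _).trans ?_) _)
  exact add_le_add (enorm_modeOp_le _ _ _ _) (enorm_modeOp_modeOp_le k hf h4)

section Character

variable {X : Type} [MeasureSpace X] {χ : X → ℂ}

theorem enorm_partialTransform_le (hχ1 : ∀ x, ‖χ x‖ = 1) {Y : Type} (g : X × Y → ℝ) (y : Y) :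
    ‖partialTransform χ g y‖ₑ ≤ ∫⁻ x, ‖g (x, y)‖ₑ := by
  refine (enorm_integral_le_lintegral_enorm _).trans_eq (lintegral_congr fun x => ?_)
  rw [enorm_mul, ← ofReal_norm, hχ1, ENNReal.ofReal_one, one_mul, ← ofReal_norm, Complex.norm_real,
    ofReal_norm]

theorem measurable_partialTransform [SFinite (volume : Measure X)] (hχm : Measurable χ)
    {Y : Type} [MeasurableSpace Y] {g : X × Y → ℝ} (hg : Measurable g) :
    Measurable (partialTransform χ g) :=
  StronglyMeasurable.measurable (StronglyMeasurable.integral_prod_left'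
    (f := fun z : X × Y => χ z.1 * (g z : ℂ)) (Measurable.stronglyMeasurable (by fun_prop)))

variable [AddCommGroup X] [MeasurableAdd X] [(volume : Measure X).IsAddRightInvariant]
  {proj : Plane → X} {k : Plane}

/-- Translation in position multiplies a Fourier coefficient by a phase. -/
theorem integral_mul_sub_proj
    (hχ : ∀ x d, χ (x + proj d) = χ x * Complex.exp (2 * Real.pi * Complex.I * (inner ℝ k d : ℝ)))
    (g : X → ℝ) (τ : ℝ) (θ : Circle2Pi) :
    ∫ x, χ x * (g (x - proj (τ • velocity θ)) : ℂ) =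
      Complex.exp (Complex.I * ((τ * frequency k θ : ℝ) : ℂ)) * ∫ x, χ x * (g x : ℂ) := by
  rw [← integral_add_right_eq_self _ (proj (τ • velocity θ)), ← integral_const_mul]
  refine integral_congr_ae (ae_of_all _ fun x => ?_)
  simp only
  rw [add_sub_cancel_right, hχ, inner_smul_right, frequency]
  push_cast
  ring_nf

/-- The Fourier coefficients of `duhamel`. -/
theorem ae_partialTransform_duhamel [MeasurableSub₂ X] [SFinite (volume : Measure X)]
    (hproj : Measurable proj) (hχm : Measurable χ) (hχ1 : ∀ x, ‖χ x‖ = 1)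
    (hχ : ∀ x d, χ (x + proj d) = χ x * Complex.exp (2 * Real.pi * Complex.I * (inner ℝ k d : ℝ)))
    {a : Circle2Pi × ℝ × ℝ → ℝ} {m₀ q : X × Circle2Pi × ℝ × ℝ → ℝ}
    (hm₀ : Measurable m₀) (hq : Measurable q)
    (hm₀fin : ∀ᵐ y ∂angleStripMeasure, ∫⁻ x, ‖m₀ (x, y)‖ₑ < ∞)
    (hfin : ∀ᵐ y ∂angleStripMeasure, collisionOp kernelFn (fun y => ∫⁻ x, ‖q (x, y)‖ₑ) y < ∞) :
    ∀ᵐ y ∂angleStripMeasure, partialTransform χ (duhamel proj a m₀ q) y =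
      Complex.exp (Complex.I * ((a y * frequency k y.1 : ℝ) : ℂ)) * partialTransform χ m₀ y +
        modeOp k (a y) (partialTransform χ q) y := by
  filter_upwards [hm₀fin, hfin] with y h1 h2
  have hχe : ∀ x, ‖χ x‖ₑ = 1 := fun x => by rw [← ofReal_norm, hχ1, ENNReal.ofReal_one]
  set H : X × ℝ × ℝ → ℂ := fun r => χ r.1 * (((Q (y.2.1 - r.2.1) y.2.2 r.2.2 *
    q (r.1 - proj ((a y - r.2.1) • velocity y.1), y.1 + deflection r.2.2, r.2) : ℝ)) : ℂ) with hH
  have hHm : Measurable H := by rw [hH]; fun_prop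
  have hHint : Integrable H ((volume : Measure X).prod stripMeasure) := by
    refine ⟨hHm.aestronglyMeasurable, ?_⟩
    rw [hasFiniteIntegral_iff_enorm, lintegral_prod _ hHm.enorm.aemeasurable]
    rw [← lintegral_lintegral_flight measurable_kernelFn hq.enorm
      (d := fun w => proj ((a y - w.1) • velocity y.1)) (by fun_prop) y] at h2
    refine lt_of_eq_of_lt (lintegral_congr fun x => lintegral_congr fun w => ?_) h2
    simp only [hH]
    rw [enorm_mul, hχe, one_mul, Complex.ofReal_mul, enorm_mul, enorm_complex_Q, ← ofReal_norm,
      Complex.norm_real, ofReal_norm]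
    rfl
  have hint₀ : Integrable fun x => χ x * (m₀ (x - proj (a y • velocity y.1), y) : ℂ) := by
    refine ⟨Measurable.aestronglyMeasurable (by fun_prop), ?_⟩
    rw [hasFiniteIntegral_iff_enorm]
    rw [← lintegral_sub_right_eq_self _ (proj (a y • velocity y.1))] at h1
    refine lt_of_eq_of_lt (lintegral_congr fun x => ?_) h1
    rw [enorm_mul, hχe, one_mul, ← ofReal_norm, Complex.norm_real, ofReal_norm]
  have e1 : ∀ x, χ x * (duhamel proj a m₀ q (x, y) : ℂ) =
      χ x * (m₀ (x - proj (a y • velocity y.1), y) : ℂ) + ∫ w, H (x, w) ∂stripMeasure := by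
    intro x
    simp only [duhamel, hH]
    rw [Complex.ofReal_add, mul_add, integral_const_mul, integral_complex_ofReal]
  rw [partialTransform]
  simp only [e1]
  rw [integral_add hint₀ hHint.integral_prod_left, integral_mul_sub_proj hχ (fun x => m₀ (x, y)),
    integral_integral_swap hHint, modeOp]
  congr 1
  refine integral_congr_ae (ae_of_all _ fun w => ?_)
  simp only [hH]
  simp only [Complex.ofReal_mul (Q _ _ _), mul_left_comm (χ _)]
  rw [integral_const_mul,
    integral_mul_sub_proj hχ (fun x => q (x, y.1 + deflection w.2, w)), mul_assoc]
  rfl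

end Character

/-! ### Decay of the Fourier coefficients of mild solutions -/

section Decay

variable {X : Type} [MeasureSpace X]

theorem measurableSet_time {S : Set ℝ} (hS : MeasurableSet S) :
    MeasurableSet {z : X × Circle2Pi × ℝ × ℝ | z.2.2.1 ∈ S} :=
  hS.preimage (f := fun z : X × Circle2Pi × ℝ × ℝ => z.2.2.1) (by fun_prop)

variable [SFinite (volume : Measure X)]

theorem prod_restrict_time {S : Set ℝ} :
    (volume : Measure X).prod ((volume : Measure Circle2Pi).prod
        ((volume.restrict S).prod (volume.restrict (Icc (-1 : ℝ) 1)))) =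
      ((volume : Measure X).prod angleStripMeasure).restrict {z | z.2.2.1 ∈ S} := by
  have h1 : (volume.restrict S).prod (volume.restrict (Icc (-1 : ℝ) 1)) =
      stripMeasure.restrict (S ×ˢ univ) := by
    rw [stripMeasure, ← Measure.prod_restrict, Measure.restrict_univ]
  have h2 : {z : X × Circle2Pi × ℝ × ℝ | z.2.2.1 ∈ S} = univ ×ˢ (univ ×ˢ (S ×ˢ univ)) := by
    ext y; simp
  rw [h1, h2, angleStripMeasure, ← Measure.prod_restrict, ← Measure.prod_restrict,
    Measure.restrict_univ, Measure.restrict_univ]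

theorem phaseMeasure_eq_restrict :
    phaseMeasure X =
      ((volume : Measure X).prod angleStripMeasure).restrict {z | z.2.2.1 ∈ Ici (0 : ℝ)} :=
  prod_restrict_time (S := Ici 0)

theorem ae_phaseMeasure_iff {P : X × Circle2Pi × ℝ × ℝ → Prop} :
    (∀ᵐ z ∂phaseMeasure X, P z) ↔
      ∀ᵐ z ∂(volume : Measure X).prod angleStripMeasure, 0 ≤ z.2.2.1 → P z := by
  rw [phaseMeasure_eq_restrict, ae_restrict_iff' (measurableSet_time measurableSet_Ici)]
  rfl

/-- A measurable representative of a function on the phase space, extended by zero to negative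
times. -/
theorem exists_measurable_representative {g : X × Circle2Pi × ℝ × ℝ → ℝ}
    (hg : AEStronglyMeasurable g (phaseMeasure X)) :
    ∃ q : X × Circle2Pi × ℝ × ℝ → ℝ, Measurable q ∧ (∀ z, z.2.2.1 < 0 → q z = 0) ∧
      ∀ᵐ z ∂(volume : Measure X).prod angleStripMeasure, 0 ≤ z.2.2.1 → g z = q z := by
  refine ⟨{z | z.2.2.1 ∈ Ici (0 : ℝ)}.indicator (hg.mk g),
    hg.stronglyMeasurable_mk.measurable.indicator (measurableSet_time measurableSet_Ici),
    fun z hz => indicator_of_notMem (by simpa using hz) _, ?_⟩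
  filter_upwards [ae_phaseMeasure_iff.mp hg.ae_eq_mk] with z hz h0
  rw [hz h0, indicator_of_mem (by simpa using h0)]

theorem quasiMeasurePreserving_shift (T : ℝ) :
    Measure.QuasiMeasurePreserving
      (fun z : X × Circle2Pi × ℝ × ℝ => (z.1, z.2.1, z.2.2.1 + T, z.2.2.2))
      ((volume : Measure X).prod angleStripMeasure)
      ((volume : Measure X).prod angleStripMeasure) :=
  ((MeasurePreserving.id _).prod ((MeasurePreserving.id _).prod
    ((measurePreserving_add_right volume T).prod (MeasurePreserving.id _)))).quasiMeasurePreserving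

theorem measurePreserving_shift (T : ℝ) :
    MeasurePreserving (fun y : Circle2Pi × ℝ × ℝ => (y.1, y.2.1 + T, y.2.2))
      angleStripMeasure angleStripMeasure :=
  (MeasurePreserving.id _).prod
    ((measurePreserving_add_right volume T).prod (MeasurePreserving.id _))

theorem measurePreserving_shift_collisionMeasure (T : ℝ) :
    MeasurePreserving (fun y : Circle2Pi × ℝ × ℝ => (y.1, y.2.1 + T, y.2.2))
      (collisionMeasure 0) (collisionMeasure T) := by
  rw [collisionMeasure_eq_restrict, collisionMeasure_eq_restrict]
  have := (measurePreserving_shift T).restrict_preimage (measurableSet_le_time T)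
  simpa only [preimage_ofPred_eq, le_add_iff_nonneg_left] using this

instance (a : ℝ) : SFinite (collisionMeasure a) := by unfold collisionMeasure; infer_instance

variable {χ : X → ℂ}

theorem eLpNorm_partialTransform_congr {g q : X × Circle2Pi × ℝ × ℝ → ℝ}
    (h : ∀ᵐ z ∂(volume : Measure X).prod angleStripMeasure, 0 ≤ z.2.2.1 → g z = q z) {a : ℝ}
    (ha : 0 ≤ a) :
    partialTransform χ q =ᵐ[collisionMeasure a] partialTransform χ g := by
  rw [Filter.EventuallyEq, collisionMeasure_eq_restrict,
    ae_restrict_iff' (measurableSet_le_time a)]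
  filter_upwards [ae_ae_swap_of_ae_prod h] with y hy hya
  refine integral_congr_ae ?_
  filter_upwards [hy] with x hx
  rw [hx (ha.trans hya)]

variable [AddCommGroup X] {proj : Plane → X} {k : Plane} {μ₀ : X × Circle2Pi × ℝ × ℝ → ℝ}
  {μ : ℝ → X × Circle2Pi × ℝ × ℝ → ℝ}

/-- Measurability over all times, from measurability over bounded intervals of time. -/
theorem IsMildSolution.aestronglyMeasurable_collisions (hμ : IsMildSolution proj μ₀ μ) :
    AEStronglyMeasurable
      (fun z : X × Circle2Pi × ℝ × ℝ => μ z.2.2.1 (z.1, z.2.1, 0, z.2.2.2)) (phaseMeasure X) := by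
  have hU : {z : X × Circle2Pi × ℝ × ℝ | z.2.2.1 ∈ Ici (0 : ℝ)} =
      ⋃ n : ℕ, {z | z.2.2.1 ∈ Icc (0 : ℝ) (n + 1)} := by
    ext z
    simp only [mem_ofPred_eq, mem_iUnion, mem_Icc, mem_Ici]
    refine ⟨fun h => ?_, fun ⟨n, h⟩ => h.1⟩
    obtain ⟨n, hn⟩ := exists_nat_ge z.2.2.1
    exact ⟨n, h, by linarith⟩
  rw [phaseMeasure_eq_restrict, hU, aestronglyMeasurable_iUnion_iff]
  intro n
  rw [← prod_restrict_time]
  exact (hμ.integrable_collisions (n + 1) (by positivity)).aestronglyMeasurable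

theorem IsMildSolution.lintegral_before_ne_top (hμ : IsMildSolution proj μ₀ μ)
    {q : X × Circle2Pi × ℝ × ℝ → ℝ} (hq : Measurable q) (hq0 : ∀ z, z.2.2.1 < 0 → q z = 0)
    (hqμ : ∀ᵐ z ∂(volume : Measure X).prod angleStripMeasure, 0 ≤ z.2.2.1 →
      μ z.2.2.1 (z.1, z.2.1, 0, z.2.2.2) = q z) (T : ℝ) :
    ∫⁻ y, before T y * (∫⁻ x, ‖q (x, y)‖ₑ) ∂angleStripMeasure ≠ ∞ := by
  have hfin := (hμ.integrable_collisions (|T| + 1) (by positivity)).hasFiniteIntegral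
  rw [hasFiniteIntegral_iff_enorm, prod_restrict_time,
    ← lintegral_indicator (measurableSet_time measurableSet_Icc)] at hfin
  refine ne_top_of_le_ne_top hfin.ne ?_
  have e : ∀ y, before T y * (∫⁻ x, ‖q (x, y)‖ₑ) = ∫⁻ x, before T y * ‖q (x, y)‖ₑ := fun y =>
    (lintegral_const_mul _ (by fun_prop)).symm
  simp only [e]
  rw [← lintegral_prod_symm' (fun z : X × Circle2Pi × ℝ × ℝ => before T z.2 * ‖q z‖ₑ)
    (by fun_prop)]
  refine lintegral_mono_ae ?_
  filter_upwards [hqμ] with z hz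
  rcases lt_or_ge z.2.2.1 0 with h0 | h0
  · rw [hq0 z h0, enorm_zero, mul_zero]; exact zero_le
  rcases le_or_gt z.2.2.1 T with h1 | h1
  · rw [indicator_of_mem, hz h0]
    · exact mul_le_of_le_one_left' (before_le_one T _)
    · exact ⟨h0, by linarith [le_abs_self T]⟩
  · rw [before_of_lt h1, zero_mul]; exact zero_le

variable [MeasurableAdd X] [MeasurableSub₂ X] [(volume : Measure X).IsAddRightInvariant]

/-- Decay of a nonconstant mode, for mild solutions over a quotient of the plane. Here `χ` is the
character of frequency `k`, as the relation `hχ` expresses. -/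
theorem IsMildSolution.eLpNorm_partialTransform_le (hμ : IsMildSolution proj μ₀ μ) (hk : k ≠ 0)
    (hproj : Measurable proj) (hχm : Measurable χ) (hχ1 : ∀ x, ‖χ x‖ = 1)
    (hχ : ∀ x d, χ (x + proj d) = χ x * Complex.exp (2 * Real.pi * Complex.I * (inner ℝ k d : ℝ)))
    (hμ₀ : MemLp μ₀ 1 (phaseMeasure X)) {p : ℝ≥0∞} (hp : 1 ≤ p) {T : ℝ} (hT : 0 ≤ T) :
    Integrable (μ T) (phaseMeasure X) ∧
    AEStronglyMeasurable (partialTransform χ (μ T)) (collisionMeasure 0) ∧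
    eLpNorm (partialTransform χ (μ T)) p (collisionMeasure 0) ≤
      ENNReal.ofReal (4656 / gap k ^ 3) *
          (eLpNorm (partialTransform χ μ₀) p (collisionMeasure 0) / ENNReal.ofReal (T + 1)) +
        ENNReal.ofReal (4657 / gap k ^ 3) *
          eLpNorm (partialTransform χ μ₀) p (collisionMeasure (T / 4)) := by
  obtain ⟨m₀, hm₀, hm₀0, hm₀μ⟩ := exists_measurable_representative hμ₀.aestronglyMeasurable
  obtain ⟨q, hq, hq0, hqμ⟩ := exists_measurable_representative hμ.aestronglyMeasurable_collisions
  have hqT := hμ.lintegral_before_ne_top hq hq0 hqμ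
  -- the initial datum
  have hm₀fin : ∫⁻ z, ‖m₀ z‖ₑ ∂(volume : Measure X).prod angleStripMeasure ≠ ∞ := by
    have := (memLp_one_iff_integrable.mp hμ₀).hasFiniteIntegral
    rw [hasFiniteIntegral_iff_enorm, phaseMeasure_eq_restrict,
      ← lintegral_indicator (measurableSet_time measurableSet_Ici)] at this
    refine ne_top_of_le_ne_top this.ne (lintegral_mono_ae ?_)
    filter_upwards [hm₀μ] with z hz
    rcases lt_or_ge z.2.2.1 0 with h0 | h0
    · rw [hm₀0 z h0, enorm_zero]; exact zero_le
    · rw [indicator_of_mem (by exact h0), hz h0]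
  have hm₀fin' : ∫⁻ y, (∫⁻ x, ‖m₀ (x, y)‖ₑ) ∂angleStripMeasure ≠ ∞ := by
    rwa [← lintegral_prod_symm' _ hm₀.enorm]
  have hm₀ae : ∀ᵐ y ∂angleStripMeasure, ∫⁻ x, ‖m₀ (x, y)‖ₑ < ∞ :=
    ae_lt_top hm₀.enorm.lintegral_prod_left' hm₀fin'
  have hC : Measurable fun y => ∫⁻ x, ‖q (x, y)‖ₑ := hq.enorm.lintegral_prod_left'
  have hCfin : ∀ᵐ y ∂angleStripMeasure,
      collisionOp kernelFn (fun y => ∫⁻ x, ‖q (x, y)‖ₑ) y < ∞ :=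
    ae_lt_top_of_before (by fun_prop) fun T =>
      ne_top_of_le_ne_top (hqT T) (lintegral_before_mul_collisionOp_le T hC)
  -- the Fourier coefficients of the datum and of the density of collisions
  set f : Circle2Pi × ℝ × ℝ → ℂ := partialTransform χ q with hf
  set F₀ : Circle2Pi × ℝ × ℝ → ℂ := partialTransform χ m₀ with hF₀
  have hfm : Measurable f := measurable_partialTransform hχm hq
  have hF₀m : Measurable F₀ := measurable_partialTransform hχm hm₀
  have hF₀neg : ∀ y : Circle2Pi × ℝ × ℝ, y.2.1 < 0 → F₀ y = 0 := fun y hy => by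
    simp only [hF₀, partialTransform, hm₀0 (_, y) hy, Complex.ofReal_zero, mul_zero, integral_zero]
  have hfneg : ∀ y : Circle2Pi × ℝ × ℝ, y.2.1 < 0 → f y = 0 := fun y hy => by
    simp only [hf, partialTransform, hq0 (_, y) hy, Complex.ofReal_zero, mul_zero, integral_zero]
  have hF₀fin : ∫⁻ y, ‖F₀ y‖ₑ ∂angleStripMeasure ≠ ∞ :=
    ne_top_of_le_ne_top hm₀fin' (lintegral_mono fun y => enorm_partialTransform_le hχ1 m₀ y)
  have hffin : ∀ T, ∫⁻ y, before T y * ‖f y‖ₑ ∂angleStripMeasure ≠ ∞ := fun T =>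
    ne_top_of_le_ne_top (hqT T)
      (lintegral_mono fun y => mul_le_mul_right (enorm_partialTransform_le hχ1 q y) _)
  set f₀ : Circle2Pi × ℝ × ℝ → ℂ := fun y =>
    Complex.exp (Complex.I * ((y.2.1 * frequency k y.1 : ℝ) : ℂ)) * F₀ y with hf₀
  have hf₀e : ∀ y, ‖f₀ y‖ₑ = ‖F₀ y‖ₑ := fun y => by
    simp only [hf₀]; rw [enorm_mul, enorm_exp_I_mul, one_mul]
  -- the renewal equation for the mode `k` of the density of collisions
  have hrenew : ∀ᵐ y ∂angleStripMeasure, f y = f₀ y + modeOp k y.2.1 f y := by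
    have hrhs := ae_mildRHS_eq_duhamel (μ₀ := μ₀) (μ := μ) hproj
      (a := fun y => y.2.1) (by fun_prop) hq
      (S := Ici 0) (fun y => Icc_subset_Ici_self) hm₀μ hqμ (fun x y w hw => by
        rcases hw with hw | hw
        · rw [hq0 _ hw, mul_zero]
        · rw [Q_of_neg (sub_neg.mpr hw), zero_mul]) hCfin
    have hz : ∀ᵐ z ∂(volume : Measure X).prod angleStripMeasure, 0 ≤ z.2.2.1 →
        q z = duhamel proj (fun y => y.2.1) m₀ q z := by
      filter_upwards [hrhs, hqμ, ae_phaseMeasure_iff.mp hμ.collisions_eq] with z h1 h2 h3 h0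
      rw [← h1 h0 le_rfl, ← h2 h0, h3 h0, sub_self]
    filter_upwards [ae_ae_swap_of_ae_prod hz, ae_partialTransform_duhamel hproj hχm hχ1 hχ
      (a := fun y => y.2.1) hm₀ hq hm₀ae hCfin] with y h1 h2
    rcases lt_or_ge y.2.1 0 with h0 | h0
    · have hK : modeOp k y.2.1 f y = 0 := by
        refine integral_eq_zero_of_ae (ae_of_all _ fun w => ?_)
        rcases lt_or_ge w.1 0 with hw | hw
        · simp only
          rw [hfneg _ hw, mul_zero]
          rfl
        · simp [Q_of_neg (sub_neg.mpr (h0.trans_le hw))]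
      rw [hfneg y h0, hK, add_zero]
      simp only [hf₀]
      rw [hF₀neg y h0, mul_zero]
    · simp only [hf₀]
      rw [← h2, hf]
      refine integral_congr_ae ?_
      filter_upwards [h1] with x hx
      rw [hx h0]
  have hineq : ∀ᵐ y ∂angleStripMeasure, ‖f y‖ₑ ≤ ‖F₀ y‖ₑ +
      collisionOp kernelFn (fun y => ‖F₀ y‖ₑ) y + pairOp k (fun y => ‖f y‖ₑ) y := by
    have := ae_enorm_le_of_ae_eq_modeOp k hfm (f₀ := f₀) (by fun_prop)
      (by simpa only [hf₀e] using hF₀fin) hffin hrenew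
    simpa only [hf₀e] using this
  have hcore := eLpNorm_collisionOp_before_le hk hF₀m.enorm hfm.enorm hffin hineq hp hT
  -- the solution at time `T`
  set qT : X × Circle2Pi × ℝ × ℝ → ℝ := {z | z.2.2.1 ∈ Iic T}.indicator q with hqTdef
  have hqTm : Measurable qT := hq.indicator (measurableSet_time measurableSet_Iic)
  have hqTe : ∀ y, ∫⁻ x, ‖qT (x, y)‖ₑ = before T y * ∫⁻ x, ‖q (x, y)‖ₑ := by
    intro y
    rcases le_or_gt y.2.1 T with h1 | h1
    · rw [before_of_le h1, one_mul]
      refine lintegral_congr fun x => ?_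
      rw [hqTdef, indicator_of_mem (by exact h1)]
    · rw [before_of_lt h1, zero_mul]
      have : ∀ x, qT (x, y) = 0 := fun x => indicator_of_notMem (by simpa using h1) _
      simp [this]
  have hqTfin : ∀ᵐ y ∂angleStripMeasure,
      collisionOp kernelFn (fun y => ∫⁻ x, ‖qT (x, y)‖ₑ) y < ∞ := by
    filter_upwards [hCfin] with y hy
    refine (collisionOp_mono (fun y => ?_) y).trans_lt hy
    rw [hqTe]
    exact mul_le_of_le_one_left' (before_le_one T y)
  have hfT : ∀ y, ‖partialTransform χ qT y‖ₑ = before T y * ‖f y‖ₑ := by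
    intro y
    rcases le_or_gt y.2.1 T with h1 | h1
    · rw [before_of_le h1, one_mul]
      congr 1
      refine integral_congr_ae (ae_of_all _ fun x => ?_)
      simp only
      rw [hqTdef, indicator_of_mem (by exact h1)]
    · rw [before_of_lt h1, zero_mul]
      have : ∀ x, qT (x, y) = 0 := fun x => indicator_of_notMem (by simpa using h1) _
      simp [partialTransform, this]
  set D : X × Circle2Pi × ℝ × ℝ → ℝ := duhamel proj (fun _ => T) m₀ qT with hD
  have hDm : Measurable D := measurable_duhamel hproj measurable_const hm₀ hqTm
  have hrhsT := ae_mildRHS_eq_duhamel (μ₀ := μ₀) (μ := μ) hproj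
    (a := fun _ => T) measurable_const hqTm (S := Icc 0 T) (fun y => Subset.rfl) hm₀μ
    (by
      filter_upwards [hqμ] with z hz hzS
      rw [hz hzS.1, hqTdef, indicator_of_mem (by exact hzS.2)])
    (fun x y w hw => by
      rcases hw with hw | hw
      · have : qT (x, y.1 + deflection w.2, w) = 0 := by
          rw [hqTdef, indicator_apply, hq0 _ hw, ite_self]
        rw [this, mul_zero]
      · have : qT (x, y.1 + deflection w.2, w) = 0 :=
          indicator_of_notMem (by simpa using hw) _
        rw [this, mul_zero]) hqTfin
  have hμD : ∀ᵐ z ∂phaseMeasure X, μ T z = D (z.1, z.2.1, z.2.2.1 + T, z.2.2.2) := by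
    rw [ae_phaseMeasure_iff]
    filter_upwards [(quasiMeasurePreserving_shift T).ae hrhsT,
      ae_phaseMeasure_iff.mp (hμ.eq T hT)] with z h1 h2 h0
    have := h1 hT (by simpa using h0)
    rw [h2 h0, hD, ← this]
    simp only [add_sub_cancel_right, Prod.mk.eta]
  have hDshift : Measurable fun z : X × Circle2Pi × ℝ × ℝ =>
      D (z.1, z.2.1, z.2.2.1 + T, z.2.2.2) := by fun_prop
  have hcoeff : partialTransform χ (μ T) =ᵐ[collisionMeasure 0]
      fun y => partialTransform χ D (y.1, y.2.1 + T, y.2.2) := by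
    filter_upwards [ae_ae_swap_of_ae_prod (n := collisionMeasure 0) hμD] with y hy
    refine integral_congr_ae ?_
    filter_upwards [hy] with x hx
    rw [hx]
  have hDt : Measurable (partialTransform χ D) := measurable_partialTransform hχm hDm
  refine ⟨⟨?_, ?_⟩, ?_, ?_⟩
  · exact hDshift.aestronglyMeasurable.congr (Filter.EventuallyEq.symm hμD)
  · rw [hasFiniteIntegral_iff_enorm]
    calc ∫⁻ z, ‖μ T z‖ₑ ∂phaseMeasure X
        = ∫⁻ z, ‖D (z.1, z.2.1, z.2.2.1 + T, z.2.2.2)‖ₑ ∂phaseMeasure X := by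
          refine lintegral_congr_ae ?_
          filter_upwards [hμD] with z hz
          rw [hz]
      _ ≤ ∫⁻ z, ‖D (z.1, z.2.1, z.2.2.1 + T, z.2.2.2)‖ₑ
            ∂(volume : Measure X).prod angleStripMeasure := by
          rw [phaseMeasure_eq_restrict]
          exact lintegral_mono' Measure.restrict_le_self le_rfl
      _ = ∫⁻ z, ‖D z‖ₑ ∂(volume : Measure X).prod angleStripMeasure := by
          rw [lintegral_prod_symm' _ hDshift.enorm, lintegral_prod_symm' _ hDm.enorm]
          exact (measurePreserving_shift T).lintegral_comp
            (f := fun y => ∫⁻ x, ‖D (x, y)‖ₑ) hDm.enorm.lintegral_prod_left'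
      _ ≤ _ := lintegral_enorm_duhamel_le hproj measurable_const hm₀ hqTm
      _ < ∞ := by
          simp only [hqTe]
          exact (ENNReal.add_ne_top.mpr ⟨hm₀fin, hqT T⟩).lt_top
  · exact (Measurable.aestronglyMeasurable (by fun_prop)).congr hcoeff.symm
  · rw [eLpNorm_congr_ae hcoeff]
    have hnorm : eLpNorm (fun y => partialTransform χ D (y.1, y.2.1 + T, y.2.2)) p
        (collisionMeasure 0) = eLpNorm (partialTransform χ D) p (collisionMeasure T) :=
      eLpNorm_comp_measurePreserving hDt.aestronglyMeasurable
        (measurePreserving_shift_collisionMeasure T)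
    have hbefore : Measurable fun y => before T y * ‖f y‖ₑ := by fun_prop
    have hDle : eLpNorm (partialTransform χ D) p (collisionMeasure T) ≤
        eLpNorm (fun y => ‖F₀ y‖ₑ) p (collisionMeasure T) +
          eLpNorm (collisionOp kernelFn fun y => before T y * ‖f y‖ₑ) p (collisionMeasure T) := by
      refine (eLpNorm_mono_enorm_ae ?_).trans (eLpNorm_add_le hF₀m.enorm.aestronglyMeasurable
        (measurable_collisionOp measurable_kernelFn hbefore).aestronglyMeasurable hp)
      rw [collisionMeasure_eq_restrict]
      refine ae_restrict_of_ae ?_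
      filter_upwards [ae_partialTransform_duhamel hproj hχm hχ1 hχ
        (a := fun _ => T) hm₀ hqTm hm₀ae hqTfin] with y hy
      rw [hD, hy]
      refine (enorm_add_le _ _).trans ?_
      rw [enorm_mul, enorm_exp_I_mul, one_mul]
      refine add_le_add le_rfl ((enorm_modeOp_le _ _ _ _).trans_eq ?_)
      simp only [hfT]
    have h0 : eLpNorm (fun y => ‖F₀ y‖ₑ) p angleStripMeasure =
        eLpNorm (partialTransform χ μ₀) p (collisionMeasure 0) := by
      rw [eLpNorm_enorm, ← eLpNorm_congr_ae (eLpNorm_partialTransform_congr hm₀μ le_rfl),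
        collisionMeasure_eq_restrict, ← eLpNorm_indicator_eq_eLpNorm_restrict
        (measurableSet_le_time 0)]
      congr 1
      ext y
      rw [indicator_apply]
      split_ifs with hy
      · rfl
      · exact hF₀neg y (not_le.mp hy)
    have h4 : eLpNorm (fun y => ‖F₀ y‖ₑ) p (collisionMeasure (T / 4)) =
        eLpNorm (partialTransform χ μ₀) p (collisionMeasure (T / 4)) := by
      rw [eLpNorm_enorm,
        eLpNorm_congr_ae (eLpNorm_partialTransform_congr hm₀μ (by positivity))]
    have hmono : eLpNorm (fun y => ‖F₀ y‖ₑ) p (collisionMeasure T) ≤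
        eLpNorm (fun y => ‖F₀ y‖ₑ) p (collisionMeasure (T / 4)) := by
      refine eLpNorm_mono_measure _ ?_
      rw [collisionMeasure_eq_restrict, collisionMeasure_eq_restrict]
      exact Measure.restrict_mono_set _ fun y (hy : T ≤ y.2.1) => by
        change T / 4 ≤ y.2.1
        linarith
    rw [hnorm]
    rw [h0, h4] at hcore
    rw [h4] at hmono
    have hδ := gap_pos hk
    have hδ3 : gap k ^ 3 ≤ 1 := pow_le_one₀ hδ.le (gap_le_one k)
    calc eLpNorm (partialTransform χ D) p (collisionMeasure T) ≤ _ := hDle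
      _ ≤ eLpNorm (partialTransform χ μ₀) p (collisionMeasure (T / 4)) + _ :=
          add_le_add hmono hcore
      _ ≤ _ := by
          rw [add_left_comm]
          refine add_le_add_right (le_trans
            (le_of_eq (b := (1 + ENNReal.ofReal (4656 / gap k ^ 3)) * eLpNorm (partialTransform χ μ₀) p (collisionMeasure (T / 4))) (by ring))
            (mul_le_mul_left ?_ _)) _
          rw [← ENNReal.ofReal_one, ← ENNReal.ofReal_add zero_le_one (by positivity)]
          refine ENNReal.ofReal_le_ofReal ?_
          rw [show (4657 : ℝ) / gap k ^ 3 = 1 / gap k ^ 3 + 4656 / gap k ^ 3 by ring]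
          have : 1 ≤ 1 / gap k ^ 3 := by rw [le_div_iff₀ (by positivity)]; linarith
          linarith

end Decay

/-! ### The equilibrium density and product data -/

theorem E_eq_integral (s h : ℝ) :
    E s h = ∫ s', (Ioi s).indicator (fun s' => ∫ h' in Icc (-1 : ℝ) 1, Q s' h h') s' := by
  rw [integral_indicator measurableSet_Ioi, E]
  refine integral_congr_ae (ae_of_all _ fun s' => ?_)
  simp only
  rw [intervalIntegral.integral_of_le (by norm_num), integral_Icc_eq_integral_Ioc]

theorem measurable_E : Measurable fun z : ℝ × ℝ => E z.1 z.2 := by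
  have hI : Measurable fun r : (ℝ × ℝ) × ℝ => ∫ h' in Icc (-1 : ℝ) 1, Q r.2 r.1.2 h' :=
    StronglyMeasurable.measurable (StronglyMeasurable.integral_prod_right'
      (f := fun r : ((ℝ × ℝ) × ℝ) × ℝ => Q r.1.2 r.1.1.2 r.2)
      (Measurable.stronglyMeasurable (by fun_prop)))
  simp only [E_eq_integral]
  refine StronglyMeasurable.measurable (StronglyMeasurable.integral_prod_right'
    (f := fun r : (ℝ × ℝ) × ℝ => {r : (ℝ × ℝ) × ℝ | r.1.1 < r.2}.indicator
      (fun r => ∫ h' in Icc (-1 : ℝ) 1, Q r.2 r.1.2 h') r) ?_)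
  exact (hI.indicator (measurableSet_lt (by fun_prop) (by fun_prop))).stronglyMeasurable

theorem enorm_E_le (s h : ℝ) :
    ‖E s h‖ₑ ≤ ∫⁻ s' in Ioi s, ∫⁻ h' in Icc (-1 : ℝ) 1, Qe s' h h' := by
  rw [E]
  refine (enorm_integral_le_lintegral_enorm _).trans (lintegral_mono fun s' => ?_)
  rw [intervalIntegral.integral_of_le (by norm_num), ← integral_Icc_eq_integral_Ioc]
  refine (enorm_integral_le_lintegral_enorm _).trans_eq (lintegral_congr fun h' => ?_)
  rw [enorm_Q]

theorem E_eq_zero {s h : ℝ} (hs : 0 ≤ s) (hh : |h| ≤ 1) (h1 : 1 < s * (1 - |h|)) : E s h = 0 := by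
  rw [E]
  refine setIntegral_eq_zero_of_forall_eq_zero fun s' hs' => ?_
  have : ∀ h', Q s' h h' = 0 := fun h' => by
    refine Q_eq_zero_of_lt (hs.trans (le_of_lt hs')) h h' (Or.inl (h1.trans_le ?_))
    exact mul_le_mul_of_nonneg_right (le_of_lt hs') (by linarith)
  simp [this]

/-- The equilibrium density is of order `1 / s`, and it is supported where `|h|` is within `1 / s`
of `1`. -/
theorem ae_enorm_E_le : ∀ᵐ h ∂volume.restrict (Icc (-1 : ℝ) 1), ∀ s, 0 ≤ s →
    ‖E s h‖ₑ ≤ {h | s * (1 - |h|) ≤ 1}.indicator (fun _ => ENNReal.ofReal (9 / (1 + s))) h := by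
  filter_upwards [ae_lintegral_Qe, ae_restrict_mem measurableSet_Icc] with h h1 hm s hs
  have hh : |h| ≤ 1 := abs_le.mpr hm
  by_cases hc : s * (1 - |h|) ≤ 1
  · rw [indicator_of_mem (by exact hc)]
    refine (enorm_E_le s h).trans ?_
    -- `min (1, 8 / s) ≤ 9 / (1 + s)`, with equality at `s = 8`
    rcases le_or_gt s 8 with h8 | h8
    · calc ∫⁻ s' in Ioi s, ∫⁻ h' in Icc (-1 : ℝ) 1, Qe s' h h'
          ≤ ∫⁻ s', ∫⁻ h' in Icc (-1 : ℝ) 1, Qe s' h h' := setLIntegral_le_lintegral _ _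
        _ = 1 := by rw [← h1, lintegral_stripMeasure (by fun_prop)]
        _ ≤ ENNReal.ofReal (9 / (1 + s)) := by
          rw [ENNReal.one_le_ofReal, le_div_iff₀ (by linarith)]
          linarith
    · have hs0 : 0 < s := by linarith
      calc ∫⁻ s' in Ioi s, ∫⁻ h' in Icc (-1 : ℝ) 1, Qe s' h h'
          ≤ ∫⁻ s' in Ioi s, ENNReal.ofReal (8 / s' ^ 2) :=
            setLIntegral_mono' measurableSet_Ioi fun s' hs' => lintegral_Qe_le (hs0.trans hs') hh
        _ = ENNReal.ofReal (8 / s) := lintegral_ofReal_div_sq (by norm_num) hs0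
        _ ≤ _ := by
          refine ENNReal.ofReal_le_ofReal ?_
          rw [div_le_div_iff₀ hs0 (by linarith)]
          linarith
  · rw [E_eq_zero hs hh (not_le.mp hc), enorm_zero]
    exact zero_le

/-- The set where `|h|` is within `1 / s` of `1` is small. -/
theorem volume_support_E_le {s : ℝ} (hs : 0 ≤ s) :
    volume.restrict (Icc (-1 : ℝ) 1) {h | s * (1 - |h|) ≤ 1} ≤ ENNReal.ofReal (4 / (1 + s)) := by
  rcases le_or_gt s 1 with h1 | h1
  · calc volume.restrict (Icc (-1 : ℝ) 1) {h | s * (1 - |h|) ≤ 1}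
        ≤ volume.restrict (Icc (-1 : ℝ) 1) univ := measure_mono (subset_univ _)
      _ = ENNReal.ofReal 2 := by
          rw [Measure.restrict_apply_univ, Real.volume_Icc]; norm_num
      _ ≤ _ := by
          refine ENNReal.ofReal_le_ofReal ?_
          rw [le_div_iff₀ (by linarith)]
          linarith
  · have hs0 : 0 < s := by linarith
    calc volume.restrict (Icc (-1 : ℝ) 1) {h | s * (1 - |h|) ≤ 1}
        ≤ volume (Icc (-1) (-1 + 1 / s) ∪ Icc (1 - 1 / s) 1) := by
          rw [Measure.restrict_apply' measurableSet_Icc]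
          refine measure_mono fun h hm => ?_
          obtain ⟨hm1, hm2, hm3⟩ := hm
          have hm4 : 1 - |h| ≤ 1 / s := by
            rw [le_div_iff₀ hs0, mul_comm]; exact hm1
          rcases le_total 0 h with h0 | h0
          · rw [abs_of_nonneg h0] at hm4
            exact Or.inr ⟨by linarith, hm3⟩
          · rw [abs_of_nonpos h0] at hm4
            exact Or.inl ⟨hm2, by linarith⟩
      _ ≤ ENNReal.ofReal (1 / s) + ENNReal.ofReal (1 / s) := by
          refine (measure_union_le _ _).trans_eq ?_
          rw [Real.volume_Icc, Real.volume_Icc]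
          congr 2 <;> ring
      _ ≤ _ := by
          rw [← ENNReal.ofReal_add (by positivity) (by positivity)]
          refine ENNReal.ofReal_le_ofReal ?_
          rw [← add_div, div_le_div_iff₀ hs0 (by linarith)]
          linarith

theorem lintegral_enorm_E_le {a : ℝ} (ha : 0 ≤ a) :
    ∫⁻ z, ‖E z.1 z.2‖ₑ ∂(volume.restrict (Ici a)).prod (volume.restrict (Icc (-1 : ℝ) 1)) ≤
      ENNReal.ofReal (36 / (1 + a)) := by
  rw [lintegral_prod _ measurable_E.enorm.aemeasurable]
  calc ∫⁻ s in Ici a, (∫⁻ h in Icc (-1 : ℝ) 1, ‖E s h‖ₑ)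
      ≤ ∫⁻ s in Ici a, ENNReal.ofReal (36 / (1 + s) ^ 2) := by
        refine setLIntegral_mono' measurableSet_Ici fun s hs => ?_
        have hs0 : 0 ≤ s := ha.trans hs
        have hm : MeasurableSet {h : ℝ | s * (1 - |h|) ≤ 1} :=
          measurableSet_le (by fun_prop) (by fun_prop)
        calc ∫⁻ h in Icc (-1 : ℝ) 1, ‖E s h‖ₑ
            ≤ ∫⁻ h in Icc (-1 : ℝ) 1, {h | s * (1 - |h|) ≤ 1}.indicator
                (fun _ => ENNReal.ofReal (9 / (1 + s))) h := by
              refine lintegral_mono_ae ?_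
              filter_upwards [ae_enorm_E_le] with h hh using hh s hs0
          _ ≤ ENNReal.ofReal (9 / (1 + s)) * ENNReal.ofReal (4 / (1 + s)) := by
              rw [lintegral_indicator_const hm]
              gcongr
              exact volume_support_E_le hs0
          _ = _ := by
              rw [← ENNReal.ofReal_mul (by positivity)]
              congr 1
              field_simp
              norm_num
    _ = ∫⁻ s in Ioi a, ENNReal.ofReal (36 / (1 + s) ^ 2) := by
        rw [restrict_Ioi_eq_restrict_Ici]
    _ = ∫⁻ s in Ioi (1 + a), ENNReal.ofReal (36 / s ^ 2) := by
        rw [← lintegral_indicator measurableSet_Ioi, ← lintegral_indicator measurableSet_Ioi,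
          ← lintegral_add_left_eq_self ((Ioi (1 + a)).indicator _) 1]
        refine lintegral_congr fun s => ?_
        simp only [indicator_apply, mem_Ioi, add_lt_add_iff_left]
    _ = _ := lintegral_ofReal_div_sq (by norm_num) (by linarith)

theorem ae_enorm_E_le_of_le {a : ℝ} (ha : 0 ≤ a) :
    ∀ᵐ z ∂(volume.restrict (Ici a)).prod (volume.restrict (Icc (-1 : ℝ) 1)),
      ‖E z.1 z.2‖ₑ ≤ ENNReal.ofReal (36 / (1 + a)) := by
  have h1 : ∀ᵐ z : ℝ × ℝ ∂(volume.restrict (Ici a)).prod (volume.restrict (Icc (-1 : ℝ) 1)),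
      a ≤ z.1 := Measure.quasiMeasurePreserving_fst.ae (ae_restrict_mem measurableSet_Ici)
  filter_upwards [h1, Measure.quasiMeasurePreserving_snd.ae ae_enorm_E_le] with z hz1 hz2
  refine (hz2 z.1 (ha.trans hz1)).trans ((indicator_le_self' (fun _ _ => zero_le) _).trans ?_)
  refine ENNReal.ofReal_le_ofReal ?_
  have := ha.trans hz1
  gcongr
  norm_num

/-- The product with the equilibrium density is a bounded operation on `L^p`, with a norm that
decays when short flights are left out. -/
theorem eLpNorm_E_smul_le {W F : Type*} [MeasurableSpace W] {m : Measure W} [SFinite m]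
    [NormedAddCommGroup F] [NormedSpace ℝ F] {φ : W → F} (hφ : AEStronglyMeasurable φ m)
    {p : ℝ≥0∞} (hp : 1 ≤ p) {a : ℝ} (ha : 0 ≤ a) :
    eLpNorm (fun z : W × ℝ × ℝ => E z.2.1 z.2.2 • φ z.1) p
        (m.prod ((volume.restrict (Ici a)).prod (volume.restrict (Icc (-1 : ℝ) 1)))) ≤
      ENNReal.ofReal (36 / (1 + a)) * eLpNorm φ p m := by
  set n := (volume.restrict (Ici a)).prod (volume.restrict (Icc (-1 : ℝ) 1)) with hn
  have hE := measurable_E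
  have hg : Measurable fun w => ‖hφ.mk φ w‖ₑ := hφ.stronglyMeasurable_mk.enorm
  -- Schur's test for multiplication by `E`, as an operator from functions of `w` to functions of
  -- `(w, s, h)`: both the supremum and the `L¹` norm of `E` enter
  have h := eLpNorm_lintegral_mul_comp_le (Z₁ := W × ℝ × ℝ) (V := Unit) (m₁ := m.prod n) (m₂ := m)
    (ν := Measure.dirac ()) (N := fun q => ‖E q.1.2.1 q.1.2.2‖ₑ) (Φ := fun q => q.1.1)
    (a := ENNReal.ofReal (36 / (1 + a))) (by fun_prop) (by fun_prop)
    (by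
      filter_upwards [Measure.quasiMeasurePreserving_snd.ae (ae_enorm_E_le_of_le ha)] with z hz
      simpa using hz)
    (fun G hG => by
      simp only [lintegral_dirac]
      rw [lintegral_prod _ (by fun_prop)]
      have : ∀ w, ∫⁻ z, ‖E z.1 z.2‖ₑ * G w ∂n = (∫⁻ z, ‖E z.1 z.2‖ₑ ∂n) * G w := fun w =>
        lintegral_mul_const _ (by fun_prop)
      simp only [this]
      rw [lintegral_const_mul _ hG]
      gcongr
      exact lintegral_enorm_E_le ha) hg hp
  rw [eLpNorm_enorm, ← eLpNorm_congr_ae hφ.ae_eq_mk] at h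
  refine le_trans (eLpNorm_mono_enorm_ae ?_) h
  filter_upwards [Measure.quasiMeasurePreserving_fst.ae hφ.ae_eq_mk] with z hz
  rw [enorm_smul, hz, lintegral_dirac, enorm_eq_self]

theorem aestronglyMeasurable_E_smul {W F : Type*} [MeasurableSpace W] {m : Measure W} [SFinite m]
    [NormedAddCommGroup F] [NormedSpace ℝ F] {φ : W → F} (hφ : AEStronglyMeasurable φ m)
    (n : Measure (ℝ × ℝ)) [SFinite n] :
    AEStronglyMeasurable (fun z : W × ℝ × ℝ => E z.2.1 z.2.2 • φ z.1) (m.prod n) :=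
  (measurable_E.comp measurable_snd).aestronglyMeasurable.smul hφ.comp_fst

section Product

variable {X : Type} [MeasureSpace X] [SFinite (volume : Measure X)] {χ : X → ℂ}
  {μin : X × Circle2Pi → ℝ}

theorem memLp_productDatum {p : ℝ≥0∞} (hp : 1 ≤ p) (h : MemLp μin p volume) :
    MemLp (productDatum μin) p (phaseMeasure X) := by
  have hmp := measurePreserving_prodAssoc (volume : Measure X) (volume : Measure Circle2Pi)
    ((volume.restrict (Ici (0 : ℝ))).prod (volume.restrict (Icc (-1 : ℝ) 1)))
  have he : productDatum μin ∘ MeasurableEquiv.prodAssoc =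
      fun z : (X × Circle2Pi) × ℝ × ℝ => E z.2.1 z.2.2 • μin z.1 := by
    ext z
    exact mul_comm _ _
  rw [phaseMeasure, collisionMeasure,
    ← hmp.map_eq, MeasurableEquiv.prodAssoc.memLp_map_measure_iff, he]
  refine ⟨aestronglyMeasurable_E_smul h.1 _, (eLpNorm_E_smul_le h.1 hp le_rfl).trans_lt ?_⟩
  exact ENNReal.mul_lt_top ENNReal.ofReal_lt_top h.2

theorem aestronglyMeasurable_partialTransform (hχm : Measurable χ) {Y : Type} [MeasurableSpace Y]
    {n : Measure Y} [SFinite n] {g : X × Y → ℝ}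
    (hg : AEStronglyMeasurable g ((volume : Measure X).prod n)) :
    AEStronglyMeasurable (partialTransform χ g) n := by
  refine AEStronglyMeasurable.integral_prod_right' (μ := n) (ν := (volume : Measure X))
    (f := fun z : Y × X => χ z.2 * (g z.swap : ℂ)) ?_
  exact (hχm.comp measurable_snd).aestronglyMeasurable.mul
    (Complex.continuous_ofReal.comp_aestronglyMeasurable
      (hg.comp_measurePreserving Measure.measurePreserving_swap))

theorem eLpNorm_partialTransform_productDatum_le (hχm : Measurable χ) {p : ℝ≥0∞} (hp : 1 ≤ p)
    (h : AEStronglyMeasurable μin volume) {a : ℝ} (ha : 0 ≤ a) :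
    eLpNorm (partialTransform χ (productDatum μin)) p (collisionMeasure a) ≤
      ENNReal.ofReal (36 / (1 + a)) * eLpNorm (partialTransform χ μin) p volume := by
  have he : partialTransform χ (productDatum μin) =
      fun y : Circle2Pi × ℝ × ℝ => E y.2.1 y.2.2 • partialTransform χ μin y.1 := by
    ext y
    simp only [partialTransform, productDatum, Complex.ofReal_mul, ← mul_assoc]
    rw [integral_mul_const, mul_comm, Complex.real_smul]
  rw [he]
  exact eLpNorm_E_smul_le (aestronglyMeasurable_partialTransform hχm h) hp ha

/-- The Fourier coefficient is a contraction in `L^p` over a space of mass at most `1`. -/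
theorem eLpNorm_partialTransform_le (hχ1 : ∀ x, ‖χ x‖ = 1) {Y : Type} [MeasurableSpace Y]
    {n : Measure Y} [SFinite n] {g : X × Y → ℝ}
    (hg : AEStronglyMeasurable g ((volume : Measure X).prod n)) {p : ℝ≥0∞} (hp : 1 ≤ p)
    (hX : (volume : Measure X) univ ≤ 1) :
    eLpNorm (partialTransform χ g) p n ≤ eLpNorm g p ((volume : Measure X).prod n) := by
  have hm : Measurable fun z => ‖hg.mk g z‖ₑ := hg.stronglyMeasurable_mk.enorm
  have h := eLpNorm_lintegral_mul_comp_le (Z₁ := Y) (V := X) (m₁ := n)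
    (m₂ := (volume : Measure X).prod n) (ν := (volume : Measure X)) (N := fun _ => 1)
    (Φ := Prod.swap) (a := 1) measurable_const measurable_swap
    (ae_of_all _ fun y => by simpa using hX)
    (fun G hG => by
      simp only [one_mul, Prod.swap_prod_mk]
      rw [lintegral_prod_symm' _ hG]) hm hp
  rw [one_mul, eLpNorm_enorm, ← eLpNorm_congr_ae hg.ae_eq_mk] at h
  refine le_trans (eLpNorm_mono_enorm_ae ?_) h
  filter_upwards [ae_ae_swap_of_ae_prod hg.ae_eq_mk] with y hy
  refine (enorm_integral_le_lintegral_enorm _).trans (le_of_eq ?_)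
  rw [enorm_eq_self]
  refine lintegral_congr_ae ?_
  filter_upwards [hy] with x hx
  rw [enorm_mul, ← ofReal_norm, hχ1, ENNReal.ofReal_one, ← ofReal_norm, Complex.norm_real,
    ofReal_norm, hx]
  rfl

/-- The Fourier coefficient is a contraction from `L¹` to `L¹`, whatever the mass of the space. -/
theorem eLpNorm_one_partialTransform_le (hχ1 : ∀ x, ‖χ x‖ = 1) {Y : Type} [MeasurableSpace Y]
    {n : Measure Y} [SFinite n] {g : X × Y → ℝ}
    (hg : AEStronglyMeasurable g ((volume : Measure X).prod n)) :
    eLpNorm (partialTransform χ g) 1 n ≤ eLpNorm g 1 ((volume : Measure X).prod n) := by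
  rw [eLpNorm_one_eq_lintegral_enorm, eLpNorm_one_eq_lintegral_enorm,
    lintegral_prod_symm _ hg.enorm]
  refine lintegral_mono fun y => ?_
  refine (enorm_integral_le_lintegral_enorm _).trans_eq (lintegral_congr fun x => ?_)
  rw [enorm_mul, ← ofReal_norm, hχ1, ENNReal.ofReal_one, one_mul, ← ofReal_norm, Complex.norm_real,
    ofReal_norm]

end Product

/-! ### The two estimates over a quotient of the plane -/

section Estimates

variable {X : Type} [AddCommGroup X] [MeasureSpace X] [MeasurableAdd X] [MeasurableSub₂ X]
  [SFinite (volume : Measure X)] [(volume : Measure X).IsAddRightInvariant]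
  {proj : Plane → X} {χ : X → ℂ} {k : Plane} {μ : ℝ → X × Circle2Pi × ℝ × ℝ → ℝ}

/-- Decay of a mode for a general datum. -/
theorem IsMildSolution.decay {μ₀ : X × Circle2Pi × ℝ × ℝ → ℝ} (hμ : IsMildSolution proj μ₀ μ)
    (hk : k ≠ 0) (hproj : Measurable proj) (hχm : Measurable χ) (hχ1 : ∀ x, ‖χ x‖ = 1)
    (hχ : ∀ x d, χ (x + proj d) = χ x * Complex.exp (2 * Real.pi * Complex.I * (inner ℝ k d : ℝ)))
    {A : ℝ} (hA : 180 * (4657 / gap k ^ 3) ≤ A) (hμ₀ : MemLp μ₀ 1 (phaseMeasure X)) {p : ℝ≥0∞}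
    (hp : 1 ≤ p) (hfin : eLpNorm (partialTransform χ μ₀) p (collisionMeasure 0) ≠ ∞) {t : ℝ}
    (ht : 0 ≤ t) :
    Integrable (μ t) (phaseMeasure X) ∧
    MemLp (partialTransform χ (μ t)) p (collisionMeasure 0) ∧
    eLpNorm (partialTransform χ (μ t)) p (collisionMeasure 0) ≤
      ENNReal.ofReal A *
          ((eLpNorm (partialTransform χ μ₀) 1 (collisionMeasure 0) +
            eLpNorm (partialTransform χ μ₀) p (collisionMeasure 0)) / ENNReal.ofReal (t + 1)) +
        ENNReal.ofReal A *
          (eLpNorm (partialTransform χ μ₀) 1 (collisionMeasure (t / 4)) +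
            eLpNorm (partialTransform χ μ₀) p (collisionMeasure (t / 4))) := by
  obtain ⟨h1, h2, h3⟩ := hμ.eLpNorm_partialTransform_le hk hproj hχm hχ1 hχ hμ₀ hp ht
  have hδ := gap_pos hk
  have hδ3 : 0 < gap k ^ 3 := by positivity
  have h4657 : 4657 / gap k ^ 3 ≤ A := by
    have : 0 < 4657 / gap k ^ 3 := by positivity
    linarith
  have h4656 : 4656 / gap k ^ 3 ≤ A := le_trans (by gcongr; norm_num) h4657
  have hmono : eLpNorm (partialTransform χ μ₀) p (collisionMeasure (t / 4)) ≤
      eLpNorm (partialTransform χ μ₀) p (collisionMeasure 0) := by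
    refine eLpNorm_mono_measure _ ?_
    rw [collisionMeasure_eq_restrict, collisionMeasure_eq_restrict]
    exact Measure.restrict_mono_set _ fun y (hy : t / 4 ≤ y.2.1) =>
      show 0 ≤ y.2.1 by linarith
  refine ⟨h1, ⟨h2, h3.trans_lt ?_⟩, h3.trans ?_⟩
  · have ht1 : ENNReal.ofReal (t + 1) ≠ 0 := by
      rw [Ne, ENNReal.ofReal_eq_zero]; linarith
    exact ENNReal.add_lt_top.mpr
      ⟨ENNReal.mul_lt_top ENNReal.ofReal_lt_top (ENNReal.div_lt_top hfin ht1),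
        ENNReal.mul_lt_top ENNReal.ofReal_lt_top (hmono.trans_lt hfin.lt_top)⟩
  · gcongr <;> exact le_add_self

/-- Decay of a mode for a datum in equilibrium in the variables `(s, h)`. -/
theorem IsMildSolution.decay_productDatum {μin : X × Circle2Pi → ℝ}
    (hμ : IsMildSolution proj (productDatum μin) μ) (hk : k ≠ 0) (hproj : Measurable proj)
    (hχm : Measurable χ) (hχ1 : ∀ x, ‖χ x‖ = 1)
    (hχ : ∀ x d, χ (x + proj d) = χ x * Complex.exp (2 * Real.pi * Complex.I * (inner ℝ k d : ℝ)))
    {A : ℝ} (hA : 180 * (4657 / gap k ^ 3) ≤ A) (hin : MemLp μin 1 volume) {p : ℝ≥0∞}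
    (hp : 1 ≤ p) {t : ℝ} (ht : 0 ≤ t) :
    eLpNorm (partialTransform χ (μ t)) p (collisionMeasure 0) ≤
      ENNReal.ofReal (A / (t + 1)) * eLpNorm (partialTransform χ μin) p volume := by
  obtain ⟨-, -, h3⟩ := hμ.eLpNorm_partialTransform_le hk hproj hχm hχ1 hχ
    (memLp_productDatum le_rfl hin) hp ht
  have hδ := gap_pos hk
  have ht1 : 0 < t + 1 := by linarith
  set N := eLpNorm (partialTransform χ μin) p volume with hN
  calc eLpNorm (partialTransform χ (μ t)) p (collisionMeasure 0)
      ≤ ENNReal.ofReal (4656 / gap k ^ 3) * (ENNReal.ofReal (36 / (1 + 0)) * N /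
            ENNReal.ofReal (t + 1)) +
          ENNReal.ofReal (4657 / gap k ^ 3) * (ENNReal.ofReal (36 / (1 + t / 4)) * N) := by
        refine h3.trans ?_
        gcongr
        · exact eLpNorm_partialTransform_productDatum_le hχm hp hin.1 le_rfl
        · exact eLpNorm_partialTransform_productDatum_le hχm hp hin.1 (by positivity)
    _ = ENNReal.ofReal (4656 / gap k ^ 3 * (36 / (1 + 0) / (t + 1)) +
          4657 / gap k ^ 3 * (36 / (1 + t / 4))) * N := by
        rw [ENNReal.ofReal_add (p := 4656 / gap k ^ 3 * (36 / (1 + 0) / (t + 1))) (by positivity)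
          (by positivity), add_mul,
          ENNReal.ofReal_mul (by positivity), ENNReal.ofReal_mul (by positivity),
          ENNReal.ofReal_div_of_pos ht1, ENNReal.div_eq_inv_mul, ENNReal.div_eq_inv_mul]
        ring
    _ ≤ ENNReal.ofReal (A / (t + 1)) * N := by
        refine mul_le_mul_left (ENNReal.ofReal_le_ofReal ?_) _
        rw [le_div_iff₀ ht1]
        refine le_trans ?_ hA
        have h4 : 36 / (1 + t / 4) * (t + 1) ≤ 144 := by
          rw [div_mul_eq_mul_div, div_le_iff₀ (by positivity)]
          linarith
        calc (4656 / gap k ^ 3 * (36 / (1 + 0) / (t + 1)) +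
              4657 / gap k ^ 3 * (36 / (1 + t / 4))) * (t + 1)
            = 4656 / gap k ^ 3 * 36 + 4657 / gap k ^ 3 * (36 / (1 + t / 4) * (t + 1)) := by
              field_simp
              ring
          _ ≤ 4657 / gap k ^ 3 * 36 + 4657 / gap k ^ 3 * 144 := by
              gcongr
              norm_num
          _ = 180 * (4657 / gap k ^ 3) := by ring

end Estimates

/-! ### The characters of the torus and of the plane -/

/-- An integer frequency as a vector of the plane. -/
def latticeVector (k : Fin 2 → ℤ) : Plane := WithLp.toLp 2 fun i => (k i : ℝ)

theorem one_le_norm_latticeVector {k : Fin 2 → ℤ} (hk : k ≠ 0) : 1 ≤ ‖latticeVector k‖ := by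
  obtain ⟨i, hi⟩ := Function.ne_iff.mp hk
  refine le_trans ?_ (PiLp.norm_apply_le (latticeVector k) i)
  have h1 : (1 : ℝ) ≤ |(k i : ℝ)| := by exact_mod_cast Int.one_le_abs hi
  exact h1

theorem latticeVector_ne_zero {k : Fin 2 → ℤ} (hk : k ≠ 0) : latticeVector k ≠ 0 :=
  norm_pos_iff.mp (zero_lt_one.trans_le (one_le_norm_latticeVector hk))

theorem gap_latticeVector {k : Fin 2 → ℤ} (hk : k ≠ 0) : gap (latticeVector k) = 1 / 240000 := by
  rw [gap, min_eq_left (one_le_pow₀ (one_le_norm_latticeVector hk))]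

/-- The source of the power `|k|⁶`. -/
theorem gap_pow_three (k : Plane) : gap k ^ 3 = min 1 (‖k‖ ^ 6) / 240000 ^ 3 := by
  rw [gap, div_pow]
  congr 1
  rcases le_total (‖k‖ ^ 2) 1 with h | h
  · rw [min_eq_right h, min_eq_right, ← pow_mul]
    rw [show 6 = 2 * 3 by norm_num, pow_mul]
    exact pow_le_one₀ (by positivity) h
  · rw [min_eq_left h, min_eq_left, one_pow]
    rw [show 6 = 2 * 3 by norm_num, pow_mul]
    exact one_le_pow₀ h

theorem measurable_torusProj : Measurable torusProj := by
  refine measurable_pi_lambda _ fun i => ?_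
  exact (AddCircle.continuous_mk' (1 : ℝ)).measurable.comp (by fun_prop)

theorem norm_mFourier (k : Fin 2 → ℤ) (x : Torus) : ‖UnitAddTorus.mFourier k x‖ = 1 := by
  change ‖∏ i, fourier (k i) (x i)‖ = 1
  rw [norm_prod]
  exact Finset.prod_eq_one fun i _ => by rw [fourier_apply]; exact Circle.norm_coe _

/-- The characters of the torus pull back to exponentials on the plane. -/
theorem mFourier_add_torusProj (k : Fin 2 → ℤ) (x : Torus) (d : Plane) :
    UnitAddTorus.mFourier k (x + torusProj d) = UnitAddTorus.mFourier k x *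
      Complex.exp (2 * Real.pi * Complex.I * (inner ℝ (latticeVector k) d : ℝ)) := by
  have hadd : ∀ i, fourier (k i) ((x + torusProj d) i) =
      fourier (k i) (x i) * Complex.exp (2 * Real.pi * Complex.I * (k i * d i : ℝ)) := by
    intro i
    have h1 : fourier (k i) ((d i : ℝ) : UnitAddCircle) =
        Complex.exp (2 * Real.pi * Complex.I * (k i * d i : ℝ)) := by
      rw [fourier_coe_apply]
      push_cast
      ring_nf
    rw [← h1, Pi.add_apply, fourier_apply, smul_add, AddCircle.toCircle_add, Circle.coe_mul]
    rfl
  change ∏ i, fourier (k i) ((x + torusProj d) i) = (∏ i, fourier (k i) (x i)) * _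
  simp only [hadd]
  have he : inner ℝ (latticeVector k) d = ∑ i, (k i : ℝ) * d i := by
    rw [PiLp.inner_apply]
    exact Finset.sum_congr rfl fun i _ => mul_comm _ _
  rw [Finset.prod_mul_distrib, ← Complex.exp_sum, he, Complex.ofReal_sum, Finset.mul_sum]

theorem volume_torus_univ : (volume : Measure Torus) univ = 1 := by
  rw [volume_pi, Measure.pi_univ]
  simp

theorem norm_exp_inner (k x : Plane) :
    ‖Complex.exp (2 * Real.pi * Complex.I * (inner ℝ k x : ℝ))‖ = 1 := by
  rw [show 2 * Real.pi * Complex.I * (inner ℝ k x : ℝ) =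
    ((2 * Real.pi * inner ℝ k x : ℝ) : ℂ) * Complex.I by push_cast; ring]
  exact Complex.norm_exp_ofReal_mul_I _

theorem exp_inner_add (k x d : Plane) :
    Complex.exp (2 * Real.pi * Complex.I * (inner ℝ k (x + id d) : ℝ)) =
      Complex.exp (2 * Real.pi * Complex.I * (inner ℝ k x : ℝ)) *
        Complex.exp (2 * Real.pi * Complex.I * (inner ℝ k d : ℝ)) := by
  rw [id, inner_add_right, Complex.ofReal_add, mul_add, Complex.exp_add]

end LorentzGas

end

theorem theorem2 :
    ∃ C : ℝ, 0 < C ∧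
      -- the torus, every exponent `p` and every nonzero frequency `k`
      (∀ p : ℝ≥0∞, 1 ≤ p → ∀ k : Fin 2 → ℤ, k ≠ 0 →
        (∀ μ₀ : Torus × Circle2Pi × ℝ × ℝ → ℝ,
          MemLp μ₀ 1 (phaseMeasure Torus) → MemLp μ₀ p (phaseMeasure Torus) →
          ∀ μ : ℝ → Torus × Circle2Pi × ℝ × ℝ → ℝ, IsMildSolution torusProj μ₀ μ →
          ∀ t : ℝ, 0 ≤ t →
            Integrable (μ t) (phaseMeasure Torus) ∧
            MemLp (torusCoeff k (μ t)) p (collisionMeasure 0) ∧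
            eLpNorm (torusCoeff k (μ t)) p (collisionMeasure 0) ≤
              ENNReal.ofReal C *
                  ((eLpNorm (torusCoeff k μ₀) 1 (collisionMeasure 0) +
                    eLpNorm (torusCoeff k μ₀) p (collisionMeasure 0)) / ENNReal.ofReal (t + 1)) +
                ENNReal.ofReal C *
                  (eLpNorm (torusCoeff k μ₀) 1 (collisionMeasure (t / 4)) +
                    eLpNorm (torusCoeff k μ₀) p (collisionMeasure (t / 4)))) ∧
        (∀ μin : Torus × Circle2Pi → ℝ, MemLp μin p volume →
          MemLp (productDatum μin) 1 (phaseMeasure Torus) ∧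
          MemLp (productDatum μin) p (phaseMeasure Torus) ∧
          ∀ μ : ℝ → Torus × Circle2Pi × ℝ × ℝ → ℝ,
            IsMildSolution torusProj (productDatum μin) μ →
            ∀ t : ℝ, 0 ≤ t →
              eLpNorm (torusCoeff k (μ t)) p (collisionMeasure 0) ≤
                ENNReal.ofReal (C / (t + 1)) * eLpNorm (torusCoeff k μin) p volume)) ∧
      -- the plane, `p = 1` and every nonzero frequency `k`
      (∀ k : Plane, k ≠ 0 →
        (∀ μ₀ : Plane × Circle2Pi × ℝ × ℝ → ℝ,
          MemLp μ₀ 1 (phaseMeasure Plane) →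
          ∀ μ : ℝ → Plane × Circle2Pi × ℝ × ℝ → ℝ, IsMildSolution id μ₀ μ →
          ∀ t : ℝ, 0 ≤ t →
            Integrable (μ t) (phaseMeasure Plane) ∧
            MemLp (planeCoeff k (μ t)) 1 (collisionMeasure 0) ∧
            eLpNorm (planeCoeff k (μ t)) 1 (collisionMeasure 0) ≤
              ENNReal.ofReal (C / min 1 (‖k‖ ^ 6)) *
                  ((eLpNorm (planeCoeff k μ₀) 1 (collisionMeasure 0) +
                    eLpNorm (planeCoeff k μ₀) 1 (collisionMeasure 0)) / ENNReal.ofReal (t + 1)) +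
                ENNReal.ofReal (C / min 1 (‖k‖ ^ 6)) *
                  (eLpNorm (planeCoeff k μ₀) 1 (collisionMeasure (t / 4)) +
                    eLpNorm (planeCoeff k μ₀) 1 (collisionMeasure (t / 4)))) ∧
        (∀ μin : Plane × Circle2Pi → ℝ, MemLp μin 1 volume →
          MemLp (productDatum μin) 1 (phaseMeasure Plane) ∧
          ∀ μ : ℝ → Plane × Circle2Pi × ℝ × ℝ → ℝ,
            IsMildSolution id (productDatum μin) μ →
            ∀ t : ℝ, 0 ≤ t →
              eLpNorm (planeCoeff k (μ t)) 1 (collisionMeasure 0) ≤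
                ENNReal.ofReal (C / min 1 (‖k‖ ^ 6) / (t + 1)) *
                  eLpNorm (planeCoeff k μin) 1 volume)) := by
  have hpow : ∀ k : Plane, 4657 / gap k ^ 3 = 4657 * 240000 ^ 3 / min 1 (‖k‖ ^ 6) := fun k => by
    rw [gap_pow_three, div_div_eq_mul_div]
  refine ⟨180 * (4657 * 240000 ^ 3), by positivity, fun p hp k hk => ?_, fun k hk => ?_⟩
  · have hkv := latticeVector_ne_zero hk
    have hA : 180 * (4657 / gap (latticeVector k) ^ 3) ≤ 180 * (4657 * 240000 ^ 3) := by
      rw [gap_latticeVector hk]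
      norm_num
    have hχm : Measurable fun x : Torus => UnitAddTorus.mFourier k x :=
      (UnitAddTorus.mFourier k).continuous.measurable
    refine ⟨fun μ₀ h1 hμp μ hμ t ht => ?_, fun μin hin => ?_⟩
    · exact hμ.decay hkv measurable_torusProj hχm (norm_mFourier k) (mFourier_add_torusProj k) hA h1
        hp (ne_top_of_le_ne_top hμp.2.ne (LorentzGas.eLpNorm_partialTransform_le (norm_mFourier k)
          hμp.1 hp volume_torus_univ.le)) ht
    · have : IsFiniteMeasure (volume : Measure Torus) :=
        ⟨by rw [volume_torus_univ]; exact ENNReal.one_lt_top⟩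
      have hin1 : MemLp μin 1 volume := hin.mono_exponent hp
      exact ⟨memLp_productDatum le_rfl hin1, memLp_productDatum hp hin, fun μ hμ t ht =>
        hμ.decay_productDatum hkv measurable_torusProj hχm (norm_mFourier k)
          (mFourier_add_torusProj k) hA hin1 hp ht⟩
  · have hA : 180 * (4657 / gap k ^ 3) ≤ 180 * (4657 * 240000 ^ 3) / min 1 (‖k‖ ^ 6) := by
      rw [hpow]
      exact (mul_div_assoc _ _ _).ge
    have hχm : Measurable fun x : Plane =>
        Complex.exp (2 * Real.pi * Complex.I * (inner ℝ k x : ℝ)) := by fun_prop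
    refine ⟨fun μ₀ h1 μ hμ t ht => ?_, fun μin hin => ⟨memLp_productDatum le_rfl hin,
      fun μ hμ t ht => ?_⟩⟩
    · exact hμ.decay hk measurable_id hχm (norm_exp_inner k) (exp_inner_add k) hA h1 le_rfl
        (ne_top_of_le_ne_top h1.2.ne (eLpNorm_one_partialTransform_le (norm_exp_inner k) h1.1)) ht
    · exact hμ.decay_productDatum hk measurable_id hχm (norm_exp_inner k) (exp_inner_add k) hA hin
        le_rfl ht
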